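/- Let $f,g:\mathbb R^n\to\mathbb R^n$ and $h:\mathbb R^n\to\mathbb R$ be such that $f$, $g$, $h$ and $L_gh:=h'g$ are of class $C^2$, and consider the system $\dot x=f(x)+g(x)u$, $y=h(x)$. Let $\alpha(\eta,y,y_v,t)\in\mathbb R$ and $a(\eta,y,y_v,t)\in\mathbb R^p$ be of class $C^2$, with derivatives of order at most two that are bounded uniformly in $t\ge 0$ for $(\eta,y,y_v)$ in any compact set. Let $s$ be a bounded measurable $1$-periodic function with $\int_0^1 s=0$, let $S(\sigma)=\int_0^\sigma s(\tau)\,d\tau-\int_0^1\!\int_0^\mu s(\tau)\,d\tau\,d\mu$ be its zero-mean primitive, and assume $S(0)=0$. Let $(\bar x,\bar\eta)$ denote solutions of the nominal closed loop $$\dot{\bar x}=f(\bar x)+g(\bar x)\,\alpha(\bar\eta,h(\bar x),L_gh(\bar x),t),\qquad \dot{\bar\eta}=a(\bar\eta,h(\bar x),L_gh(\bar x),t),$$ and let $K$ be a compact set of initial states (at time $0$), each of which lies in the region of attraction of some (uniformly) exponentially stable equilibrium point of this system. For $\varepsilon>0$, the modified control law with functions $\kappa,\kappa_v$ is $$u=\alpha(\eta,\bar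 y,\bar y_v,t)+s(t/\varepsilon),\qquad \dot\eta=a(\eta,\bar y,\bar y_v,t),$$ $$\bar y=h(x)+\varepsilon\kappa(x,t/\varepsilon)+O(\varepsilon^2),\qquad \bar y_v=L_gh(x)+\varepsilon\kappa_v(x,t/\varepsilon)+O(\varepsilon^2),$$ where $\kappa,\kappa_v$ are required to be $1$-periodic with zero mean over a period in their second argument; solutions are understood in the sense of Carathéodory. Choose $$\kappa(x,\sigma):=-L_gh(x)\,S(\sigma),\qquad \kappa_v(x,\sigma):=-L_g^2h(x)\,S(\sigma),\qquad L_g^2h:=L_g(L_gh).$$ Then: 1. $\kappa$ and $\kappa_v$ are $1$-periodic and have zero mean with respect to $\sigma$. 2. For every bound $R$ on the constants of the two $O(\varepsilon^2)$ terms of the modified control law there are $\varepsilon_0>0$ and $C$ such that for all $\varepsilon\in(0,\varepsilon_0)$ and every initial state in $K$: for all measurable residuals $r,r_v$ with $|r|,|r_v|\le R\varepsilon^2$ on $[0,\infty)$, the system under the modified control law with $\bar y=h(x)+\varepsilon\kappa(x,t/\varepsilon)+r(t)$ and $\bar y_v=L_gh(x)+\varepsilon\kappa_v(x,t/\varepsilon)+r_v(t)$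 has a solution on $[0,\infty)$ with this initial state; and for every solution $(x,\eta)$ on $[0,\infty)$ of the system under the modified control law, and the nominal solution $(\bar x,\bar\eta)$ with the same initial state, one has for all $t\ge 0$ $$|\bar y(t)-h(\bar x(t))|\le C\varepsilon^2,\qquad |\bar y_v(t)-L_gh(\bar x(t))|\le C\varepsilon^2,$$ $$\bigl|h(\bar x)-\bigl(h(x)+\varepsilon\kappa(x,t/\varepsilon)\bigr)\bigr|\le C\varepsilon^2,\qquad \bigl|L_gh(\bar x)-\bigl(L_gh(x)+\varepsilon\kappa_v(x,t/\varepsilon)\bigr)\bigr|\le C\varepsilon^2 .$$ That is, the signals fed to the controller equal $h(\bar x)$ and $L_gh(\bar x)$ up to $O(\varepsilon^2)$, uniformly in $t\ge0$, and the signals $h(\bar x)$, $L_gh(\bar x)$ satisfy the equations by which the modified control law prescribes $\bar y$, $\bar y_v$. 3. (Implementation with the available signals.) For every $T>0$ there are $\varepsilon_0>0$ and $C$ such that for all $\varepsilon\in(0,\varepsilon_0)$ and every initial state in $K$, with nominal solution $(\bar x,\bar\eta)$: the system with $u=\alpha(\eta,h(\bar x(t)),L_gh(\bar x(t)),t)+s(t/\varepsilon)$,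 $\dot\eta=a(\eta,h(\bar x(t)),L_gh(\bar x(t)),t)$ has a solution on $[0,T]$ with the same initial state, and along every such solution the controller is the modified control law with the above $\kappa,\kappa_v$, that is, $h(\bar x)=h(x)+\varepsilon\kappa(x,t/\varepsilon)+O(\varepsilon^2)$ and $L_gh(\bar x)=L_gh(x)+\varepsilon\kappa_v(x,t/\varepsilon)+O(\varepsilon^2)$ on $[0,T]$, with constant $C$ in both $O(\varepsilon^2)$. -/

import Mathlib

open Set Filter Topology MeasureTheory

namespace SignalInjection

/-- Column vectors with the Euclidean norm. -/
abbrev Vec (n : ℕ) : Type := EuclideanSpace ℝ (Fin n)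

/-- Lie derivative `L_g h (x) = h'(x) g(x)` of a scalar function `h` along a vector field `g`. -/
noncomputable def lieDeriv {n : ℕ} (g : Vec n → Vec n) (h : Vec n → ℝ) : Vec n → ℝ :=
  fun x => fderiv ℝ h x (g x)

/-- The zero-mean primitive `S` of a 1-periodic zero-mean signal `s`. -/
noncomputable def zeroMeanPrimitive (s : ℝ → ℝ) : ℝ → ℝ :=
  fun σ => (∫ τ in (0 : ℝ)..σ, s τ) - ∫ μ in (0 : ℝ)..1, ∫ τ in (0 : ℝ)..μ, s τ

/-- Carathéodory solution on the interval `J` of `z' = V t z`, `z t₀ = z₀` (the right-hand side may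
be discontinuous in time, e.g. when a square wave is injected). -/
structure IsSolution {Z : Type*} [NormedAddCommGroup Z] [NormedSpace ℝ Z]
    (V : ℝ → Z → Z) (J : Set ℝ) (t₀ : ℝ) (z₀ : Z) (z : ℝ → Z) : Prop where
  continuousOn : ContinuousOn z J
  intervalIntegrable : ∀ t ∈ J, IntervalIntegrable (fun τ => V τ (z τ)) volume t₀ t
  eq_integral : ∀ t ∈ J, z t = z₀ + ∫ τ in t₀..t, V τ (z τ)

/-- `ze` is a (uniformly) exponentially stable equilibrium point of `z' = V t z`, `t ≥ 0`. The bound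
is required of all solutions on compact intervals, so that finite escape is excluded. -/
def IsExpStableEquilibrium {Z : Type*} [NormedAddCommGroup Z] [NormedSpace ℝ Z]
    (V : ℝ → Z → Z) (ze : Z) : Prop :=
  (∀ t : ℝ, 0 ≤ t → V t ze = 0) ∧
  ∃ ρ > (0 : ℝ), ∃ M > (0 : ℝ), ∃ lam > (0 : ℝ),
    ∀ t₀ T : ℝ, 0 ≤ t₀ → t₀ ≤ T → ∀ (z₀ : Z) (z : ℝ → Z), ‖z₀ - ze‖ ≤ ρ →
      IsSolution V (Icc t₀ T) t₀ z₀ z →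
        ∀ t ∈ Icc t₀ T, ‖z t - ze‖ ≤ M * Real.exp (-lam * (t - t₀)) * ‖z₀ - ze‖

/-- The initial states (at time `0`) from which `z' = V t z` has a solution on `[0, ∞)` that
converges to some exponentially stable equilibrium point: the union of the regions of attraction
of all such points. -/
def attractionRegion {Z : Type*} [NormedAddCommGroup Z] [NormedSpace ℝ Z]
    (V : ℝ → Z → Z) : Set Z :=
  {z₀ | ∃ ze : Z, IsExpStableEquilibrium V ze ∧
    ∃ z : ℝ → Z, IsSolution V (Ici 0) 0 z₀ z ∧ Tendsto z atTop (𝓝 ze)}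

/-- A controller map `b (η, y, yv, t)` is `C²`, and its derivatives up to order two are bounded
uniformly in `t ≥ 0` when `(η, y, yv)` ranges over a compact set. -/
def UniformlyC2 {p : ℕ} {F : Type*} [NormedAddCommGroup F] [NormedSpace ℝ F]
    (b : Vec p → ℝ → ℝ → ℝ → F) : Prop :=
  ContDiff ℝ 2 (fun q : Vec p × ℝ × ℝ × ℝ => b q.1 q.2.1 q.2.2.1 q.2.2.2) ∧
  ∀ Q : Set (Vec p × ℝ × ℝ), IsCompact Q → ∃ B : ℝ, ∀ k : ℕ, k ≤ 2 →
    ∀ η : Vec p, ∀ y yv t : ℝ, (η, y, yv) ∈ Q → 0 ≤ t →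
      ‖iteratedFDeriv ℝ k (fun q : Vec p × ℝ × ℝ × ℝ => b q.1 q.2.1 q.2.2.1 q.2.2.2)
        (η, y, yv, t)‖ ≤ B

/-- Right-hand side of the plant `x' = f x + g x * u` with the dynamic controller
`u = α(η, y, yv, t) + v`, `η' = a(η, y, yv, t)`. -/
def loopField {n p : ℕ} (f g : Vec n → Vec n) (α : Vec p → ℝ → ℝ → ℝ → ℝ)
    (a : Vec p → ℝ → ℝ → ℝ → Vec p) (y yv v t : ℝ) (z : Vec n × Vec p) : Vec n × Vec p :=
  (f z.1 + (α z.2 y yv t + v) • g z.1, a z.2 y yv t)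

/-- The nominal closed-loop system, in which the controller uses `h` and `L_g h`
and nothing is injected. -/
noncomputable def nominalField {n p : ℕ} (f g : Vec n → Vec n) (h : Vec n → ℝ)
    (α : Vec p → ℝ → ℝ → ℝ → ℝ) (a : Vec p → ℝ → ℝ → ℝ → Vec p)
    (t : ℝ) (z : Vec n × Vec p) : Vec n × Vec p :=
  loopField f g α a (h z.1) (lieDeriv g h z.1) 0 t z

/-- The system with injected signal `s (t / ε)` whose controller is fed with the signals
`y t` and `yv t`. -/
noncomputable def injectedField {n p : ℕ} (f g : Vec n → Vec n)
    (α : Vec p → ℝ → ℝ → ℝ → ℝ) (a : Vec p → ℝ → ℝ → ℝ → Vec p) (s : ℝ → ℝ) (ε : ℝ)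
    (y yv : ℝ → ℝ) (t : ℝ) (z : Vec n × Vec p) : Vec n × Vec p :=
  loopField f g α a (y t) (yv t) (s (t / ε)) t z

/-- `(x, η)` is, on the time interval `J` and from the initial state `z₀` at time `0`, a trajectory
of the plant under the modified control law associated with `κ` and `κv`: the controller is fed
with signals `y = h(x) + ε κ(x, t/ε) + O(ε²)` and `yv = L_g h(x) + ε κv(x, t/ε) + O(ε²)`,
where `R` is the constant in both `O(ε²)`. -/
structure IsModifiedLoop {n p : ℕ} (f g : Vec n → Vec n) (h : Vec n → ℝ)
    (α : Vec p → ℝ → ℝ → ℝ → ℝ) (a : Vec p → ℝ → ℝ → ℝ → Vec p) (s : ℝ → ℝ)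
    (κ κv : Vec n → ℝ → ℝ) (ε R : ℝ) (J : Set ℝ) (z₀ : Vec n × Vec p)
    (x : ℝ → Vec n) (η : ℝ → Vec p) (y yv : ℝ → ℝ) : Prop where
  isSolution : IsSolution (injectedField f g α a s ε y yv) J 0 z₀ (fun t => (x t, η t))
  output : ∀ t ∈ J, |y t - (h (x t) + ε * κ (x t) (t / ε))| ≤ R * ε ^ 2
  virtualOutput : ∀ t ∈ J, |yv t - (lieDeriv g h (x t) + ε * κv (x t) (t / ε))| ≤ R * ε ^ 2

/-- `κ(x, σ) = - L_g h(x) S(σ)`. -/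
noncomputable def kappa {n : ℕ} (g : Vec n → Vec n) (h : Vec n → ℝ) (s : ℝ → ℝ) :
    Vec n → ℝ → ℝ :=
  fun x σ => -lieDeriv g h x * zeroMeanPrimitive s σ

/-- `κ_v(x, σ) = - L_g² h(x) S(σ)`. -/
noncomputable def kappaV {n : ℕ} (g : Vec n → Vec n) (h : Vec n → ℝ) (s : ℝ → ℝ) :
    Vec n → ℝ → ℝ :=
  fun x σ => -lieDeriv g (lieDeriv g h) x * zeroMeanPrimitive s σ

end SignalInjection

open SignalInjection

/-!
The injected signal `s (t / ε)` makes the plant state ripple by `ε S(t/ε) g(x)`. The proof removes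
this ripple: the slow state `ξ = x - ε S(t/ε) g(x)` (`slowState`) starts where `x` does, because
`S 0 = 0`, and by Taylor's formula the prescribed outputs `h(x) - ε L_g h(x) S` and
`L_g h(x) - ε L_g² h(x) S` are `h(ξ)` and `L_g h(ξ)` up to `O(ε²)`. In the velocity of `ξ` the terms
of order `ε` that contain the control cancel, and what is left of that order is a Lie bracket times
`S` and a multiple of `s S` (`norm_slow_velocity_sub_le`). Both signals are periodic with mean zero,
so that after integration these terms are of order `ε²` (`norm_integral_periodic_smul_le`). Hence
`(ξ, η)` satisfies the integral equation of the nominal loop on every `[t₀, t]` up to a defect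
`C ε² (1 + (t - t₀))` (`exists_hasDefect_slowState`).

On a bounded horizon Grönwall's inequality turns the defect into a bound `O(ε²)` on the distance to
the nominal trajectory. For all times one uses the exponentially stable equilibrium that attracts the
nominal trajectory: the difference of two nearby trajectories is compared with a trajectory that
starts at the same displacement from the equilibrium. The latter decays by stability, and the
discrepancy is controlled by second differences of the vector field, which are small near the
equilibrium. So over windows of a fixed length the distance is halved up to the defect
(`exists_contraction_near_equilibrium`), and the error does not accumulate (`exists_shadowing`).

These estimates presuppose that the state stays in a fixed ball. They also show that it cannot reach
the boundary of that ball, so a bootstrap argument (`lt_of_bootstrap`) removes the assumption, and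
gives existence of solutions from Carathéodory's theorem for a field that is cut off outside of the
ball (`exists_isSolution_injectedField`).
-/

open Set Filter Topology MeasureTheory

namespace SignalInjection

/-! ### Calculus for Carathéodory trajectories, and averaging against a periodic signal -/

lemma intervalIntegrable_of_norm_le {E : Type*} [NormedAddCommGroup E] {φ : ℝ → E} {a b B : ℝ}
    (hab : a ≤ b) (hm : AEStronglyMeasurable φ (volume.restrict (Ioc a b)))
    (hB : ∀ t ∈ Icc a b, ‖φ t‖ ≤ B) : IntervalIntegrable φ volume a b := by
  rw [intervalIntegrable_iff_integrableOn_Ioc_of_le hab]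
  refine Integrable.of_bound hm B ?_
  filter_upwards [ae_restrict_mem measurableSet_Ioc] with t ht
  exact hB t (Ioc_subset_Icc_self ht)

lemma intervalIntegral_prodMk {E F : Type*} [NormedAddCommGroup E] [NormedSpace ℝ E]
    [CompleteSpace E] [NormedAddCommGroup F] [NormedSpace ℝ F] [CompleteSpace F] {u : ℝ → E}
    {v : ℝ → F} {a b : ℝ} (hu : IntervalIntegrable u volume a b)
    (hv : IntervalIntegrable v volume a b) :
    ∫ τ in a..b, (u τ, v τ) = (∫ τ in a..b, u τ, ∫ τ in a..b, v τ) := by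
  simp only [intervalIntegral, integral_pair hu.1 hv.1, integral_pair hu.2 hv.2, Prod.mk_sub_mk]

/-- Fundamental theorem of calculus along a Carathéodory trajectory `u = u a + ∫ U` with bounded
velocity: `G ∘ u` is Lipschitz, hence absolutely continuous, and the chain rule holds almost
everywhere. -/
lemma integral_fderiv_comp_eq_sub {E F : Type*} [NormedAddCommGroup E] [NormedSpace ℝ E]
    [FiniteDimensional ℝ E] [NormedAddCommGroup F] [NormedSpace ℝ F] [CompleteSpace F]
    {G : E → F} (hG : ContDiff ℝ 1 G) {u U : ℝ → E} {a b B : ℝ} (hab : a ≤ b)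
    (hU : IntervalIntegrable U volume a b) (hB : ∀ t ∈ Icc a b, ‖U t‖ ≤ B)
    (hu : ∀ t ∈ Icc a b, u t = u a + ∫ τ in a..t, U τ) :
    IntervalIntegrable (fun τ => fderiv ℝ G (u τ) (U τ)) volume a b ∧
      ∫ τ in a..b, fderiv ℝ G (u τ) (U τ) = G (u b) - G (u a) := by
  have hB0 : 0 ≤ B := (norm_nonneg _).trans (hB a (left_mem_Icc.2 hab))
  have hUsub : ∀ x ∈ Icc a b, ∀ y ∈ Icc a b, IntervalIntegrable U volume x y := by
    intro x hx y hy
    exact hU.mono_set (by rw [uIcc_of_le hab]; exact uIcc_subset_Icc hx hy)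
  have hulip : LipschitzOnWith (Real.toNNReal B) u (Icc a b) := by
    refine LipschitzOnWith.of_dist_le_mul fun x hx y hy => ?_
    have h1 : u x - u y = ∫ τ in y..x, U τ := by
      rw [hu x hx, hu y hy, add_sub_add_left_eq_sub,
        intervalIntegral.integral_interval_sub_left
          (hUsub _ (left_mem_Icc.2 hab) _ hx) (hUsub _ (left_mem_Icc.2 hab) _ hy)]
    rw [dist_eq_norm, h1, Real.coe_toNNReal _ hB0, Real.dist_eq]
    refine intervalIntegral.norm_integral_le_of_norm_le_const fun t ht => hB t ?_
    exact uIcc_subset_Icc hy hx (uIoc_subset_uIcc ht)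
  have hucont : ContinuousOn u (Icc a b) := hulip.continuousOn
  obtain ⟨ρ, hρ⟩ : ∃ ρ, ∀ t ∈ Icc a b, ‖u t‖ ≤ ρ :=
    isCompact_Icc.exists_bound_of_continuousOn hucont
  obtain ⟨KG, hKG⟩ := (hG.contDiffOn (s := Metric.closedBall (0 : E) ρ)).exists_lipschitzOnWith
    one_ne_zero (convex_closedBall _ _) (isCompact_closedBall _ _)
  have hmaps : MapsTo u (Icc a b) (Metric.closedBall (0 : E) ρ) := fun t ht => by
    simpa using hρ t ht
  have hGu : LipschitzOnWith (KG * Real.toNNReal B) (G ∘ u) (Icc a b) := hKG.comp hulip hmaps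
  have hdG : Continuous (fderiv ℝ G) := hG.continuous_fderiv one_ne_zero
  obtain ⟨D, hD⟩ : ∃ D, ∀ t ∈ Icc a b, ‖fderiv ℝ G (u t)‖ ≤ D :=
    isCompact_Icc.exists_bound_of_continuousOn (hdG.comp_continuousOn hucont)
  have hD0 : 0 ≤ D := (norm_nonneg _).trans (hD a (left_mem_Icc.2 hab))
  set W : ℝ → F := fun τ => fderiv ℝ G (u τ) (U τ) with hW
  have hWB : ∀ t ∈ Icc a b, ‖W t‖ ≤ D * B := fun t ht =>
    (ContinuousLinearMap.le_opNorm _ _).trans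
      (mul_le_mul (hD t ht) (hB t ht) (norm_nonneg _) hD0)
  have hWint : IntervalIntegrable W volume a b := by
    refine intervalIntegrable_of_norm_le hab ?_ hWB
    have h1 : AEStronglyMeasurable (fun τ => fderiv ℝ G (u τ)) (volume.restrict (Ioc a b)) :=
      ((hdG.comp_continuousOn hucont).mono Ioc_subset_Icc_self).aestronglyMeasurable
        measurableSet_Ioc
    exact (isBoundedBilinearMap_apply (𝕜 := ℝ) (E := E)
      (F := F)).continuous.comp_aestronglyMeasurable (h1.prodMk hU.1.aestronglyMeasurable)
  refine ⟨hWint, ?_⟩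
  have hWsub : ∀ x ∈ Icc a b, ∀ y ∈ Icc a b, IntervalIntegrable W volume x y := by
    intro x hx y hy
    exact hWint.mono_set (by rw [uIcc_of_le hab]; exact uIcc_subset_Icc hx hy)
  have hIlip : LipschitzOnWith (Real.toNNReal (D * B)) (fun t => ∫ τ in a..t, W τ) (Icc a b) := by
    refine LipschitzOnWith.of_dist_le_mul fun x hx y hy => ?_
    rw [dist_eq_norm, intervalIntegral.integral_interval_sub_left
      (hWsub _ (left_mem_Icc.2 hab) _ hx) (hWsub _ (left_mem_Icc.2 hab) _ hy),
      Real.coe_toNNReal _ (by positivity), Real.dist_eq]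
    refine intervalIntegral.norm_integral_le_of_norm_le_const fun t ht => hWB t ?_
    exact uIcc_subset_Icc hy hx (uIoc_subset_uIcc ht)
  have hac : AbsolutelyContinuousOnInterval ((G ∘ u) - fun t => ∫ τ in a..t, W τ) a b := by
    refine AbsolutelyContinuousOnInterval.sub ?_ ?_
    · exact LipschitzOnWith.absolutelyContinuousOnInterval (by rwa [uIcc_of_le hab])
    · exact LipschitzOnWith.absolutelyContinuousOnInterval (by rwa [uIcc_of_le hab])
  have hae : ∀ᵐ t, t ∈ uIcc a b →
      HasDerivAt ((G ∘ u) - fun t => ∫ τ in a..t, W τ) 0 t := by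
    have hna : ∀ᵐ t : ℝ, t ≠ a := by simp [ae_iff, measure_singleton]
    have hnb : ∀ᵐ t : ℝ, t ≠ b := by simp [ae_iff, measure_singleton]
    filter_upwards [hU.ae_hasDerivAt_integral, hWint.ae_hasDerivAt_integral, hna, hnb]
      with t h1 h2 hta htb ht
    have ht' : t ∈ Icc a b := by rwa [uIcc_of_le hab] at ht
    have hnhds : Icc a b ∈ 𝓝 t :=
      Icc_mem_nhds (lt_of_le_of_ne ht'.1 (Ne.symm hta)) (lt_of_le_of_ne ht'.2 htb)
    have hd1 : HasDerivAt u (U t) t := by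
      refine ((h1 ht a left_mem_uIcc).const_add (u a)).congr_of_eventuallyEq ?_
      filter_upwards [hnhds] with x hx using hu x hx
    have hd2 : HasDerivAt (G ∘ u) (W t) t :=
      ((hG.differentiable one_ne_zero (u t)).hasFDerivAt).comp_hasDerivAt t hd1
    simpa using hd2.sub (h2 ht a left_mem_uIcc)
  obtain ⟨c, hc⟩ := hac.const_of_ae_hasDerivAt_zero hae
  have h1 := hc a left_mem_uIcc
  have h2 := hc b right_mem_uIcc
  simp only [Pi.sub_apply, Function.comp_apply, intervalIntegral.integral_same, sub_zero] at h1 h2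
  rw [h1, ← h2]; abel

/-- Averaging: a slowly varying coefficient integrated against a fast periodic signal of mean zero
gives a contribution of order `ε` per unit of time. -/
lemma norm_integral_periodic_smul_le {E : Type*} [NormedAddCommGroup E] [NormedSpace ℝ E]
    [CompleteSpace E] {w : ℝ → ℝ} {W : ℝ} (hw : Measurable w) (hwB : ∀ σ, |w σ| ≤ W)
    (hper : Function.Periodic w 1) (hmean : ∫ σ in (0 : ℝ)..1, w σ = 0) {ε : ℝ} (hε : 0 < ε)
    {c : ℝ → E} {B Λ t : ℝ} (hΛ : 0 ≤ Λ) :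
    ∀ t₀ ≤ t, (∀ τ ∈ Icc t₀ t, ‖c τ‖ ≤ B) →
      (∀ τ ∈ Icc t₀ t, ∀ τ' ∈ Icc t₀ t, ‖c τ - c τ'‖ ≤ Λ * |τ - τ'|) →
      ‖∫ τ in t₀..t, w (τ / ε) • c τ‖ ≤ W * ε * (B + Λ * (t - t₀)) := by
  have hW0 : 0 ≤ W := (abs_nonneg _).trans (hwB 0)
  suffices H : ∀ N : ℕ, ∀ t₀ ≤ t, t - t₀ ≤ N * ε → (∀ τ ∈ Icc t₀ t, ‖c τ‖ ≤ B) →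
      (∀ τ ∈ Icc t₀ t, ∀ τ' ∈ Icc t₀ t, ‖c τ - c τ'‖ ≤ Λ * |τ - τ'|) →
      ‖∫ τ in t₀..t, w (τ / ε) • c τ‖ ≤ W * ε * (B + Λ * (t - t₀)) by
    intro t₀ ht₀
    obtain ⟨N, hN⟩ := exists_nat_ge ((t - t₀) / ε)
    exact H N t₀ ht₀ ((div_le_iff₀ hε).1 hN)
  intro N
  induction N with
  | zero =>
    intro t₀ ht₀ hN hB _
    have : t₀ = t := le_antisymm ht₀ (by simpa using hN)
    subst this
    have hB0 : 0 ≤ B := (norm_nonneg _).trans (hB t₀ (left_mem_Icc.2 le_rfl))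
    simpa using mul_nonneg (mul_nonneg hW0 hε.le) hB0
  | succ N ih =>
    intro t₀ ht₀ hN hB hlip
    have hB0 : 0 ≤ B := (norm_nonneg _).trans (hB t₀ (left_mem_Icc.2 ht₀))
    rcases le_total (t - t₀) ε with hshort | hlong
    · have h1 : ‖∫ τ in t₀..t, w (τ / ε) • c τ‖ ≤ (W * B) * |t - t₀| := by
        refine intervalIntegral.norm_integral_le_of_norm_le_const fun τ hτ => ?_
        rw [uIoc_of_le ht₀] at hτ
        rw [norm_smul]
        exact mul_le_mul (hwB _) (hB τ (Ioc_subset_Icc_self hτ)) (norm_nonneg _) hW0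
      rw [abs_of_nonneg (by linarith)] at h1
      have h2 : W * B * (t - t₀) ≤ W * B * ε := by gcongr
      have h3 : 0 ≤ W * ε * (Λ * (t - t₀)) := by
        have : 0 ≤ t - t₀ := by linarith
        positivity
      nlinarith
    · have hmid : t₀ + ε ≤ t := by linarith
      have hcont : ContinuousOn c (Icc t₀ t) := by
        refine (LipschitzOnWith.of_dist_le_mul (K := Real.toNNReal Λ) fun x hx y hy => ?_).continuousOn
        rw [dist_eq_norm, Real.dist_eq, Real.coe_toNNReal _ hΛ]
        exact hlip x hx y hy
      have hint : ∀ x ∈ Icc t₀ t, ∀ y ∈ Icc t₀ t,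
          IntervalIntegrable (fun τ => w (τ / ε) • c τ) volume x y := by
        have hbase : IntervalIntegrable (fun τ => w (τ / ε) • c τ) volume t₀ t := by
          refine intervalIntegrable_of_norm_le (B := W * B) ht₀ ?_ fun τ hτ => ?_
          · exact ((hw.comp (measurable_id.div_const ε)).aestronglyMeasurable).smul
              ((hcont.mono Ioc_subset_Icc_self).aestronglyMeasurable measurableSet_Ioc)
          · rw [norm_smul]
            exact mul_le_mul (hwB _) (hB τ hτ) (norm_nonneg _) hW0
        intro x hx y hy
        exact hbase.mono_set (by rw [uIcc_of_le ht₀]; exact uIcc_subset_Icc hx hy)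
      have hl : t₀ ∈ Icc t₀ t := left_mem_Icc.2 ht₀
      have hr : t ∈ Icc t₀ t := right_mem_Icc.2 ht₀
      have hm : t₀ + ε ∈ Icc t₀ t := ⟨by linarith, hmid⟩
      rw [← intervalIntegral.integral_add_adjacent_intervals (hint _ hl _ hm) (hint _ hm _ hr)]
      have hrest : ‖∫ τ in (t₀ + ε)..t, w (τ / ε) • c τ‖ ≤ W * ε * (B + Λ * (t - (t₀ + ε))) := by
        refine ih (t₀ + ε) hmid ?_ (fun τ hτ => hB τ ⟨by linarith [hτ.1], hτ.2⟩)
          (fun τ hτ τ' hτ' => hlip τ ⟨by linarith [hτ.1], hτ.2⟩ τ' ⟨by linarith [hτ'.1], hτ'.2⟩)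
        push_cast at hN
        linarith
      have hzero : ∫ τ in t₀..(t₀ + ε), w (τ / ε) = 0 := by
        rw [intervalIntegral.integral_comp_div _ hε.ne', add_div, div_self hε.ne',
          hper.intervalIntegral_add_eq (t₀ / ε) 0, zero_add, hmean, smul_zero]
      have hfirst : ‖∫ τ in t₀..(t₀ + ε), w (τ / ε) • c τ‖ ≤ W * (Λ * ε) * ε := by
        have hwint : IntervalIntegrable (fun τ => w (τ / ε) • c t₀) volume t₀ (t₀ + ε) := by
          refine intervalIntegrable_of_norm_le (B := W * B) (by linarith) ?_ fun τ _ => ?_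
          · exact ((hw.comp (measurable_id.div_const ε)).aestronglyMeasurable).smul
              aestronglyMeasurable_const
          · rw [norm_smul]
            exact mul_le_mul (hwB _) (hB t₀ hl) (norm_nonneg _) hW0
        have heq : ∫ τ in t₀..(t₀ + ε), w (τ / ε) • c τ
            = ∫ τ in t₀..(t₀ + ε), w (τ / ε) • (c τ - c t₀) := by
          simp only [smul_sub]
          rw [intervalIntegral.integral_sub (hint _ hl _ hm) hwint,
            intervalIntegral.integral_smul_const, hzero, zero_smul, sub_zero]
        rw [heq]
        have := intervalIntegral.norm_integral_le_of_norm_le_const (a := t₀) (b := t₀ + ε)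
          (C := W * (Λ * ε)) (f := fun τ => w (τ / ε) • (c τ - c t₀)) fun τ hτ => by
            rw [uIoc_of_le (by linarith)] at hτ
            have hτ' : τ ∈ Icc t₀ t := ⟨hτ.1.le, hτ.2.trans hmid⟩
            rw [norm_smul]
            refine mul_le_mul (hwB _) ((hlip τ hτ' t₀ hl).trans ?_) (norm_nonneg _) hW0
            rw [abs_of_nonneg (by linarith [hτ.1])]
            exact mul_le_mul_of_nonneg_left (by linarith [hτ.2]) hΛ
        simpa [abs_of_pos hε] using this
      calc _ ≤ _ := norm_add_le _ _
        _ ≤ W * (Λ * ε) * ε + W * ε * (B + Λ * (t - (t₀ + ε))) := add_le_add hfirst hrest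
        _ = W * ε * (B + Λ * (t - t₀)) := by ring

/-! ### The zero-mean primitive -/

section Primitive

variable {s : ℝ → ℝ} (hs_meas : Measurable s) (hs_bdd : ∃ B : ℝ, ∀ σ : ℝ, |s σ| ≤ B)

include hs_meas hs_bdd

lemma intervalIntegrable_of_bounded (a b : ℝ) : IntervalIntegrable s volume a b := by
  obtain ⟨B, hB⟩ := hs_bdd
  rw [intervalIntegrable_iff]
  exact Measure.integrableOn_of_bounded (M := B) (by simp) hs_meas.aestronglyMeasurable
    (Eventually.of_forall fun σ => hB σ)

lemma zeroMeanPrimitive_sub (a b : ℝ) :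
    zeroMeanPrimitive s b - zeroMeanPrimitive s a = ∫ τ in a..b, s τ := by
  have hi := intervalIntegrable_of_bounded hs_meas hs_bdd
  unfold zeroMeanPrimitive
  rw [sub_sub_sub_cancel_right, intervalIntegral.integral_interval_sub_left (hi _ _) (hi _ _)]

lemma continuous_zeroMeanPrimitive : Continuous (zeroMeanPrimitive s) :=
  (intervalIntegral.continuous_primitive (intervalIntegrable_of_bounded hs_meas hs_bdd) 0).sub
    continuous_const

lemma integral_zeroMeanPrimitive : ∫ σ in (0 : ℝ)..1, zeroMeanPrimitive s σ = 0 := by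
  have hc := intervalIntegral.continuous_primitive
    (intervalIntegrable_of_bounded hs_meas hs_bdd) 0
  unfold zeroMeanPrimitive
  rw [intervalIntegral.integral_sub (hc.intervalIntegrable _ _) (by simp)]
  simp

variable (hs_per : Function.Periodic s 1) (hs_mean : ∫ σ in (0 : ℝ)..1, s σ = 0)

include hs_per hs_mean

lemma periodic_zeroMeanPrimitive : Function.Periodic (zeroMeanPrimitive s) 1 := fun σ => by
  have h := zeroMeanPrimitive_sub hs_meas hs_bdd σ (σ + 1)
  rw [hs_per.intervalIntegral_add_eq σ 0, zero_add, hs_mean] at h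
  linarith

lemma exists_bound_zeroMeanPrimitive : ∃ W : ℝ, ∀ σ, |zeroMeanPrimitive s σ| ≤ W := by
  obtain ⟨W, hW⟩ := (isCompact_Icc (a := (0 : ℝ)) (b := 1)).exists_bound_of_continuousOn
    (continuous_zeroMeanPrimitive hs_meas hs_bdd).continuousOn
  refine ⟨W, fun σ => ?_⟩
  obtain ⟨y, hy, hyσ⟩ :=
    (periodic_zeroMeanPrimitive hs_meas hs_bdd hs_per hs_mean).exists_mem_Ico₀ zero_lt_one σ
  rw [hyσ]
  exact hW y (Ico_subset_Icc_self hy)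

/-- `s S` is the derivative of the periodic function `S² / 2`, so it has zero mean. -/
lemma integral_mul_zeroMeanPrimitive :
    ∫ σ in (0 : ℝ)..1, s σ * zeroMeanPrimitive s σ = 0 := by
  have hi := intervalIntegrable_of_bounded hs_meas hs_bdd
  obtain ⟨B, hB⟩ := hs_bdd
  have h := (integral_fderiv_comp_eq_sub (G := fun x : ℝ => x ^ 2) (by fun_prop) zero_le_one
    (hi 0 1) (fun t _ => hB t)
    (fun t _ => by rw [← zeroMeanPrimitive_sub hs_meas ⟨B, hB⟩ 0 t]; ring)).2
  have hp := periodic_zeroMeanPrimitive hs_meas ⟨B, hB⟩ hs_per hs_mean 0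
  rw [zero_add] at hp
  have hf : ∀ τ, fderiv ℝ (fun x : ℝ => x ^ 2) (zeroMeanPrimitive s τ) (s τ)
      = 2 * (s τ * zeroMeanPrimitive s τ) := fun τ => by
    rw [fderiv_eq_smul_deriv]
    simp
    ring
  simp only [hf, hp, sub_self, intervalIntegral.integral_const_mul] at h
  linarith

end Primitive

/-! ### Grönwall estimates and existence of Carathéodory solutions -/

lemma le_mul_exp_of_le_add_integral {φ : ℝ → ℝ} {a b A L : ℝ} (hL : 0 ≤ L)
    (hφ : ContinuousOn φ (Icc a b))
    (h : ∀ t ∈ Icc a b, φ t ≤ A + L * ∫ τ in a..t, φ τ) :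
    ∀ t ∈ Icc a b, φ t ≤ A * Real.exp (L * (t - a)) := by
  intro t ht
  have hab : a ≤ b := ht.1.trans ht.2
  set ψ : ℝ → ℝ := IccExtend hab ((Icc a b).domRestrict φ) with hψ
  have hψc : Continuous ψ := (continuousOn_iff_continuous_domRestrict.1 hφ).Icc_extend'
  have hψe : ∀ x ∈ Icc a b, ψ x = φ x := fun x hx => by rw [hψ, IccExtend_of_mem hab _ hx]; rfl
  have hint : ∀ x ∈ Icc a b, ∫ τ in a..x, φ τ = ∫ τ in a..x, ψ τ := fun x hx =>
    intervalIntegral.integral_congr fun y hy => by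
      rw [uIcc_of_le hx.1] at hy
      exact (hψe y ⟨hy.1, hy.2.trans hx.2⟩).symm
  have hd : ∀ x, HasDerivAt (fun x => A + L * ∫ τ in a..x, ψ τ) (L * ψ x) x := fun x =>
    (((intervalIntegral.integral_hasDerivAt_right (hψc.intervalIntegrable _ _)
      hψc.aestronglyMeasurable.stronglyMeasurableAtFilter hψc.continuousAt).const_mul L).const_add A)
  have hg := le_gronwallBound_of_liminf_deriv_right_le (f := fun x => A + L * ∫ τ in a..x, ψ τ)
    (f' := fun x => L * ψ x) (δ := A) (K := L) (ε := 0) (a := a) (b := b)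
    (fun x _ => (hd x).continuousAt.continuousWithinAt)
    (fun x _ r hr => (hd x).hasDerivWithinAt.liminf_right_slope_le hr) (by simp)
    (fun x hx => by
      have hx' := Ico_subset_Icc_self hx
      rw [add_zero, hψe x hx', ← hint x hx']
      exact mul_le_mul_of_nonneg_left (h x hx') hL) t ht
  rw [gronwallBound_ε0] at hg
  exact ((h t ht).trans_eq (by rw [hint t ht])).trans hg

/-- Grönwall's inequality for a function that satisfies an integral equation up to a defect. -/
lemma norm_le_exp_of_defect {Z : Type*} [NormedAddCommGroup Z] [NormedSpace ℝ Z]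
    {u v : ℝ → Z} {a b δ L m : ℝ} (hL : 0 ≤ L) (hm : 0 ≤ m)
    (hu : ContinuousOn u (Icc a b))
    (hdef : ∀ t ∈ Icc a b, ‖u t - u a - ∫ τ in a..t, v τ‖ ≤ δ)
    (hv : ∀ t ∈ Icc a b, ‖v t‖ ≤ L * ‖u t‖ + m) :
    ∀ t ∈ Icc a b, ‖u t‖ ≤ (‖u a‖ + δ + m * (b - a)) * Real.exp (L * (t - a)) := by
  refine le_mul_exp_of_le_add_integral hL hu.norm fun t ht => ?_
  have hsub : Icc a t ⊆ Icc a b := Icc_subset_Icc_right ht.2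
  have hi : IntervalIntegrable (fun τ => ‖u τ‖) volume a t :=
    ContinuousOn.intervalIntegrable (by rw [uIcc_of_le ht.1]; exact (hu.mono hsub).norm)
  have h1 : ‖∫ τ in a..t, v τ‖ ≤ ∫ τ in a..t, (L * ‖u τ‖ + m) :=
    intervalIntegral.norm_integral_le_of_norm_le ht.1
      (Eventually.of_forall fun τ hτ => hv τ (hsub (Ioc_subset_Icc_self hτ)))
      ((hi.const_mul L).add intervalIntegrable_const)
  rw [intervalIntegral.integral_add (hi.const_mul L) intervalIntegrable_const,
    intervalIntegral.integral_const_mul, intervalIntegral.integral_const, smul_eq_mul] at h1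
  have h2 : ‖u t‖ ≤ ‖u t - u a - ∫ τ in a..t, v τ‖ + ‖u a‖ + ‖∫ τ in a..t, v τ‖ := by
    have : u t = (u t - u a - ∫ τ in a..t, v τ) + u a + ∫ τ in a..t, v τ := by abel
    calc ‖u t‖ = ‖(u t - u a - ∫ τ in a..t, v τ) + u a + ∫ τ in a..t, v τ‖ := by rw [← this]
      _ ≤ _ := norm_add₃_le
  have h3 : (t - a) * m ≤ m * (b - a) := by
    rw [mul_comm]; exact mul_le_mul_of_nonneg_left (by linarith [ht.2]) hm
  linarith [hdef t ht]

/-- A bootstrap principle: a continuous quantity that starts below `R` and cannot reach `R` for the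
first time stays below `R`. -/
lemma lt_of_bootstrap {φ : ℝ → ℝ} {T R : ℝ} (hφ : ContinuousOn φ (Icc 0 T)) (h0 : φ 0 < R)
    (h : ∀ T' ∈ Icc 0 T, (∀ t ∈ Icc 0 T', φ t ≤ R) → ∀ t ∈ Icc 0 T', φ t < R) :
    ∀ t ∈ Icc 0 T, φ t < R := by
  by_contra! hcon
  obtain ⟨t₁, ht₁, hR⟩ := hcon
  have hclosed : IsCompact (Icc 0 T ∩ φ ⁻¹' Ici R) :=
    isCompact_Icc.of_isClosed_subset (hφ.preimage_isClosed_of_isClosed isClosed_Icc isClosed_Ici)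
      inter_subset_left
  obtain ⟨m, ⟨hm, hmR⟩, hmin⟩ := hclosed.exists_isLeast ⟨t₁, ht₁, hR⟩
  have hle : ∀ t ∈ Icc 0 m, φ t ≤ R := by
    intro t ht
    rcases eq_or_lt_of_le ht.2 with rfl | hlt
    · obtain ⟨c, hc, hcR⟩ := intermediate_value_Icc hm.1 (hφ.mono (Icc_subset_Icc_right hm.2))
        ⟨h0.le, hmR⟩
      have : t ≤ c := hmin ⟨⟨hc.1, hc.2.trans hm.2⟩, hcR.ge⟩
      rw [le_antisymm this hc.2, hcR]
    · by_contra! hgt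
      exact absurd (hmin ⟨⟨ht.1, ht.2.trans hm.2⟩, hgt.le⟩) (not_le.2 hlt)
  exact absurd (h m hm hle m (right_mem_Icc.2 hm.1)) (not_lt.2 hmR)

/-- The radial retraction of a normed space onto the closed ball of radius `ρ` around `0`. -/
noncomputable def ballRetraction {Z : Type*} [NormedAddCommGroup Z] [NormedSpace ℝ Z]
    (ρ : ℝ) (z : Z) : Z := (ρ / max ρ ‖z‖) • z

section BallRetraction

variable {Z : Type*} [NormedAddCommGroup Z] [NormedSpace ℝ Z] {ρ : ℝ}

lemma norm_ballRetraction_le (hρ : 0 < ρ) (z : Z) : ‖ballRetraction ρ z‖ ≤ ρ := by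
  have hm : 0 < max ρ ‖z‖ := lt_max_of_lt_left hρ
  rw [ballRetraction, norm_smul, Real.norm_of_nonneg (by positivity), div_mul_eq_mul_div,
    div_le_iff₀ hm]
  exact mul_le_mul_of_nonneg_left (le_max_right _ _) hρ.le

lemma ballRetraction_of_norm_le (hρ : 0 < ρ) {z : Z} (hz : ‖z‖ ≤ ρ) : ballRetraction ρ z = z := by
  rw [ballRetraction, max_eq_left hz, div_self hρ.ne', one_smul]

lemma norm_ballRetraction_sub_le (hρ : 0 < ρ) (z z' : Z) :
    ‖ballRetraction ρ z - ballRetraction ρ z'‖ ≤ 2 * ‖z - z'‖ := by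
  have hm : 0 < max ρ ‖z‖ := lt_max_of_lt_left hρ
  have hm' : 0 < max ρ ‖z'‖ := lt_max_of_lt_left hρ
  have hsplit : ballRetraction ρ z - ballRetraction ρ z'
      = (ρ / max ρ ‖z‖) • (z - z') + (ρ / max ρ ‖z‖ - ρ / max ρ ‖z'‖) • z' := by
    unfold ballRetraction
    module
  have h1 : ‖(ρ / max ρ ‖z‖) • (z - z')‖ ≤ ‖z - z'‖ := by
    rw [norm_smul, Real.norm_of_nonneg (by positivity)]
    exact mul_le_of_le_one_left (norm_nonneg _) ((div_le_one hm).2 (le_max_left _ _))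
  have h2 : ‖(ρ / max ρ ‖z‖ - ρ / max ρ ‖z'‖) • z'‖ ≤ ‖z - z'‖ := by
    have hmm : |max ρ ‖z'‖ - max ρ ‖z‖| ≤ ‖z - z'‖ := by
      refine (abs_max_sub_max_le_abs ‖z'‖ ‖z‖ ρ |>.trans' ?_).trans ?_
      · simp [max_comm]
      · rw [norm_sub_rev]; exact abs_norm_sub_norm_le _ _
    have he : ρ / max ρ ‖z‖ - ρ / max ρ ‖z'‖
        = (ρ / max ρ ‖z‖) * ((max ρ ‖z'‖ - max ρ ‖z‖) / max ρ ‖z'‖) := by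
      field_simp
    rw [norm_smul, he, norm_mul, Real.norm_of_nonneg (show 0 ≤ ρ / max ρ ‖z‖ by positivity),
      norm_div, Real.norm_of_nonneg hm'.le, mul_assoc, div_mul_eq_mul_div ‖_‖]
    have h3 : ‖max ρ ‖z'‖ - max ρ ‖z‖‖ * ‖z'‖ / max ρ ‖z'‖ ≤ ‖z - z'‖ := by
      rw [div_le_iff₀ hm']
      exact mul_le_mul hmm (le_max_right _ _) (norm_nonneg _) (norm_nonneg _)
    exact (mul_le_of_le_one_left (by positivity) ((div_le_one hm).2 (le_max_left _ _))).trans h3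
  calc _ = _ := by rw [hsplit]
    _ ≤ _ := norm_add_le _ _
    _ ≤ 2 * ‖z - z'‖ := by linarith

lemma continuous_ballRetraction (hρ : 0 < ρ) : Continuous (ballRetraction ρ : Z → Z) :=
  (LipschitzWith.of_dist_le_mul (K := 2) fun z z' => by
    simpa [dist_eq_norm] using norm_ballRetraction_sub_le hρ z z').continuous

end BallRetraction

/-- Carathéodory's existence theorem for a bounded, globally Lipschitz right-hand side. The Picard
iterates converge geometrically in the weighted norm `sup ‖z t‖ exp (-2 L (t - t₀))`. -/
theorem exists_isSolution_of_lipschitz {Z : Type*} [NormedAddCommGroup Z] [NormedSpace ℝ Z]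
    [CompleteSpace Z] {V : ℝ → Z → Z} {t₀ L B : ℝ} (hL : 0 < L)
    (hlip : ∀ t, t₀ ≤ t → ∀ z z', ‖V t z - V t z'‖ ≤ L * ‖z - z'‖)
    (hB : ∀ t, t₀ ≤ t → ∀ z, ‖V t z‖ ≤ B)
    (hmeas : ∀ z : ℝ → Z, Continuous z →
      AEStronglyMeasurable (fun τ => V τ (z τ)) (volume.restrict (Ici t₀))) (z₀ : Z) :
    ∃ z : ℝ → Z, IsSolution V (Ici t₀) t₀ z₀ z := by
  have hB0 : 0 ≤ B := (norm_nonneg _).trans (hB t₀ le_rfl z₀)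
  have hIocsub : ∀ t, Ioc t₀ t ⊆ Ici t₀ := fun t x hx => hx.1.le
  -- integrability along any trajectory with measurable right-hand side
  have hint' : ∀ z : ℝ → Z, AEStronglyMeasurable (fun τ => V τ (z τ)) (volume.restrict (Ici t₀)) →
      ∀ t, t₀ ≤ t → IntervalIntegrable (fun τ => V τ (z τ)) volume t₀ t := fun z hz t ht =>
    intervalIntegrable_of_norm_le ht (hz.mono_set (hIocsub t)) fun τ hτ => hB τ hτ.1 _
  let step : (ℝ → Z) → ℝ → Z := fun z t => z₀ + ∫ τ in t₀..(max t₀ t), V τ (z τ)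
  let zs : ℕ → ℝ → Z := fun k => step^[k] fun _ => z₀
  have hzs : ∀ k, zs (k + 1) = step (zs k) := fun k => Function.iterate_succ_apply' _ _ _
  have hstepc : ∀ z : ℝ → Z,
      AEStronglyMeasurable (fun τ => V τ (z τ)) (volume.restrict (Ici t₀)) →
      Continuous (step z) := by
    intro z hz
    have hl : LipschitzWith (Real.toNNReal B) (step z) := by
      refine LipschitzWith.of_dist_le_mul fun x y => ?_
      have hx := hint' z hz _ (le_max_left t₀ x)
      have hy := hint' z hz _ (le_max_left t₀ y)
      rw [dist_eq_norm, Real.coe_toNNReal _ hB0, Real.dist_eq]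
      simp only [step]
      rw [add_sub_add_left_eq_sub, intervalIntegral.integral_interval_sub_left hx hy]
      refine (intervalIntegral.norm_integral_le_of_norm_le_const (C := B) fun τ hτ => hB τ ?_ _).trans
        (mul_le_mul_of_nonneg_left ?_ hB0)
      · exact (le_min (le_max_left _ _) (le_max_left _ _)).trans hτ.1.le
      · have := abs_max_sub_max_le_abs x y t₀
        rwa [max_comm x, max_comm y] at this
    exact hl.continuous
  have hzc : ∀ k, Continuous (zs k) := by
    intro k
    induction k with
    | zero => exact continuous_const
    | succ k ih => rw [hzs]; exact hstepc _ (hmeas _ ih)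
  have hzm := fun k => hmeas _ (hzc k)
  set C₀ : ℝ := B / (2 * L) with hC₀
  have hexp : ∀ t, ∫ τ in t₀..t, Real.exp (2 * L * (τ - t₀))
      = (Real.exp (2 * L * (t - t₀)) - 1) / (2 * L) := by
    intro t
    have hd : ∀ x ∈ uIcc t₀ t, HasDerivAt (fun τ => Real.exp (2 * L * (τ - t₀)) / (2 * L))
        (Real.exp (2 * L * (x - t₀))) x := by
      intro x _
      have h1 : HasDerivAt (fun τ => 2 * L * (τ - t₀)) (2 * L) x := by
        simpa using ((hasDerivAt_id x).sub_const t₀).const_mul (2 * L)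
      have h2 := h1.exp.div_const (2 * L)
      rwa [mul_div_cancel_right₀ _ (by positivity)] at h2
    rw [intervalIntegral.integral_eq_sub_of_hasDerivAt hd
      (Continuous.intervalIntegrable (by fun_prop) _ _)]
    simp
    ring
  have hdiff : ∀ k t, t₀ ≤ t →
      dist (zs k t) (zs (k + 1) t) ≤ C₀ * Real.exp (2 * L * (t - t₀)) * (1 / 2) ^ k := by
    intro k
    induction k with
    | zero =>
      intro t ht
      have h1 : ‖∫ τ in t₀..t, V τ z₀‖ ≤ B * |t - t₀| :=
        intervalIntegral.norm_integral_le_of_norm_le_const fun τ hτ => by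
          rw [uIoc_of_le ht] at hτ
          exact hB τ hτ.1.le _
      have h2 : zs 0 t - zs 1 t = -∫ τ in t₀..t, V τ z₀ := by
        rw [hzs 0]
        simp only [step, zs, Function.iterate_zero, id, max_eq_right ht]
        abel
      rw [dist_eq_norm, zero_add, h2, norm_neg, pow_zero, mul_one]
      rw [abs_of_nonneg (by linarith)] at h1
      refine h1.trans ?_
      have h3 : 2 * L * (t - t₀) ≤ Real.exp (2 * L * (t - t₀)) := by
        linarith [Real.add_one_le_exp (2 * L * (t - t₀))]
      calc B * (t - t₀) = C₀ * (2 * L * (t - t₀)) := by rw [hC₀]; field_simp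
        _ ≤ _ := mul_le_mul_of_nonneg_left h3 (by positivity)
    | succ k ih =>
      intro t ht
      have h2 : zs (k + 1) t - zs (k + 2) t
          = ∫ τ in t₀..t, (V τ (zs k τ) - V τ (zs (k + 1) τ)) := by
        rw [intervalIntegral.integral_sub (hint' _ (hzm k) t ht) (hint' _ (hzm (k + 1)) t ht),
          hzs (k + 1), hzs k]
        simp only [step, max_eq_right ht, add_sub_add_left_eq_sub]
      rw [dist_eq_norm, h2]
      have h3 : ‖∫ τ in t₀..t, (V τ (zs k τ) - V τ (zs (k + 1) τ))‖
          ≤ ∫ τ in t₀..t, L * (C₀ * (1 / 2) ^ k) * Real.exp (2 * L * (τ - t₀)) := by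
        refine intervalIntegral.norm_integral_le_of_norm_le ht (Eventually.of_forall fun τ hτ => ?_)
          (Continuous.intervalIntegrable (by fun_prop) _ _)
        refine (hlip τ hτ.1.le _ _).trans ?_
        have := ih τ hτ.1.le
        rw [dist_eq_norm] at this
        calc _ ≤ L * (C₀ * Real.exp (2 * L * (τ - t₀)) * (1 / 2) ^ k) :=
              mul_le_mul_of_nonneg_left this hL.le
          _ = _ := by ring
      rw [intervalIntegral.integral_const_mul, hexp] at h3
      refine h3.trans ?_
      have : L * (C₀ * (1 / 2) ^ k) * ((Real.exp (2 * L * (t - t₀)) - 1) / (2 * L))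
          = C₀ * (Real.exp (2 * L * (t - t₀)) - 1) * (1 / 2) ^ (k + 1) := by
        field_simp
        ring
      rw [this]
      gcongr
      linarith
  have hlim : ∀ t, t₀ ≤ t → ∃ y, Tendsto (fun k => zs k t) atTop (𝓝 y) := fun t ht =>
    cauchySeq_tendsto_of_complete
      (cauchySeq_of_le_geometric (1 / 2) _ (by norm_num) fun k => hdiff k t ht)
  classical
  let z : ℝ → Z := fun t => if ht : t₀ ≤ t then (hlim t ht).choose else z₀
  have hz : ∀ t, t₀ ≤ t → Tendsto (fun k => zs k t) atTop (𝓝 (z t)) := fun t ht => by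
    simp only [z, dif_pos ht]
    exact (hlim t ht).choose_spec
  have hVlim : ∀ t, t₀ ≤ t → Tendsto (fun k => V t (zs k t)) atTop (𝓝 (V t (z t))) := by
    intro t ht
    have hc : Continuous (V t) := (LipschitzWith.of_dist_le_mul (K := Real.toNNReal L)
      fun x y => by simpa [dist_eq_norm, hL.le] using hlip t ht x y).continuous
    exact (hc.tendsto _).comp (hz t ht)
  have hm : AEStronglyMeasurable (fun τ => V τ (z τ)) (volume.restrict (Ici t₀)) := by
    refine aestronglyMeasurable_of_tendsto_ae atTop hzm ?_
    filter_upwards [ae_restrict_mem measurableSet_Ici] with τ hτ using hVlim τ hτ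
  have heq : ∀ t, t₀ ≤ t → z t = z₀ + ∫ τ in t₀..t, V τ (z τ) := by
    intro t ht
    have h1 : Tendsto (fun k => zs (k + 1) t) atTop (𝓝 (z₀ + ∫ τ in t₀..t, V τ (z τ))) := by
      have h2 : ∀ k, zs (k + 1) t = z₀ + ∫ τ in t₀..t, V τ (zs k τ) := fun k => by
        rw [hzs]; simp only [step, max_eq_right ht]
      simp only [h2]
      refine Tendsto.const_add z₀ ?_
      refine intervalIntegral.tendsto_integral_filter_of_dominated_convergence (fun _ => B)
        (Eventually.of_forall fun k => ?_) (Eventually.of_forall fun k => ?_) (by simp) ?_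
      · rw [uIoc_of_le ht]; exact (hzm k).mono_set (hIocsub t)
      · refine Eventually.of_forall fun τ hτ => ?_
        rw [uIoc_of_le ht] at hτ
        exact hB τ hτ.1.le _
      · refine Eventually.of_forall fun τ hτ => ?_
        rw [uIoc_of_le ht] at hτ
        exact hVlim τ hτ.1.le
    exact tendsto_nhds_unique ((hz t ht).comp (tendsto_add_atTop_nat 1)) h1
  refine ⟨z, ⟨?_, fun t ht => hint' z hm t ht, heq⟩⟩
  refine (hstepc z hm).continuousOn.congr fun t ht => ?_
  rw [heq t ht]
  simp only [step, max_eq_right (show t₀ ≤ t from ht)]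

section Restrict

variable {Z : Type*} [NormedAddCommGroup Z] [NormedSpace ℝ Z] {V : ℝ → Z → Z} {J : Set ℝ}
  {t₀ : ℝ} {z₀ : Z} {z : ℝ → Z}

lemma IsSolution.apply_initial (h : IsSolution V J t₀ z₀ z) (ht₀ : t₀ ∈ J) : z t₀ = z₀ := by
  simpa using h.eq_integral t₀ ht₀

lemma IsSolution.mono (h : IsSolution V J t₀ z₀ z) {J' : Set ℝ} (hJ : J' ⊆ J) :
    IsSolution V J' t₀ z₀ z :=
  ⟨h.continuousOn.mono hJ, fun t ht => h.intervalIntegrable t (hJ ht),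
    fun t ht => h.eq_integral t (hJ ht)⟩

/-- A solution, restarted at a later time. -/
lemma IsSolution.restart (h : IsSolution V J t₀ z₀ z) {t₁ : ℝ} (ht₁ : t₁ ∈ J) {J' : Set ℝ}
    (hJ : J' ⊆ J) : IsSolution V J' t₁ (z t₁) z := by
  refine ⟨h.continuousOn.mono hJ, fun t ht =>
    (h.intervalIntegrable t₁ ht₁).symm.trans (h.intervalIntegrable t (hJ ht)), fun t ht => ?_⟩
  rw [← intervalIntegral.integral_interval_sub_left (h.intervalIntegrable t (hJ ht))
    (h.intervalIntegrable t₁ ht₁)]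
  nth_rw 1 [h.eq_integral t (hJ ht)]
  nth_rw 1 [h.eq_integral t₁ ht₁]
  abel

/-- The right-hand side matters only along the solution. -/
lemma IsSolution.congr_field (h : IsSolution V J t₀ z₀ z) {V' : ℝ → Z → Z}
    (hV : ∀ t ∈ J, ∀ τ ∈ uIcc t₀ t, V τ (z τ) = V' τ (z τ)) : IsSolution V' J t₀ z₀ z := by
  refine ⟨h.continuousOn, fun t ht => (h.intervalIntegrable t ht).congr ?_, fun t ht => ?_⟩
  · exact fun τ hτ => hV t ht τ (uIoc_subset_uIcc hτ)
  · rw [h.eq_integral t ht, intervalIntegral.integral_congr (hV t ht)]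

end Restrict

/-! ### Shadowing of trajectories attracted by an exponentially stable equilibrium -/

/-- On bounded sets and uniformly in `t ≥ 0`, the map `G t` is bounded and Lipschitz, and its
second differences are bounded by the product of the increments. This is what a bounded derivative
that is Lipschitz in the state gives; the formulation by differences makes it easy to compose. -/
def UniformlyC11 {Z E : Type*} [NormedAddCommGroup Z] [NormedAddCommGroup E]
    (G : ℝ → Z → E) : Prop :=
  ∀ ρ : ℝ, ∃ L : ℝ, 0 < L ∧ ∀ t : ℝ, 0 ≤ t →
    (∀ z, ‖z‖ ≤ ρ → ‖G t z‖ ≤ L) ∧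
    (∀ z z', ‖z‖ ≤ ρ → ‖z'‖ ≤ ρ → ‖G t z - G t z'‖ ≤ L * ‖z - z'‖) ∧
    (∀ z w d, ‖z‖ ≤ ρ → ‖z + w‖ ≤ ρ → ‖z + d‖ ≤ ρ → ‖z + w + d‖ ≤ ρ →
      ‖G t (z + w + d) - G t (z + w) - G t (z + d) + G t z‖ ≤ L * ‖w‖ * ‖d‖)

/-- On `[a, b]`, the curve `ζ` satisfies the integral equation of `z' = F t z` between any two times
`t₀ ≤ t` up to an error `δ (1 + (t - t₀))`. -/
structure HasDefect {Z : Type*} [NormedAddCommGroup Z] [NormedSpace ℝ Z] (F : ℝ → Z → Z)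
    (a b δ : ℝ) (ζ : ℝ → Z) : Prop where
  continuousOn : ContinuousOn ζ (Icc a b)
  defect : ∀ t₀ t, a ≤ t₀ → t₀ ≤ t → t ≤ b →
    ‖ζ t - ζ t₀ - ∫ τ in t₀..t, F τ (ζ τ)‖ ≤ δ * (1 + (t - t₀))

lemma intervalIntegrable_comp_of_continuousOn {Z : Type*} [NormedAddCommGroup Z] {F : ℝ → Z → Z}
    {ζ : ℝ → Z} {a b t₀ t : ℝ} (hF : ContinuousOn (fun q : ℝ × Z => F q.1 q.2) (Icc a b ×ˢ univ))
    (hζ : ContinuousOn ζ (Icc a b))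
    (h₀ : a ≤ t₀) (h₁ : t₀ ≤ t) (h₂ : t ≤ b) : IntervalIntegrable (fun τ => F τ (ζ τ)) volume t₀ t := by
  refine ContinuousOn.intervalIntegrable ?_
  rw [uIcc_of_le h₁]
  exact hF.comp (continuousOn_id.prodMk (hζ.mono (Icc_subset_Icc h₀ h₂)))
    fun τ hτ => ⟨Icc_subset_Icc h₀ h₂ hτ, mem_univ _⟩

section Shadowing

variable {Z : Type*} [NormedAddCommGroup Z] [NormedSpace ℝ Z] {F : ℝ → Z → Z}

lemma HasDefect.mono {a b a' b' δ : ℝ} {ζ : ℝ → Z} (h : HasDefect F a b δ ζ) (ha : a ≤ a')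
    (hb : b' ≤ b) : HasDefect F a' b' δ ζ :=
  ⟨h.continuousOn.mono (Icc_subset_Icc ha hb), fun t₀ t h₀ h₁ h₂ =>
    h.defect t₀ t (ha.trans h₀) h₁ (h₂.trans hb)⟩

lemma IsSolution.hasDefect {a b : ℝ} {z₀ : Z} {z : ℝ → Z} (h : IsSolution F (Icc a b) a z₀ z) :
    HasDefect F a b 0 z := by
  refine ⟨h.continuousOn, fun t₀ t h₀ h₁ h₂ => ?_⟩
  have hr := (h.restart (t₁ := t₀) ⟨h₀, h₁.trans h₂⟩ (J' := Icc t₀ t)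
    (Icc_subset_Icc h₀ h₂)).eq_integral t (right_mem_Icc.2 h₁)
  rw [zero_mul, norm_le_zero_iff, sub_sub, ← hr, sub_self]

/-- Two approximate trajectories separate at most exponentially. -/
lemma norm_sub_le_of_hasDefect {a b δ δ' L ρ : ℝ}
    (hF : ContinuousOn (fun q : ℝ × Z => F q.1 q.2) (Icc a b ×ˢ univ)) (hL : 0 ≤ L)
    (hlip : ∀ t ∈ Icc a b, ∀ z z', ‖z‖ ≤ ρ → ‖z'‖ ≤ ρ → ‖F t z - F t z'‖ ≤ L * ‖z - z'‖)
    {ζ z : ℝ → Z} (hζ : HasDefect F a b δ ζ) (hz : HasDefect F a b δ' z)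
    (hζρ : ∀ t ∈ Icc a b, ‖ζ t‖ ≤ ρ) (hzρ : ∀ t ∈ Icc a b, ‖z t‖ ≤ ρ) (hδ : 0 ≤ δ + δ') :
    ∀ t ∈ Icc a b, ‖ζ t - z t‖ ≤
      (‖ζ a - z a‖ + (δ + δ') * (1 + (b - a))) * Real.exp (L * (t - a)) := by
  intro t ht
  have h := norm_le_exp_of_defect (u := fun t => ζ t - z t)
    (v := fun t => F t (ζ t) - F t (z t)) (a := a) (b := b)
    (δ := (δ + δ') * (1 + (b - a))) (m := 0) hL le_rfl
    (hζ.continuousOn.sub hz.continuousOn) (fun x hx => ?_) (fun x hx => ?_) t ht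
  · simpa using h
  · rw [intervalIntegral.integral_sub
      (intervalIntegrable_comp_of_continuousOn hF hζ.continuousOn le_rfl hx.1 hx.2)
      (intervalIntegrable_comp_of_continuousOn hF hz.continuousOn le_rfl hx.1 hx.2)]
    have h1 := hζ.defect a x le_rfl hx.1 hx.2
    have h2 := hz.defect a x le_rfl hx.1 hx.2
    have h3 : (δ + δ') * (1 + (x - a)) ≤ (δ + δ') * (1 + (b - a)) :=
      mul_le_mul_of_nonneg_left (by linarith [hx.2]) hδ
    calc _ = ‖(ζ x - ζ a - ∫ τ in a..x, F τ (ζ τ)) - (z x - z a - ∫ τ in a..x, F τ (z τ))‖ := by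
          congr 1; abel
      _ ≤ _ := norm_sub_le _ _
      _ ≤ _ := by linarith
  · simpa using hlip x hx _ _ (hζρ x hx) (hzρ x hx)

/-- Solutions that start close enough to an equilibrium exist on a given compact interval and
remain close to it. -/
lemma exists_isSolution_near_equilibrium [CompleteSpace Z]
    (hF : Continuous fun q : ℝ × Z => F q.1 q.2)
    {ze : Z} (hze : ∀ t, 0 ≤ t → F t ze = 0) {L ρ : ℝ} (hL : 0 < L) (hρ : ‖ze‖ + 1 ≤ ρ)
    (hlip : ∀ t, 0 ≤ t → ∀ z z', ‖z‖ ≤ ρ → ‖z'‖ ≤ ρ → ‖F t z - F t z'‖ ≤ L * ‖z - z'‖)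
    {a T : ℝ} (ha : 0 ≤ a) {w : Z} (hw : ‖w‖ * Real.exp (2 * L * T) ≤ 1) :
    ∃ u : ℝ → Z, IsSolution F (Icc a (a + T)) a (ze + w) (fun t => ze + u t) ∧
      ∀ t ∈ Icc a (a + T), ‖u t‖ ≤ 1 := by
  set V : ℝ → Z → Z := fun t u => F t (ze + ballRetraction 1 u) with hV
  have hin : ∀ u : Z, ‖ze + ballRetraction 1 u‖ ≤ ρ := fun u =>
    (norm_add_le _ _).trans (by linarith [norm_ballRetraction_le (Z := Z) one_pos u])
  have hzeρ : ‖ze‖ ≤ ρ := by linarith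
  have hVlip : ∀ t, a ≤ t → ∀ z z', ‖V t z - V t z'‖ ≤ (2 * L) * ‖z - z'‖ := fun t ht z z' => by
    refine (hlip t (ha.trans ht) _ _ (hin z) (hin z')).trans ?_
    rw [add_sub_add_left_eq_sub]
    have := mul_le_mul_of_nonneg_left (norm_ballRetraction_sub_le (Z := Z) one_pos z z') hL.le
    linarith
  have hVB : ∀ t, a ≤ t → ∀ z, ‖V t z‖ ≤ L := fun t ht z => by
    have h := hlip t (ha.trans ht) _ _ (hin z) hzeρ
    rw [hze t (ha.trans ht), sub_zero, add_sub_cancel_left] at h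
    exact h.trans (mul_le_of_le_one_right hL.le (norm_ballRetraction_le one_pos z))
  have hV0 : ∀ t, a ≤ t → V t 0 = 0 := fun t ht => by
    simp only [hV]
    rw [ballRetraction_of_norm_le one_pos (by simp), add_zero, hze t (ha.trans ht)]
  obtain ⟨u, hu⟩ := exists_isSolution_of_lipschitz (V := V) (t₀ := a) (by positivity) hVlip hVB
    (fun z hz => (hF.comp (continuous_id.prodMk (continuous_const.add
      ((continuous_ballRetraction one_pos).comp hz)))).aestronglyMeasurable) w
  have hu1 : ∀ t ∈ Icc a (a + T), ‖u t‖ ≤ 1 := by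
    intro t ht
    have hsub : Icc a (a + T) ⊆ Ici a := fun x hx => hx.1
    have h := norm_le_exp_of_defect (u := u) (v := fun t => V t (u t)) (δ := 0) (m := 0)
      (L := 2 * L) (by positivity) le_rfl (hu.continuousOn.mono hsub) (fun x hx => by
        rw [hu.apply_initial self_mem_Ici, sub_sub, ← hu.eq_integral x (hsub hx)]; simp)
      (fun x hx => by
        have := hVlip x hx.1 (u x) 0
        rw [hV0 x hx.1, sub_zero, sub_zero] at this
        simpa using this) t ht
    rw [hu.apply_initial self_mem_Ici, add_zero, zero_mul, add_zero] at h
    refine h.trans (le_trans ?_ hw)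
    gcongr
    linarith [ht.2]
  refine ⟨u, ?_, hu1⟩
  have hVF : ∀ τ ∈ Icc a (a + T), V τ (u τ) = F τ (ze + u τ) := fun τ hτ => by
    simp only [hV]
    rw [ballRetraction_of_norm_le one_pos (hu1 τ hτ)]
  have h := (hu.mono (J' := Icc a (a + T)) fun x hx => hx.1).congr_field
    (V' := fun τ v => F τ (ze + v)) fun t ht τ hτ => hVF τ (by
      rw [uIcc_of_le ht.1] at hτ; exact ⟨hτ.1, hτ.2.trans ht.2⟩)
  exact ⟨continuousOn_const.add h.continuousOn, h.intervalIntegrable, fun t ht => by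
    rw [h.eq_integral t ht]; abel⟩

/-- Near an exponentially stable equilibrium, the distance of an approximate trajectory to an exact
one is halved, up to the defect, over windows of a fixed length. The difference `ζ - z` is compared
with the deviation `u` from the equilibrium of the exact solution with the same initial deviation:
`u` decays, and the second difference of `F` controls the discrepancy. -/
lemma exists_contraction_near_equilibrium [CompleteSpace Z]
    (hF : Continuous fun q : ℝ × Z => F q.1 q.2) (hC11 : UniformlyC11 F) {ze : Z}
    (hze : IsExpStableEquilibrium F ze) (R : ℝ) :
    ∃ T > (0 : ℝ), ∃ r > (0 : ℝ), ∃ C > (0 : ℝ), ∃ μ > (0 : ℝ), ∀ a δ : ℝ, 0 ≤ a → 0 ≤ δ →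
      ∀ ζ z : ℝ → Z, HasDefect F a (a + T) δ ζ → HasDefect F a (a + T) 0 z →
        (∀ t ∈ Icc a (a + T), ‖ζ t‖ ≤ R) → (∀ t ∈ Icc a (a + T), ‖z t - ze‖ ≤ r) →
        ‖ζ a - z a‖ ≤ μ →
        ‖ζ (a + T) - z (a + T)‖ ≤ 1 / 2 * ‖ζ a - z a‖ + C * δ := by
  obtain ⟨hze0, ρe, hρe, M, hM, lam, hlam, hES⟩ := hze
  set R₂ : ℝ := |R| + 2 * ‖ze‖ + 2 with hR₂
  obtain ⟨L, hL, hLt⟩ := hC11 R₂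
  obtain ⟨T, hT, hTM⟩ : ∃ T > (0 : ℝ), M * Real.exp (-lam * T) ≤ 1 / 4 := by
    have hlim : Tendsto (fun T : ℝ => M * Real.exp (-lam * T)) atTop (𝓝 0) := by
      have h1 : Tendsto (fun T : ℝ => -lam * T) atTop atBot :=
        (tendsto_id.const_mul_atTop_of_neg (by linarith))
      simpa using (Real.tendsto_exp_atBot.comp h1).const_mul M
    obtain ⟨T, h1, h2⟩ :=
      ((hlim.eventually (gt_mem_nhds (show (0 : ℝ) < 1 / 4 by norm_num))).and
        (eventually_gt_atTop 0)).exists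
    exact ⟨T, h2, h1.le⟩
  -- the radius `r` makes the second differences so small that, over one window, they contribute at
  -- most a quarter of the initial distance; decay of `u` to a quarter leaves one half in total
  set E : ℝ := Real.exp (L * T) with hE
  have hE0 : 0 < E := Real.exp_pos _
  have hnE := norm_nonneg ze
  have hR0 := abs_nonneg R
  have hRR := le_abs_self R
  refine ⟨T, hT, min 1 (1 / (4 * T * L * E * E)), lt_min one_pos (by positivity),
    E * (1 + T) + 1 / 4 * (1 + T), by positivity,
    min ρe (1 / Real.exp (2 * L * T)), lt_min hρe (by positivity), ?_⟩
  set r : ℝ := min 1 (1 / (4 * T * L * E * E)) with hr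
  have hr0 : 0 < r := lt_min one_pos (by positivity)
  intro a δ ha hδ ζ z hζ hz hζR hzr hμ
  set w₀ : Z := ζ a - z a with hw₀
  have haT : a ≤ a + T := by linarith
  have hw1 : ‖w₀‖ * Real.exp (2 * L * T) ≤ 1 := by
    have := hμ.trans (min_le_right _ _)
    rwa [le_div_iff₀ (Real.exp_pos _)] at this
  have hlip : ∀ t, 0 ≤ t → ∀ z z', ‖z‖ ≤ R₂ → ‖z'‖ ≤ R₂ → ‖F t z - F t z'‖ ≤ L * ‖z - z'‖ :=
    fun t ht => (hLt t ht).2.1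
  obtain ⟨u, husol, hu1⟩ := exists_isSolution_near_equilibrium hF hze0 hL
    (show ‖ze‖ + 1 ≤ R₂ by rw [hR₂]; linarith) hlip ha (T := T) hw1
  have hua : u a = w₀ := by
    have := husol.apply_initial (left_mem_Icc.2 haT)
    exact add_left_cancel this
  have huT : ‖u (a + T)‖ ≤ 1 / 4 * ‖w₀‖ := by
    have h := hES a (a + T) ha haT (ze + w₀) _ (by
      simpa using hμ.trans (min_le_left _ _)) husol (a + T) (right_mem_Icc.2 haT)
    simp only [add_sub_cancel_left] at h
    exact h.trans (mul_le_mul_of_nonneg_right hTM (norm_nonneg _))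
  have hzn : ∀ t ∈ Icc a (a + T), ‖z t‖ ≤ ‖ze‖ + 1 := fun t ht => by
    have h1 := (hzr t ht).trans (min_le_left _ _)
    have h2 := norm_le_norm_add_norm_sub' (z t) ze
    linarith
  have hζ₂ : ∀ t ∈ Icc a (a + T), ‖ζ t‖ ≤ R₂ := fun t ht => by
    rw [hR₂]; linarith [hζR t ht]
  have hz₂ : ∀ t ∈ Icc a (a + T), ‖z t‖ ≤ R₂ := fun t ht => by
    rw [hR₂]; linarith [hzn t ht]
  have hwbd : ∀ t ∈ Icc a (a + T), ‖ζ t - z t‖ ≤ (‖w₀‖ + δ * (1 + T)) * E := by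
    intro t ht
    have h := norm_sub_le_of_hasDefect hF.continuousOn hL.le
      (fun t ht => hlip t (ha.trans ht.1)) hζ hz hζ₂ hz₂ (by simpa using hδ) t ht
    rw [add_zero, add_sub_cancel_left] at h
    refine h.trans (mul_le_mul_of_nonneg_left ?_ (by positivity))
    exact Real.exp_le_exp.2 (mul_le_mul_of_nonneg_left (by linarith [ht.2]) hL.le)
  -- `ζ - z - u` vanishes at time `a`, and `m` bounds the second difference that drives it
  set m : ℝ := L * (r * ((‖w₀‖ + δ * (1 + T)) * E)) with hm
  have hd := norm_le_exp_of_defect (u := fun t => ζ t - z t - u t)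
    (v := fun t => F t (ζ t) - F t (z t) - F t (ze + u t)) (a := a) (b := a + T)
    (δ := δ * (1 + T)) (m := m) hL.le (by positivity)
    ((hζ.continuousOn.sub hz.continuousOn).sub
      ((continuousOn_const (c := -ze)).add husol.continuousOn |>.congr fun t _ => by simp))
    (fun x hx => ?_) (fun x hx => ?_) (a + T) (right_mem_Icc.2 haT)
  · simp only [hua, add_sub_cancel_left] at hd
    rw [← hw₀, sub_self, norm_zero, zero_add, ← hE] at hd
    have h1 : m * T * E ≤ 1 / 4 * (‖w₀‖ + δ * (1 + T)) := by
      have h2 : r * (4 * T * L * E * E) ≤ 1 := by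
        have := min_le_right 1 (1 / (4 * T * L * E * E))
        rwa [← hr, le_div_iff₀ (by positivity)] at this
      have h3 : m * T * E = 1 / 4 * (r * (4 * T * L * E * E)) * (‖w₀‖ + δ * (1 + T)) := by
        rw [hm]; ring
      rw [h3]
      exact mul_le_mul_of_nonneg_right (by linarith) (by positivity)
    have h4 : ‖ζ (a + T) - z (a + T)‖
        ≤ ‖ζ (a + T) - z (a + T) - u (a + T)‖ + ‖u (a + T)‖ := by
      simpa using norm_add_le (ζ (a + T) - z (a + T) - u (a + T)) (u (a + T))
    have h5 : (δ * (1 + T) + m * T) * E = δ * (1 + T) * E + m * T * E := by ring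
    rw [h5] at hd
    linarith
  · have hi1 := intervalIntegrable_comp_of_continuousOn hF.continuousOn hζ.continuousOn
      le_rfl hx.1 hx.2
    have hi2 := intervalIntegrable_comp_of_continuousOn hF.continuousOn hz.continuousOn
      le_rfl hx.1 hx.2
    have hi3 := intervalIntegrable_comp_of_continuousOn hF.continuousOn husol.continuousOn
      le_rfl hx.1 hx.2
    rw [intervalIntegral.integral_sub (hi1.sub hi2) hi3, intervalIntegral.integral_sub hi1 hi2]
    have h1 := hζ.defect a x le_rfl hx.1 hx.2
    have h2 := hz.defect a x le_rfl hx.1 hx.2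
    rw [zero_mul, norm_le_zero_iff] at h2
    have h3 := husol.eq_integral x hx
    have h4 : u x - w₀ - ∫ τ in a..x, F τ (ze + u τ) = 0 := by
      have : u x = w₀ + ∫ τ in a..x, F τ (ze + u τ) := by
        rw [add_assoc] at h3; exact add_left_cancel h3
      rw [this]; abel
    calc _ = ‖(ζ x - ζ a - ∫ τ in a..x, F τ (ζ τ)) - (z x - z a - ∫ τ in a..x, F τ (z τ))
          - (u x - w₀ - ∫ τ in a..x, F τ (ze + u τ))‖ := by
          rw [hua]; congr 1; abel
      _ = ‖ζ x - ζ a - ∫ τ in a..x, F τ (ζ τ)‖ := by rw [h2, h4, sub_zero, sub_zero]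
      _ ≤ _ := h1.trans (mul_le_mul_of_nonneg_left (by linarith [hx.2]) hδ)
  · have hx0 : 0 ≤ x := ha.trans hx.1
    have hζx : ‖ζ x‖ ≤ R := hζR x hx
    -- `F (ζ) - F (z) - F (ze + (ζ - z))` is a second difference of `F`, because `F` vanishes at `ze`
    have hsd := (hLt x hx0).2.2 ze (z x - ze) (ζ x - z x) (by rw [hR₂]; linarith)
      (by simpa using hz₂ x hx) (by
        have h1 : ‖ze + (ζ x - z x)‖ ≤ ‖ze‖ + (‖ζ x‖ + ‖z x‖) :=
          (norm_add_le _ _).trans (by gcongr; exact norm_sub_le _ _)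
        rw [hR₂]; linarith [hzn x hx]) (by simpa using hζ₂ x hx)
    rw [add_sub_cancel, add_sub_cancel, hze0 x hx0, add_zero] at hsd
    have hl := hlip x hx0 (ze + (ζ x - z x)) (ze + u x) (by
        have h1 : ‖ze + (ζ x - z x)‖ ≤ ‖ze‖ + (‖ζ x‖ + ‖z x‖) :=
          (norm_add_le _ _).trans (by gcongr; exact norm_sub_le _ _)
        rw [hR₂]; linarith [hzn x hx]) (by
        have h1 := norm_add_le ze (u x)
        rw [hR₂]; linarith [hu1 x hx])
    rw [add_sub_add_left_eq_sub] at hl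
    have hb : L * ‖z x - ze‖ * ‖ζ x - z x‖ ≤ m := by
      rw [hm, mul_assoc]
      gcongr
      · exact hzr x hx
      · exact hwbd x hx
    calc _ = ‖(F x (ζ x) - F x (z x) - F x (ze + (ζ x - z x)))
          + (F x (ze + (ζ x - z x)) - F x (ze + u x))‖ := by congr 1; abel
      _ ≤ _ := norm_add_le _ _
      _ ≤ _ := by linarith

/-- Shadowing for all times near an exponentially stable equilibrium. -/
lemma exists_shadowing_near_equilibrium [CompleteSpace Z]
    (hF : Continuous fun q : ℝ × Z => F q.1 q.2) (hC11 : UniformlyC11 F) {ze : Z}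
    (hze : IsExpStableEquilibrium F ze) (R : ℝ) :
    ∃ r > (0 : ℝ), ∀ D : ℝ, ∃ C ≥ (0 : ℝ), ∃ δ₀ > (0 : ℝ), ∀ a b δ : ℝ, 0 ≤ a → 0 ≤ δ → δ ≤ δ₀ →
      ∀ ζ z : ℝ → Z, HasDefect F a b δ ζ → HasDefect F a b 0 z →
        (∀ t ∈ Icc a b, ‖ζ t‖ ≤ R) → (∀ t ∈ Icc a b, ‖z t - ze‖ ≤ r) →
        ‖ζ a - z a‖ ≤ D * δ → ∀ t ∈ Icc a b, ‖ζ t - z t‖ ≤ C * δ := by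
  obtain ⟨T, hT, r, hr, C, hC, μ, hμ, hcon⟩ :=
    exists_contraction_near_equilibrium hF hC11 hze R
  obtain ⟨L, hL, hLt⟩ := hC11 (max R (‖ze‖ + r))
  refine ⟨r, hr, fun D => ?_⟩
  -- the map `d ↦ d / 2 + C δ` preserves `d ≤ C₂ δ` as soon as `2 C ≤ C₂`
  set C₂ : ℝ := max D (2 * C) with hC₂
  have hC₂0 : 0 < C₂ := lt_max_of_lt_right (by positivity)
  refine ⟨(C₂ + (1 + T)) * Real.exp (L * T), by positivity, μ / C₂, by positivity, ?_⟩
  intro a b δ ha hδ hδ₀ ζ z hζ hz hζR hzr h0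
  have hμδ : C₂ * δ ≤ μ := by rwa [le_div_iff₀ hC₂0, mul_comm] at hδ₀
  have hk : ∀ k : ℕ, a + k * T ≤ b → ‖ζ (a + k * T) - z (a + k * T)‖ ≤ C₂ * δ := by
    intro k
    induction k with
    | zero =>
      intro _
      simpa using h0.trans (mul_le_mul_of_nonneg_right (le_max_left _ _) hδ)
    | succ k ih =>
      intro hkb
      have he : a + ((k + 1 : ℕ) : ℝ) * T = a + k * T + T := by push_cast; ring
      rw [he] at hkb ⊢
      have hak : a ≤ a + k * T := by have : 0 ≤ (k : ℝ) * T := by positivity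
                                     linarith
      have ih' := ih (by linarith)
      have hsub : Icc (a + k * T) (a + k * T + T) ⊆ Icc a b := Icc_subset_Icc hak hkb
      have h := hcon (a + k * T) δ (ha.trans hak) hδ ζ z (hζ.mono hak hkb) (hz.mono hak hkb)
        (fun t ht => hζR t (hsub ht)) (fun t ht => hzr t (hsub ht)) (ih'.trans hμδ)
      have h2 : C * δ ≤ 1 / 2 * (C₂ * δ) := by
        have : 2 * C ≤ C₂ := le_max_right _ _
        nlinarith
      linarith
  intro t ht
  -- within the last, incomplete window the distance grows at most by a fixed factor
  set k : ℕ := ⌊(t - a) / T⌋₊ with hkdef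
  have hta : 0 ≤ (t - a) / T := div_nonneg (by linarith [ht.1]) hT.le
  have hk1 : a + k * T ≤ t := by
    have := Nat.floor_le hta
    rw [← hkdef, le_div_iff₀ hT] at this
    linarith
  have hk2 : t ≤ a + k * T + T := by
    have := (Nat.lt_floor_add_one ((t - a) / T)).le
    rw [← hkdef, div_le_iff₀ hT] at this
    linarith
  have hak : a ≤ a + k * T := by have : 0 ≤ (k : ℝ) * T := by positivity
                                 linarith
  have hsub : Icc (a + k * T) t ⊆ Icc a b := Icc_subset_Icc hak ht.2
  have h := norm_sub_le_of_hasDefect hF.continuousOn hL.le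
    (fun s hs => (hLt s ((ha.trans hak).trans hs.1)).2.1) (hζ.mono hak ht.2) (hz.mono hak ht.2)
    (fun s hs => (hζR s (hsub hs)).trans (le_max_left _ _))
    (fun s hs => by
      have h1 := hzr s (hsub hs)
      have h2 := norm_le_norm_add_norm_sub' (z s) ze
      exact le_max_of_le_right (by linarith))
    (by simpa using hδ) t (right_mem_Icc.2 hk1)
  refine h.trans ?_
  have h1 := hk k (hk1.trans ht.2)
  have h2 : δ * (1 + (t - (a + k * T))) ≤ δ * (1 + T) :=
    mul_le_mul_of_nonneg_left (by linarith) hδ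
  have h3 : Real.exp (L * (t - (a + k * T))) ≤ Real.exp (L * T) :=
    Real.exp_le_exp.2 (mul_le_mul_of_nonneg_left (by linarith) hL.le)
  calc _ ≤ (C₂ * δ + δ * (1 + T)) * Real.exp (L * T) := by
        rw [add_zero]
        refine mul_le_mul (by linarith) h3 (Real.exp_pos _).le (by positivity)
    _ = _ := by ring

/-- Trajectories that start near an attracted one stay bounded, and shadow approximate trajectories
of size at most `R` for as long as these exist. -/
lemma exists_nhds_shadowing [CompleteSpace Z]
    (hF : Continuous fun q : ℝ × Z => F q.1 q.2) (hC11 : UniformlyC11 F) {zs : Z}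
    (hzs : zs ∈ attractionRegion F) (R : ℝ) :
    ∃ U ∈ 𝓝 zs, ∃ ρ : ℝ, ∃ C ≥ (0 : ℝ), ∃ δ₀ > (0 : ℝ), ∀ z₀ ∈ U, ∀ z : ℝ → Z,
      IsSolution F (Ici 0) 0 z₀ z → (∀ t, 0 ≤ t → ‖z t‖ ≤ ρ) ∧
        ∀ T δ : ℝ, 0 ≤ T → 0 ≤ δ → δ ≤ δ₀ → ∀ ζ : ℝ → Z, HasDefect F 0 T δ ζ → ζ 0 = z₀ →
          (∀ t ∈ Icc 0 T, ‖ζ t‖ ≤ R) → ∀ t ∈ Icc 0 T, ‖ζ t - z t‖ ≤ C * δ := by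
  obtain ⟨ze, hze, zr, hzr, hlim⟩ := hzs
  obtain ⟨r, hr, hsh⟩ := exists_shadowing_near_equilibrium hF hC11 hze R
  obtain ⟨-, ρe, hρe, M, hM, lam, hlam, hES⟩ := hze
  set r₀ : ℝ := min ρe (r / M) with hr₀
  have hr₀0 : 0 < r₀ := lt_min hρe (by positivity)
  -- the attracted trajectory has come close to the equilibrium at time `T₀`; until then Grönwall's
  -- inequality applies, afterwards the estimate near the equilibrium
  obtain ⟨T₀, hT₀, hT₀r⟩ : ∃ T₀ ≥ (0 : ℝ), ‖zr T₀ - ze‖ ≤ r₀ / 2 := by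
    have h1 : ∀ᶠ t in atTop, ‖zr t - ze‖ < r₀ / 2 := by
      have := (tendsto_iff_norm_sub_tendsto_zero.1 hlim).eventually
        (gt_mem_nhds (show (0 : ℝ) < r₀ / 2 by positivity))
      exact this
    obtain ⟨T₀, h2, h3⟩ := (h1.and (eventually_ge_atTop 0)).exists
    exact ⟨T₀, h3, h2.le⟩
  have hIccsub : ∀ T : ℝ, Icc 0 T ⊆ Ici (0 : ℝ) := fun T x hx => hx.1
  obtain ⟨ρs, hρs⟩ := (isCompact_Icc (a := (0 : ℝ)) (b := T₀)).exists_bound_of_continuousOn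
    (hzr.continuousOn.mono (hIccsub T₀))
  obtain ⟨L, hL, hLt⟩ := hC11 (ρs + 1)
  set β : ℝ := min 1 (r₀ / 2) with hβ
  have hβ0 : 0 < β := lt_min one_pos (by positivity)
  set ρ : ℝ := max (ρs + 1) (‖ze‖ + r) with hρ
  obtain ⟨L', hL', hLt'⟩ := hC11 (max R ρ)
  obtain ⟨C, hC, δ₀, hδ₀, hshC⟩ := hsh ((1 + T₀) * Real.exp (L' * T₀))
  refine ⟨Metric.ball zs (β * Real.exp (-(L * T₀))), Metric.ball_mem_nhds _ (by positivity), ρ,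
    max C ((1 + T₀) * Real.exp (L' * T₀)), le_max_of_le_left hC, δ₀, hδ₀, ?_⟩
  intro z₀ hz₀ z hz
  have hz00 : z 0 = z₀ := hz.apply_initial self_mem_Ici
  have hzr0 : zr 0 = zs := hzr.apply_initial self_mem_Ici
  have hzd : ∀ T, HasDefect F 0 T 0 z := fun T => (hz.mono (hIccsub T)).hasDefect
  have hzrd : ∀ T, HasDefect F 0 T 0 zr := fun T => (hzr.mono (hIccsub T)).hasDefect
  have hd0 : ‖z 0 - zr 0‖ < β * Real.exp (-(L * T₀)) := by
    rw [hz00, hzr0, ← dist_eq_norm]; exact hz₀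
  -- `z` remains `β`-close to `zr` up to time `T₀`, hence in the ball where `L` is a Lipschitz constant
  have hclose : ∀ t ∈ Icc 0 T₀, ‖z t - zr t‖ < β := by
    refine lt_of_bootstrap
      ((hz.continuousOn.mono (hIccsub T₀)).sub (hzr.continuousOn.mono (hIccsub T₀))).norm ?_ ?_
    · refine hd0.trans_le (mul_le_of_le_one_right hβ0.le (Real.exp_le_one_iff.2 ?_))
      have := mul_nonneg hL.le hT₀
      linarith
    · intro T' hT' hle t ht
      have hbd : ∀ t ∈ Icc 0 T', ‖zr t‖ ≤ ρs := fun t ht => hρs t ⟨ht.1, ht.2.trans hT'.2⟩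
      have h := norm_sub_le_of_hasDefect hF.continuousOn hL.le (fun s hs => (hLt s hs.1).2.1)
        (hzd T') (hzrd T')
        (fun t ht => by
          have h1 := norm_le_norm_add_norm_sub' (z t) (zr t)
          have h2 := (hle t ht).trans (min_le_left _ _)
          linarith [hbd t ht]) (fun t ht => by linarith [hbd t ht]) (by simp) t ht
      refine h.trans_lt ?_
      have h3 : Real.exp (L * (t - 0)) ≤ Real.exp (L * T₀) :=
        Real.exp_le_exp.2 (mul_le_mul_of_nonneg_left (by linarith [ht.2, hT'.2]) hL.le)
      calc _ ≤ ‖z 0 - zr 0‖ * Real.exp (L * T₀) := by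
            rw [add_zero, zero_mul, add_zero]
            exact mul_le_mul_of_nonneg_left h3 (norm_nonneg _)
        _ < β * Real.exp (-(L * T₀)) * Real.exp (L * T₀) :=
            mul_lt_mul_of_pos_right hd0 (Real.exp_pos _)
        _ = β := by rw [mul_assoc, ← Real.exp_add]; simp
  have hzT₀ : ‖z T₀ - ze‖ ≤ r₀ := by
    have h1 := (hclose T₀ (right_mem_Icc.2 hT₀)).le.trans (min_le_right _ _)
    have h2 := norm_sub_le_norm_sub_add_norm_sub (z T₀) (zr T₀) ze
    linarith
  have hzlate : ∀ t, T₀ ≤ t → ‖z t - ze‖ ≤ r := by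
    intro t ht
    have h := hES T₀ t hT₀ ht (z T₀) z (hzT₀.trans (min_le_left _ _))
      (hz.restart (show T₀ ∈ Ici 0 from hT₀) fun x hx => hT₀.trans hx.1) t (right_mem_Icc.2 ht)
    refine h.trans ?_
    have h1 : Real.exp (-lam * (t - T₀)) ≤ 1 := Real.exp_le_one_iff.2 (by nlinarith)
    calc M * Real.exp (-lam * (t - T₀)) * ‖z T₀ - ze‖ ≤ M * 1 * (r / M) := by
          gcongr
          exact hzT₀.trans (min_le_right _ _)
      _ = r := by field_simp
  have hzρ : ∀ t, 0 ≤ t → ‖z t‖ ≤ ρ := by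
    intro t ht
    rcases le_total t T₀ with h | h
    · have h1 := norm_le_norm_add_norm_sub' (z t) (zr t)
      have h2 := (hclose t ⟨ht, h⟩).le.trans (min_le_left _ _)
      have h3 := hρs t ⟨ht, h⟩
      exact le_max_of_le_left (by linarith)
    · have h1 := norm_le_norm_add_norm_sub' (z t) ze
      exact le_max_of_le_right (by linarith [hzlate t h])
  refine ⟨hzρ, fun T δ hT hδ hδδ₀ ζ hζ hζ0 hζR => ?_⟩
  have hearly : ∀ t, t ∈ Icc 0 T → t ≤ T₀ →
      ‖ζ t - z t‖ ≤ (1 + T₀) * Real.exp (L' * T₀) * δ := by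
    intro t ht htT₀
    have h := norm_sub_le_of_hasDefect hF.continuousOn hL'.le (fun s hs => (hLt' s hs.1).2.1)
      (hζ.mono le_rfl ht.2) (hzd t)
      (fun s hs => (hζR s ⟨hs.1, hs.2.trans ht.2⟩).trans (le_max_left _ _))
      (fun s hs => (hzρ s hs.1).trans (le_max_right _ _)) (by simpa using hδ) t
      (right_mem_Icc.2 ht.1)
    rw [hζ0, hz00, sub_self, norm_zero, zero_add, add_zero, sub_zero] at h
    refine h.trans ?_
    have h3 : Real.exp (L' * t) ≤ Real.exp (L' * T₀) :=
      Real.exp_le_exp.2 (mul_le_mul_of_nonneg_left htT₀ hL'.le)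
    calc δ * (1 + t) * Real.exp (L' * t) ≤ δ * (1 + T₀) * Real.exp (L' * T₀) := by
          have := ht.1
          gcongr
      _ = _ := by ring
  intro t ht
  rcases le_total t T₀ with h | h
  · exact (hearly t ht h).trans (mul_le_mul_of_nonneg_right (le_max_right _ _) hδ)
  · have h1 := hshC T₀ T δ hT₀ hδ hδδ₀ ζ z (hζ.mono hT₀ le_rfl) ((hzd T).mono hT₀ le_rfl)
      (fun s hs => hζR s ⟨hT₀.trans hs.1, hs.2⟩) (fun s hs => hzlate s hs.1)
      (hearly T₀ ⟨hT₀, h.trans ht.2⟩ le_rfl) t ⟨h, ht.2⟩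
    exact h1.trans (mul_le_mul_of_nonneg_right (le_max_left _ _) hδ)

/-- Shadowing, uniformly over a compact set of attracted initial states. -/
theorem exists_shadowing [CompleteSpace Z]
    (hF : Continuous fun q : ℝ × Z => F q.1 q.2) (hC11 : UniformlyC11 F) {K : Set Z}
    (hK : IsCompact K) (hKattr : K ⊆ attractionRegion F) (R : ℝ) :
    ∃ ρ : ℝ, ∃ C ≥ (0 : ℝ), ∃ δ₀ > (0 : ℝ), ∀ z₀ ∈ K, ∀ z : ℝ → Z,
      IsSolution F (Ici 0) 0 z₀ z → (∀ t, 0 ≤ t → ‖z t‖ ≤ ρ) ∧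
        ∀ T δ : ℝ, 0 ≤ T → 0 ≤ δ → δ ≤ δ₀ → ∀ ζ : ℝ → Z, HasDefect F 0 T δ ζ → ζ 0 = z₀ →
          (∀ t ∈ Icc 0 T, ‖ζ t‖ ≤ R) → ∀ t ∈ Icc 0 T, ‖ζ t - z t‖ ≤ C * δ := by
  refine hK.induction_on ⟨0, 0, le_rfl, 1, one_pos, by simp⟩ ?_ ?_ ?_
  · rintro s t hst ⟨ρ, C, hC, δ₀, hδ₀, h⟩
    exact ⟨ρ, C, hC, δ₀, hδ₀, fun z₀ hz₀ => h z₀ (hst hz₀)⟩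
  · rintro s t ⟨ρ₁, C₁, hC₁, δ₁, hδ₁, h₁⟩ ⟨ρ₂, C₂, hC₂, δ₂, hδ₂, h₂⟩
    refine ⟨max ρ₁ ρ₂, max C₁ C₂, le_max_of_le_left hC₁, min δ₁ δ₂, lt_min hδ₁ hδ₂, ?_⟩
    rintro z₀ (hz₀ | hz₀) z hz
    · obtain ⟨ha, hb⟩ := h₁ z₀ hz₀ z hz
      refine ⟨fun t ht => (ha t ht).trans (le_max_left _ _), fun T δ hT hδ hδ' ζ hζ h0 hR t ht => ?_⟩
      exact (hb T δ hT hδ (hδ'.trans (min_le_left _ _)) ζ hζ h0 hR t ht).trans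
        (mul_le_mul_of_nonneg_right (le_max_left _ _) hδ)
    · obtain ⟨ha, hb⟩ := h₂ z₀ hz₀ z hz
      refine ⟨fun t ht => (ha t ht).trans (le_max_right _ _), fun T δ hT hδ hδ' ζ hζ h0 hR t ht => ?_⟩
      exact (hb T δ hT hδ (hδ'.trans (min_le_right _ _)) ζ hζ h0 hR t ht).trans
        (mul_le_mul_of_nonneg_right (le_max_right _ _) hδ)
  · intro x hx
    obtain ⟨U, hU, ρ, C, hC, δ₀, hδ₀, h⟩ := exists_nhds_shadowing hF hC11 (hKattr hx) R
    exact ⟨U, mem_nhdsWithin_of_mem_nhds hU, ρ, C, hC, δ₀, hδ₀, h⟩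

end Shadowing

/-! ### Uniform regularity of the closed-loop vector field -/

lemma norm_second_difference_le {E F : Type*} [NormedAddCommGroup E] [NormedSpace ℝ E]
    [NormedAddCommGroup F] [NormedSpace ℝ F] {φ : E → F} (hφ : Differentiable ℝ φ) {s : Set E}
    (hs : Convex ℝ s) {L : ℝ}
    (hlip : ∀ x ∈ s, ∀ y ∈ s, ‖fderiv ℝ φ x - fderiv ℝ φ y‖ ≤ L * ‖x - y‖) {z w d : E}
    (h0 : z ∈ s) (hw : z + w ∈ s) (hd : z + d ∈ s) (hwd : z + w + d ∈ s) :
    ‖φ (z + w + d) - φ (z + w) - φ (z + d) + φ z‖ ≤ L * ‖w‖ * ‖d‖ := by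
  have hconv : Convex ℝ (s ∩ (fun v => w + v) ⁻¹' s) := hs.inter (hs.translate_preimage_right w)
  have hder : ∀ v ∈ s ∩ (fun v => w + v) ⁻¹' s,
      HasFDerivWithinAt (fun v => φ (w + v) - φ v) (fderiv ℝ φ (w + v) - fderiv ℝ φ v)
        (s ∩ (fun v => w + v) ⁻¹' s) v := fun v _ => by
    have h1 : HasFDerivAt (fun v => φ (w + v)) (fderiv ℝ φ (w + v)) v := by
      have h := (hφ (w + v)).hasFDerivAt.comp v ((hasFDerivAt_id v).const_add w)
      rwa [ContinuousLinearMap.comp_id] at h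
    exact (h1.sub (hφ v).hasFDerivAt).hasFDerivWithinAt
  have h := hconv.norm_image_sub_le_of_norm_hasFDerivWithin_le (C := L * ‖w‖) hder
    (fun v hv => by simpa using hlip (w + v) hv.2 v hv.1)
    (x := z) (y := z + d) ⟨h0, by simpa [add_comm] using hw⟩
    ⟨hd, by simpa [add_comm, add_left_comm, add_assoc] using hwd⟩
  rw [add_sub_cancel_left] at h
  refine le_trans (le_of_eq ?_) h
  have e1 : w + (z + d) = z + w + d := by abel
  rw [e1, add_comm w z]
  congr 1
  abel

section OfContDiff

variable {Z E : Type*} [NormedAddCommGroup Z] [NormedSpace ℝ Z] [NormedAddCommGroup E]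
  [NormedSpace ℝ E]

/-- A `C¹` map is bounded and Lipschitz on every ball. -/
lemma exists_bound_lipschitz_of_contDiff [FiniteDimensional ℝ Z] {φ : Z → E}
    (hφ : ContDiff ℝ 1 φ) (ρ : ℝ) : ∃ L : ℝ, 0 < L ∧ (∀ z, ‖z‖ ≤ ρ → ‖φ z‖ ≤ L) ∧
      (∀ z z', ‖z‖ ≤ ρ → ‖z'‖ ≤ ρ → ‖φ z - φ z'‖ ≤ L * ‖z - z'‖) := by
  have hcomp : IsCompact (Metric.closedBall (0 : Z) ρ) := isCompact_closedBall _ _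
  obtain ⟨A, hA⟩ := hcomp.exists_bound_of_continuousOn hφ.continuous.continuousOn
  obtain ⟨k, hk⟩ := (hφ.contDiffOn (s := Metric.closedBall (0 : Z) ρ)).exists_lipschitzOnWith
    one_ne_zero (convex_closedBall _ _) hcomp
  have hk0 := k.coe_nonneg
  have hmem : ∀ z : Z, ‖z‖ ≤ ρ → z ∈ Metric.closedBall (0 : Z) ρ := fun z hz => by simpa using hz
  refine ⟨1 + |A| + k, by positivity, fun z hz => ?_, fun z z' hz hz' => ?_⟩
  · linarith [hA z (hmem z hz), le_abs_self A]
  · have h := hk.dist_le_mul z (hmem z hz) z' (hmem z' hz')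
    rw [dist_eq_norm, dist_eq_norm] at h
    refine h.trans (mul_le_mul_of_nonneg_right ?_ (norm_nonneg _))
    linarith [abs_nonneg A]

/-- A `C²` map is bounded and Lipschitz on every ball, and so is its derivative. -/
lemma exists_lipschitz_fderiv_of_contDiff [FiniteDimensional ℝ Z] {φ : Z → E}
    (hφ : ContDiff ℝ 2 φ) (ρ : ℝ) : ∃ L : ℝ, 0 < L ∧ (∀ z, ‖z‖ ≤ ρ → ‖φ z‖ ≤ L) ∧
      (∀ z z', ‖z‖ ≤ ρ → ‖z'‖ ≤ ρ → ‖φ z - φ z'‖ ≤ L * ‖z - z'‖) ∧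
      (∀ z z', ‖z‖ ≤ ρ → ‖z'‖ ≤ ρ → ‖fderiv ℝ φ z - fderiv ℝ φ z'‖ ≤ L * ‖z - z'‖) := by
  obtain ⟨L, hL, h1, h2⟩ := exists_bound_lipschitz_of_contDiff (hφ.of_le one_le_two) ρ
  obtain ⟨L', hL', -, h4⟩ := exists_bound_lipschitz_of_contDiff (φ := fderiv ℝ φ)
    (hφ.fderiv_right (by norm_num)) ρ
  refine ⟨L + L', by positivity, fun z hz => (h1 z hz).trans (by linarith),
    fun z z' hz hz' => (h2 z z' hz hz').trans (by gcongr; linarith),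
    fun z z' hz hz' => (h4 z z' hz hz').trans (by gcongr; linarith)⟩

lemma UniformlyC11.of_contDiff [FiniteDimensional ℝ Z] {φ : Z → E} (hφ : ContDiff ℝ 2 φ) :
    UniformlyC11 fun _ => φ := by
  intro ρ
  obtain ⟨L, hL, h0, h1, h2⟩ := exists_lipschitz_fderiv_of_contDiff hφ ρ
  have hmem : ∀ z : Z, ‖z‖ ≤ ρ → z ∈ Metric.closedBall (0 : Z) ρ := fun z hz => by simpa using hz
  refine ⟨L, hL, fun t _ => ⟨h0, h1, fun z w d hz hw hd hwd => ?_⟩⟩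
  exact norm_second_difference_le (hφ.differentiable two_ne_zero) (convex_closedBall (0 : Z) ρ)
    (fun x hx y hy => h2 x y (by simpa using hx) (by simpa using hy))
    (hmem _ hz) (hmem _ hw) (hmem _ hd) (hmem _ hwd)

end OfContDiff

section Closure

variable {Z E Y : Type*} [NormedAddCommGroup Z] [NormedAddCommGroup E] [NormedAddCommGroup Y]

lemma UniformlyC11.add {G H : ℝ → Z → E} (hG : UniformlyC11 G) (hH : UniformlyC11 H) :
    UniformlyC11 fun t z => G t z + H t z := by
  intro ρ
  obtain ⟨L, hL, hGL⟩ := hG ρ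
  obtain ⟨L', hL', hHL⟩ := hH ρ
  refine ⟨L + L', by positivity, fun t ht => ?_⟩
  obtain ⟨a, b, c⟩ := hGL t ht
  obtain ⟨a', b', c'⟩ := hHL t ht
  refine ⟨fun z hz => ?_, fun z z' hz hz' => ?_, fun z w d hz hw hd hwd => ?_⟩
  · exact norm_add_le_of_le (a z hz) (a' z hz)
  · rw [add_sub_add_comm, add_mul]
    exact norm_add_le_of_le (b z z' hz hz') (b' z z' hz hz')
  · have e : G t (z + w + d) + H t (z + w + d) - (G t (z + w) + H t (z + w))
        - (G t (z + d) + H t (z + d)) + (G t z + H t z)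
        = (G t (z + w + d) - G t (z + w) - G t (z + d) + G t z)
          + (H t (z + w + d) - H t (z + w) - H t (z + d) + H t z) := by abel
    rw [e, add_mul, add_mul]
    exact norm_add_le_of_le (c z w d hz hw hd hwd) (c' z w d hz hw hd hwd)

lemma UniformlyC11.smul [NormedSpace ℝ E] {k : ℝ → Z → ℝ} {G : ℝ → Z → E}
    (hk : UniformlyC11 k) (hG : UniformlyC11 G) : UniformlyC11 fun t z => k t z • G t z := by
  intro ρ
  obtain ⟨L, hL, hkL⟩ := hk ρ
  obtain ⟨L', hL', hGL⟩ := hG ρ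
  refine ⟨4 * (L * L'), by positivity, fun t ht => ?_⟩
  obtain ⟨a, b, c⟩ := hkL t ht
  obtain ⟨a', b', c'⟩ := hGL t ht
  have hmul : ∀ (x : ℝ) (v : E) (p q : ℝ), ‖x‖ ≤ p → ‖v‖ ≤ q → ‖x • v‖ ≤ p * q :=
    fun x v p q hx hv => by
      rw [norm_smul]
      exact mul_le_mul hx hv (norm_nonneg _) ((norm_nonneg _).trans hx)
  have hLL : 0 < L * L' := mul_pos hL hL'
  refine ⟨fun z hz => ?_, fun z z' hz hz' => ?_, fun z w d hz hw hd hwd => ?_⟩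
  · linarith [hmul _ _ _ _ (a z hz) (a' z hz)]
  · have e : k t z • G t z - k t z' • G t z'
        = k t z • (G t z - G t z') + (k t z - k t z') • G t z' := by module
    have h1 := hmul _ _ _ _ (a z hz) (b' z z' hz hz')
    have h2 := hmul _ _ _ _ (b z z' hz hz') (a' z' hz')
    rw [e]
    have h3 : 0 ≤ L * L' * ‖z - z'‖ := by positivity
    refine (norm_add_le_of_le h1 h2).trans ?_
    nlinarith
  · have e : k t (z + w + d) • G t (z + w + d) - k t (z + w) • G t (z + w)
          - k t (z + d) • G t (z + d) + k t z • G t z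
        = (k t (z + w + d) - k t (z + w) - k t (z + d) + k t z) • G t (z + w + d)
          + k t (z + w) • (G t (z + w + d) - G t (z + w) - G t (z + d) + G t z)
          + (k t (z + w) - k t z) • (G t (z + d) - G t z)
          + (k t (z + d) - k t z) • (G t (z + w + d) - G t (z + d)) := by module
    have h1 := hmul _ _ _ _ (c z w d hz hw hd hwd) (a' _ hwd)
    have h2 := hmul _ _ _ _ (a _ hw) (c' z w d hz hw hd hwd)
    have h3 := hmul _ _ _ _ (b _ _ hw hz) (b' _ _ hd hz)
    have h4 := hmul _ _ _ _ (b _ _ hd hz) (b' _ _ hwd hd)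
    have e1 : z + w + d - (z + d) = w := by abel
    simp only [add_sub_cancel_left, e1] at h3 h4
    rw [e]
    refine (norm_add_le_of_le (norm_add_le_of_le (norm_add_le_of_le h1 h2) h3) h4).trans
      (le_of_eq ?_)
    ring

lemma UniformlyC11.prodMk {G : ℝ → Z → E} {H : ℝ → Z → Y} (hG : UniformlyC11 G)
    (hH : UniformlyC11 H) : UniformlyC11 fun t z => (G t z, H t z) := by
  intro ρ
  obtain ⟨L, hL, hGL⟩ := hG ρ
  obtain ⟨L', hL', hHL⟩ := hH ρ
  refine ⟨max L L', lt_max_of_lt_left hL, fun t ht => ?_⟩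
  obtain ⟨a, b, c⟩ := hGL t ht
  obtain ⟨a', b', c'⟩ := hHL t ht
  have hl := le_max_left L L'
  have hr := le_max_right L L'
  refine ⟨fun z hz => ?_, fun z z' hz hz' => ?_, fun z w d hz hw hd hwd => ?_⟩
  · exact max_le ((a z hz).trans hl) ((a' z hz).trans hr)
  · exact max_le ((b z z' hz hz').trans (by gcongr)) ((b' z z' hz hz').trans (by gcongr))
  · exact max_le ((c z w d hz hw hd hwd).trans (by gcongr))
      ((c' z w d hz hw hd hwd).trans (by gcongr))

lemma UniformlyC11.comp {G : ℝ → Y → E} {ψ : ℝ → Z → Y} (hG : UniformlyC11 G)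
    (hψ : UniformlyC11 ψ) : UniformlyC11 fun t z => G t (ψ t z) := by
  intro ρ
  obtain ⟨L, hL, hψL⟩ := hψ ρ
  obtain ⟨L', hL', hGL⟩ := hG (3 * L)
  refine ⟨L' + L' * L + L' * L * L, by positivity, fun t ht => ?_⟩
  obtain ⟨a, b, c⟩ := hψL t ht
  obtain ⟨a', b', c'⟩ := hGL t ht
  have hψ3 : ∀ z, ‖z‖ ≤ ρ → ‖ψ t z‖ ≤ 3 * L := fun z hz => (a z hz).trans (by linarith)
  refine ⟨fun z hz => ?_, fun z z' hz hz' => ?_, fun z w d hz hw hd hwd => ?_⟩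
  · refine (a' _ (hψ3 z hz)).trans ?_
    have : 0 ≤ L' * L + L' * L * L := by positivity
    linarith
  · refine (b' _ _ (hψ3 z hz) (hψ3 z' hz')).trans ?_
    have h1 := mul_le_mul_of_nonneg_left (b z z' hz hz') hL'.le
    have h2 : 0 ≤ (L' + L' * L * L) * ‖z - z'‖ := by positivity
    nlinarith
  · set p := ψ t (z + w) - ψ t z with hp
    set q := ψ t (z + d) - ψ t z with hq
    have hpn : ‖p‖ ≤ L * ‖w‖ := by simpa using b _ _ hw hz
    have hqn : ‖q‖ ≤ L * ‖d‖ := by simpa using b _ _ hd hz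
    have e1 : ψ t z + p = ψ t (z + w) := by rw [hp]; abel
    have e2 : ψ t z + q = ψ t (z + d) := by rw [hq]; abel
    have h3 : ‖ψ t z + p + q‖ ≤ 3 * L := by
      have : ψ t z + p + q = ψ t (z + w) + ψ t (z + d) - ψ t z := by rw [hp, hq]; abel
      rw [this]
      refine (norm_sub_le _ _).trans ?_
      linarith [norm_add_le_of_le (a _ hw) (a _ hd), a z hz]
    have h4 := c' (ψ t z) p q (hψ3 z hz) (e1 ▸ hψ3 _ hw) (e2 ▸ hψ3 _ hd) h3
    have h5 := b' (ψ t (z + w + d)) (ψ t z + p + q) (hψ3 _ hwd) h3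
    have e3 : ψ t (z + w + d) - (ψ t z + p + q)
        = ψ t (z + w + d) - ψ t (z + w) - ψ t (z + d) + ψ t z := by rw [hp, hq]; abel
    rw [e3] at h5
    have h6 := mul_le_mul_of_nonneg_left (c z w d hz hw hd hwd) hL'.le
    rw [e1, e2] at h4
    have e4 : G t (ψ t (z + w + d)) - G t (ψ t (z + w)) - G t (ψ t (z + d)) + G t (ψ t z)
        = (G t (ψ t (z + w + d)) - G t (ψ t z + p + q))
          + (G t (ψ t z + p + q) - G t (ψ t (z + w)) - G t (ψ t (z + d)) + G t (ψ t z)) := by abel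
    have h7 : L' * ‖p‖ * ‖q‖ ≤ L' * (L * ‖w‖) * (L * ‖d‖) := by gcongr
    rw [e4]
    rw [← e1] at h4 h5 h6 ⊢
    refine (norm_add_le_of_le (h5.trans h6) (h4.trans h7)).trans ?_
    have : 0 ≤ L' * (‖w‖ * ‖d‖) := by positivity
    nlinarith

end Closure

section Controller

variable {n p : ℕ} {f g : Vec n → Vec n} {h : Vec n → ℝ}

lemma UniformlyC2.uniformlyC11 {F : Type*} [NormedAddCommGroup F] [NormedSpace ℝ F]
    {b : Vec p → ℝ → ℝ → ℝ → F} (hb : UniformlyC2 b) :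
    UniformlyC11 fun t (q : Vec p × ℝ × ℝ) => b q.1 q.2.1 q.2.2 t := by
  intro ρ
  obtain ⟨hC, hbd⟩ := hb
  obtain ⟨B, hB⟩ := hbd (Metric.closedBall 0 ρ) (isCompact_closedBall _ _)
  set Φ : Vec p × ℝ × ℝ × ℝ → F := fun q => b q.1 q.2.1 q.2.2.1 q.2.2.2 with hΦ
  set D : Set (Vec p × ℝ × ℝ × ℝ) :=
    {q | ‖q.1‖ ≤ ρ ∧ ‖q.2.1‖ ≤ ρ ∧ ‖q.2.2.1‖ ≤ ρ ∧ 0 ≤ q.2.2.2} with hD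
  have hDconv : Convex ℝ D := by
    have hn : ∀ {V : Type} [NormedAddCommGroup V] [NormedSpace ℝ V]
        (ℓ : Vec p × ℝ × ℝ × ℝ →ₗ[ℝ] V), Convex ℝ {q | ‖ℓ q‖ ≤ ρ} := by
      intro V _ _ ℓ
      have e : {q | ‖ℓ q‖ ≤ ρ} = ℓ ⁻¹' Metric.closedBall (0 : V) ρ := by ext q; simp
      rw [e]
      exact (convex_closedBall (0 : V) ρ).linear_preimage ℓ
    have h1 := hn (LinearMap.fst ℝ (Vec p) (ℝ × ℝ × ℝ))
    have h2 := hn (LinearMap.fst ℝ ℝ (ℝ × ℝ) ∘ₗ LinearMap.snd ℝ (Vec p) (ℝ × ℝ × ℝ))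
    have h3 := hn (LinearMap.fst ℝ ℝ ℝ ∘ₗ LinearMap.snd ℝ ℝ (ℝ × ℝ) ∘ₗ
      LinearMap.snd ℝ (Vec p) (ℝ × ℝ × ℝ))
    have h4 : Convex ℝ {q : Vec p × ℝ × ℝ × ℝ | 0 ≤ q.2.2.2} :=
      (convex_Ici (0 : ℝ)).linear_preimage (LinearMap.snd ℝ ℝ ℝ ∘ₗ LinearMap.snd ℝ ℝ (ℝ × ℝ) ∘ₗ
        LinearMap.snd ℝ (Vec p) (ℝ × ℝ × ℝ))
    exact h1.inter (h2.inter (h3.inter h4))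
  have hmemQ : ∀ q ∈ D, (q.1, q.2.1, q.2.2.1) ∈ Metric.closedBall (0 : Vec p × ℝ × ℝ) ρ := by
    intro q hq
    rw [mem_closedBall_zero_iff]
    exact max_le hq.1 (max_le hq.2.1 hq.2.2.1)
  have hB' : ∀ k ≤ 2, ∀ q ∈ D, ‖iteratedFDeriv ℝ k Φ q‖ ≤ B := fun k hk q hq =>
    hB k hk q.1 q.2.1 q.2.2.1 q.2.2.2 (hmemQ q hq) hq.2.2.2
  have hmem : ∀ t, 0 ≤ t → ∀ q : Vec p × ℝ × ℝ, ‖q‖ ≤ ρ → (q.1, q.2.1, q.2.2, t) ∈ D := by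
    intro t ht q hq
    exact ⟨(norm_fst_le q).trans hq, ((norm_fst_le q.2).trans (norm_snd_le q)).trans hq,
      ((norm_snd_le q.2).trans (norm_snd_le q)).trans hq, ht⟩
  have hnorm : ∀ q : Vec p × ℝ × ℝ, ‖((q.1, q.2.1, q.2.2, 0) : Vec p × ℝ × ℝ × ℝ)‖ ≤ ‖q‖ := by
    intro q
    exact max_le (norm_fst_le q) (max_le ((norm_fst_le q.2).trans (norm_snd_le q))
      (max_le ((norm_snd_le q.2).trans (norm_snd_le q)) (by simp)))
  have hdiff : Differentiable ℝ Φ := hC.differentiable two_ne_zero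
  have hdiff' : Differentiable ℝ (fderiv ℝ Φ) :=
    (hC.fderiv_right (m := 1) (by norm_num)).differentiable one_ne_zero
  have hL1 : ∀ q ∈ D, ‖fderiv ℝ Φ q‖ ≤ B := fun q hq => by
    rw [← norm_iteratedFDeriv_one]; exact hB' 1 (by norm_num) q hq
  have hL2 : ∀ q ∈ D, ‖fderiv ℝ (fderiv ℝ Φ) q‖ ≤ B := fun q hq => by
    rw [← norm_iteratedFDeriv_one, norm_iteratedFDeriv_fderiv]; exact hB' 2 le_rfl q hq
  refine ⟨max B 1, lt_max_of_lt_right one_pos, fun t ht => ⟨fun q hq => ?_, fun q q' hq hq' => ?_,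
    fun q w d hq hw hd hwd => ?_⟩⟩
  · have := hB' 0 (by norm_num) _ (hmem t ht q hq)
    rw [norm_iteratedFDeriv_zero] at this
    exact this.trans (le_max_left _ _)
  · have h1 := hDconv.norm_image_sub_le_of_norm_fderiv_le (fun x _ => hdiff x) hL1
      (hmem t ht q' hq') (hmem t ht q hq)
    refine h1.trans ?_
    have h2 := hnorm (q - q')
    simp only [Prod.mk_sub_mk, sub_self]
    exact mul_le_mul (le_max_left _ _) h2 (norm_nonneg _) (le_max_of_le_right zero_le_one)
  · have h1 := norm_second_difference_le (L := B) hdiff hDconv (fun x hx y hy =>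
      hDconv.norm_image_sub_le_of_norm_fderiv_le (fun x _ => hdiff' x) hL2 hy hx)
      (z := (q.1, q.2.1, q.2.2, t)) (w := (w.1, w.2.1, w.2.2, 0)) (d := (d.1, d.2.1, d.2.2, 0))
      (hmem t ht q hq) (by simpa using hmem t ht _ hw) (by simpa using hmem t ht _ hd)
      (by simpa using hmem t ht _ hwd)
    simp only [Prod.mk_add_mk, add_zero] at h1
    refine h1.trans ?_
    have hB1 : B ≤ max B 1 := le_max_left _ _
    have hB0 : 0 ≤ max B 1 := le_max_of_le_right zero_le_one
    gcongr
    · exact hnorm w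
    · exact hnorm d

variable {α : Vec p → ℝ → ℝ → ℝ → ℝ} {a : Vec p → ℝ → ℝ → ℝ → Vec p}

/-- The right-hand side of the loop, in the arguments `(y, yv, v, z)` jointly. -/
lemma uniformlyC11_loopField (hf : ContDiff ℝ 2 f) (hg : ContDiff ℝ 2 g) (hα : UniformlyC2 α)
    (ha : UniformlyC2 a) : UniformlyC11 fun t (q : ℝ × ℝ × ℝ × Vec n × Vec p) =>
      loopField f g α a q.1 q.2.1 q.2.2.1 t q.2.2.2 := by
  have hx : ContDiff ℝ 2 fun q : ℝ × ℝ × ℝ × Vec n × Vec p => q.2.2.2.1 :=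
    contDiff_fst.comp (contDiff_snd.comp (contDiff_snd.comp contDiff_snd))
  have hη : ContDiff ℝ 2 fun q : ℝ × ℝ × ℝ × Vec n × Vec p => q.2.2.2.2 :=
    contDiff_snd.comp (contDiff_snd.comp (contDiff_snd.comp contDiff_snd))
  have hψ : UniformlyC11 fun (_ : ℝ) (q : ℝ × ℝ × ℝ × Vec n × Vec p) =>
      (q.2.2.2.2, q.1, q.2.1) :=
    .of_contDiff (hη.prodMk (contDiff_fst.prodMk (contDiff_fst.comp contDiff_snd)))
  have hv : UniformlyC11 fun (_ : ℝ) (q : ℝ × ℝ × ℝ × Vec n × Vec p) => q.2.2.1 :=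
    .of_contDiff (contDiff_fst.comp (contDiff_snd.comp contDiff_snd))
  have hf' := UniformlyC11.of_contDiff (hf.comp hx)
  have hg' := UniformlyC11.of_contDiff (hg.comp hx)
  have hα' := hα.uniformlyC11.comp hψ
  have ha' := ha.uniformlyC11.comp hψ
  have := (hf'.add ((hα'.add hv).smul hg')).prodMk ha'
  exact this

lemma uniformlyC11_nominalField (hf : ContDiff ℝ 2 f) (hg : ContDiff ℝ 2 g) (hh : ContDiff ℝ 2 h)
    (hLh : ContDiff ℝ 2 (lieDeriv g h)) (hα : UniformlyC2 α) (ha : UniformlyC2 a) :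
    UniformlyC11 (nominalField f g h α a) := by
  have hψ : UniformlyC11 fun (_ : ℝ) (z : Vec n × Vec p) =>
      (h z.1, lieDeriv g h z.1, (0 : ℝ), z) :=
    .of_contDiff ((hh.comp contDiff_fst).prodMk ((hLh.comp contDiff_fst).prodMk
      (contDiff_const.prodMk contDiff_id)))
  have := (uniformlyC11_loopField hf hg hα ha).comp hψ
  exact this

lemma UniformlyC2.continuous {F : Type*} [NormedAddCommGroup F] [NormedSpace ℝ F]
    {b : Vec p → ℝ → ℝ → ℝ → F} (hb : UniformlyC2 b) :
    Continuous fun q : Vec p × ℝ × ℝ × ℝ => b q.1 q.2.1 q.2.2.1 q.2.2.2 := hb.1.continuous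

/-- The right-hand side of the loop, as a function of all its arguments
`(y, yv, v, t, z)` jointly. -/
lemma continuous_loopField (hf : Continuous f) (hg : Continuous g) (hα : UniformlyC2 α)
    (ha : UniformlyC2 a) : Continuous fun q : ℝ × ℝ × ℝ × ℝ × Vec n × Vec p =>
      loopField f g α a q.1 q.2.1 q.2.2.1 q.2.2.2.1 q.2.2.2.2 := by
  have hα' := hα.continuous.comp (by fun_prop : Continuous
    fun q : ℝ × ℝ × ℝ × ℝ × Vec n × Vec p => (q.2.2.2.2.2, q.1, q.2.1, q.2.2.2.1))
  have ha' := ha.continuous.comp (by fun_prop : Continuous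
    fun q : ℝ × ℝ × ℝ × ℝ × Vec n × Vec p => (q.2.2.2.2.2, q.1, q.2.1, q.2.2.2.1))
  have hx : Continuous fun q : ℝ × ℝ × ℝ × ℝ × Vec n × Vec p => q.2.2.2.2.1 := by fun_prop
  have hv : Continuous fun q : ℝ × ℝ × ℝ × ℝ × Vec n × Vec p => q.2.2.1 := by fun_prop
  exact ((hf.comp hx).add ((hα'.add hv).smul (hg.comp hx))).prodMk ha'

lemma continuous_nominalField (hf : ContDiff ℝ 2 f) (hg : ContDiff ℝ 2 g) (hh : ContDiff ℝ 2 h)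
    (hLh : ContDiff ℝ 2 (lieDeriv g h)) (hα : UniformlyC2 α) (ha : UniformlyC2 a) :
    Continuous fun q : ℝ × Vec n × Vec p => nominalField f g h α a q.1 q.2 := by
  have hx : Continuous fun q : ℝ × Vec n × Vec p => q.2.1 := by fun_prop
  exact (continuous_loopField hf.continuous hg.continuous hα ha).comp
    ((hh.continuous.comp hx).prodMk ((hLh.continuous.comp hx).prodMk
      (continuous_const.prodMk (continuous_fst.prodMk continuous_snd))))

end Controller

/-! ### The near-identity change of state -/

/-- The slow part `x - ε S(t/ε) g(x)` of the state: subtracting the ripple that the injected signal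
causes leaves a curve that follows the averaged dynamics. -/
noncomputable def slowState {n : ℕ} (g : Vec n → Vec n) (s : ℝ → ℝ) (ε t : ℝ) (x : Vec n) : Vec n :=
  x - (ε * zeroMeanPrimitive s (t / ε)) • g x

lemma norm_sub_fderiv_le {E F : Type*} [NormedAddCommGroup E] [NormedSpace ℝ E]
    [NormedAddCommGroup F] [NormedSpace ℝ F] {φ : E → F} (hφ : Differentiable ℝ φ) {L ρ : ℝ}
    (hL : 0 ≤ L)
    (hlip : ∀ z z', ‖z‖ ≤ ρ → ‖z'‖ ≤ ρ → ‖fderiv ℝ φ z - fderiv ℝ φ z'‖ ≤ L * ‖z - z'‖)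
    {x ξ : E} (hx : ‖x‖ ≤ ρ) (hξ : ‖ξ‖ ≤ ρ) :
    ‖φ x - φ ξ - fderiv ℝ φ x (x - ξ)‖ ≤ L * ‖x - ξ‖ ^ 2 := by
  have hconv : Convex ℝ (Metric.closedBall (0 : E) ρ ∩ Metric.closedBall x ‖x - ξ‖) :=
    (convex_closedBall _ _).inter (convex_closedBall _ _)
  have h := hconv.norm_image_sub_le_of_norm_hasFDerivWithin_le' (f := φ) (f' := fderiv ℝ φ)
    (φ := fderiv ℝ φ x) (C := L * ‖x - ξ‖) (x := ξ) (y := x)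
    (fun v _ => (hφ v).hasFDerivAt.hasFDerivWithinAt)
    (fun v hv => (hlip v x (by simpa using hv.1) hx).trans (by
      have := hv.2
      rw [mem_closedBall_iff_norm] at this
      gcongr))
    ⟨by simpa using hξ, by rw [mem_closedBall_iff_norm, norm_sub_rev]⟩
    ⟨by simpa using hx, by simp⟩
  rwa [mul_assoc, ← sq] at h

section SlowState

variable {n : ℕ} {f g : Vec n → Vec n} {s : ℝ → ℝ}

lemma norm_slowState_sub_le {ε t W L : ℝ} {x : Vec n} (hε : 0 ≤ ε)
    (hW : ∀ σ, |zeroMeanPrimitive s σ| ≤ W) (hg : ‖g x‖ ≤ L) :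
    ‖x - slowState g s ε t x‖ ≤ ε * W * L := by
  have hW0 : 0 ≤ W := (abs_nonneg _).trans (hW 0)
  rw [slowState, sub_sub_cancel, norm_smul, norm_mul, Real.norm_of_nonneg hε, Real.norm_eq_abs]
  exact mul_le_mul (mul_le_mul_of_nonneg_left (hW _) hε) hg (norm_nonneg _) (by positivity)

/-- A correction `-ε φ'(x) g(x) S` turns the value at the state into the value at the slow state,
up to second order in `ε`. -/
lemma abs_sub_comp_slowState_le {φ : Vec n → ℝ} (hφ : Differentiable ℝ φ) {L ρ : ℝ} (hL : 0 ≤ L)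
    (hlip : ∀ z z', ‖z‖ ≤ ρ → ‖z'‖ ≤ ρ → ‖fderiv ℝ φ z - fderiv ℝ φ z'‖ ≤ L * ‖z - z'‖)
    {ε t : ℝ} {x : Vec n} (hx : ‖x‖ ≤ ρ) (hξ : ‖slowState g s ε t x‖ ≤ ρ) :
    |φ x + ε * (-lieDeriv g φ x * zeroMeanPrimitive s (t / ε)) - φ (slowState g s ε t x)|
      ≤ L * ‖x - slowState g s ε t x‖ ^ 2 := by
  have h := norm_sub_fderiv_le hφ hL hlip hx hξ
  have e : fderiv ℝ φ x (x - slowState g s ε t x)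
      = ε * zeroMeanPrimitive s (t / ε) * lieDeriv g φ x := by
    rw [slowState, sub_sub_cancel, map_smul, smul_eq_mul, lieDeriv]
  rw [e, Real.norm_eq_abs] at h
  refine le_trans (le_of_eq ?_) h
  congr 1
  ring

/-- Pointwise expansion of the velocity of the slow state. The terms of first order in `ε` that
contain the control `u` cancel; the remaining ones are a Lie bracket times `S` and a multiple of
`s S`, where `σ` and `v` stand for the values of `S` and `s`. -/
lemma norm_slow_velocity_sub_le (hf : Differentiable ℝ f) (hg : Differentiable ℝ g)
    {Lf Lg ρ : ℝ} (hLf : 0 ≤ Lf) (hLg : 0 ≤ Lg)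
    (hflip : ∀ z z', ‖z‖ ≤ ρ → ‖z'‖ ≤ ρ → ‖fderiv ℝ f z - fderiv ℝ f z'‖ ≤ Lf * ‖z - z'‖)
    (hglip : ∀ z z', ‖z‖ ≤ ρ → ‖z'‖ ≤ ρ → ‖fderiv ℝ g z - fderiv ℝ g z'‖ ≤ Lg * ‖z - z'‖)
    (hgB : ∀ z, ‖z‖ ≤ ρ → ‖g z‖ ≤ Lg) {ε σ v u ur A m d : ℝ} {x ξ : Vec n}
    (hξ : ξ = x - (ε * σ) • g x) (hx : ‖x‖ ≤ ρ) (hξρ : ‖ξ‖ ≤ ρ) (hu : |u| ≤ A)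
    (hm : |u - ur| ≤ m) (hd : ‖x - ξ‖ ≤ d) :
    ‖(f x + (u + v) • g x - ((ε * σ) • fderiv ℝ g x (f x + (u + v) • g x) + v • g x))
        - (f ξ + ur • g ξ)
        - (ε • σ • (fderiv ℝ f x (g x) - fderiv ℝ g x (f x))
          - ε • (v * σ) • fderiv ℝ g x (g x))‖
      ≤ (Lf + A * Lg) * d ^ 2 + m * Lg := by
  have hxξ : x - ξ = (ε * σ) • g x := by rw [hξ, sub_sub_cancel]
  have hA : 0 ≤ A := (abs_nonneg _).trans hu
  have h1 := norm_sub_fderiv_le hf hLf hflip hx hξρ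
  have h2 := norm_sub_fderiv_le hg hLg hglip hx hξρ
  have hd2 : ‖x - ξ‖ ^ 2 ≤ d ^ 2 := by gcongr
  have h3 : ‖u • (g x - g ξ - fderiv ℝ g x (x - ξ))‖ ≤ A * (Lg * d ^ 2) := by
    rw [norm_smul]
    exact mul_le_mul hu (h2.trans (by gcongr)) (norm_nonneg _) hA
  have h4 : ‖(u - ur) • g ξ‖ ≤ m * Lg := by
    rw [norm_smul]
    exact mul_le_mul hm (hgB ξ hξρ) (norm_nonneg _) ((abs_nonneg _).trans hm)
  have h5 : ‖f x - f ξ - fderiv ℝ f x (x - ξ)‖ ≤ Lf * d ^ 2 := h1.trans (by gcongr)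
  have e : (f x + (u + v) • g x - ((ε * σ) • fderiv ℝ g x (f x + (u + v) • g x) + v • g x))
        - (f ξ + ur • g ξ)
        - (ε • σ • (fderiv ℝ f x (g x) - fderiv ℝ g x (f x))
          - ε • (v * σ) • fderiv ℝ g x (g x))
      = (f x - f ξ - fderiv ℝ f x (x - ξ)) + u • (g x - g ξ - fderiv ℝ g x (x - ξ))
        + (u - ur) • g ξ := by
    rw [hxξ]
    simp only [map_add, map_smul]
    module
  rw [e]
  refine (norm_add₃_le).trans ?_
  linarith

/-- The slow state of a Carathéodory trajectory `x` with velocity `U` moves with velocity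
`U - (ε S g'(x) U + s g(x))`. -/
lemma slowState_sub_eq_integral (hg : ContDiff ℝ 1 g) (hs_meas : Measurable s)
    (hs_bdd : ∃ B : ℝ, ∀ σ : ℝ, |s σ| ≤ B) {ε : ℝ} (hε : 0 < ε) {x U : ℝ → Vec n} {a b B : ℝ}
    (hab : a ≤ b) (hU : IntervalIntegrable U volume a b) (hB : ∀ t ∈ Icc a b, ‖U t‖ ≤ B)
    (hx : ∀ t ∈ Icc a b, x t = x a + ∫ τ in a..t, U τ) :
    IntervalIntegrable (fun τ => U τ - ((ε * zeroMeanPrimitive s (τ / ε)) •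
        fderiv ℝ g (x τ) (U τ) + s (τ / ε) • g (x τ))) volume a b ∧
      slowState g s ε b (x b) - slowState g s ε a (x a)
        = ∫ τ in a..b, (U τ - ((ε * zeroMeanPrimitive s (τ / ε)) •
          fderiv ℝ g (x τ) (U τ) + s (τ / ε) • g (x τ))) := by
  have hB0 : 0 ≤ B := (norm_nonneg _).trans (hB a (left_mem_Icc.2 hab))
  have hsε : ∀ x y, IntervalIntegrable (fun τ => s (τ / ε)) volume x y :=
    intervalIntegrable_of_bounded (hs_meas.comp (measurable_id.div_const ε))
      (hs_bdd.imp fun B hB σ => hB _)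
  obtain ⟨Bs, hBs⟩ := hs_bdd
  have hUsub : ∀ t ∈ Icc a b, IntervalIntegrable U volume a t := fun t ht =>
    hU.mono_set (by rw [uIcc_of_le hab, uIcc_of_le ht.1]; exact Icc_subset_Icc_right ht.2)
  set G : Vec n × ℝ → Vec n := fun q => q.2 • g q.1 with hG
  have hGc : ContDiff ℝ 1 G := contDiff_snd.smul (hg.comp contDiff_fst)
  have hGd : ∀ (q v : Vec n × ℝ), fderiv ℝ G q v = q.2 • fderiv ℝ g q.1 v.1 + v.2 • g q.1 := by
    intro q v
    have h1 : HasFDerivAt (fun q : Vec n × ℝ => g q.1)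
        ((fderiv ℝ g q.1).comp (ContinuousLinearMap.fst ℝ (Vec n) ℝ)) q :=
      ((hg.differentiable one_ne_zero q.1).hasFDerivAt).comp q hasFDerivAt_fst
    have h2 : HasFDerivAt G _ q := (hasFDerivAt_snd (𝕜 := ℝ) (p := q)).smul h1
    rw [h2.fderiv]
    simp
  have key := integral_fderiv_comp_eq_sub hGc
    (u := fun τ => (x τ, ε * zeroMeanPrimitive s (τ / ε))) (U := fun τ => (U τ, s (τ / ε)))
    (a := a) (b := b) (B := max B Bs) hab
    ⟨hU.1.prodMk (hsε a b).1, hU.2.prodMk (hsε a b).2⟩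
    (fun t ht => max_le_max (hB t ht) (hBs _)) (fun t ht => by
      rw [intervalIntegral_prodMk (hUsub t ht) (hsε a t), intervalIntegral.integral_comp_div _ hε.ne',
        ← zeroMeanPrimitive_sub hs_meas ⟨Bs, hBs⟩, smul_eq_mul, Prod.mk_add_mk, ← hx t ht]
      congr 1
      ring)
  simp only [hGd] at key
  obtain ⟨hi, he⟩ := key
  refine ⟨hU.sub hi, ?_⟩
  rw [intervalIntegral.integral_sub hU hi, he, slowState, slowState]
  have hb : ∫ τ in a..b, U τ = x b - x a := by rw [hx b (right_mem_Icc.2 hab)]; abel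
  rw [hb]
  simp only [hG]
  abel

end SlowState

section SlowDefect

variable {n p : ℕ} {f g : Vec n → Vec n} {α : Vec p → ℝ → ℝ → ℝ → ℝ} {a : Vec p → ℝ → ℝ → ℝ → Vec p}
  {s : ℝ → ℝ}

set_option maxHeartbeats 800000 in
/-- The slow state, with the controller state, solves the system without injection up to a defect
of order `ε²`, provided that the signals `y`, `yv` fed to the controller agree up to `O(ε²)` with
the reference signals `yr`, `yvr`. -/
lemma exists_hasDefect_slowState (hf : ContDiff ℝ 2 f) (hg : ContDiff ℝ 2 g)
    (hα : UniformlyC2 α) (ha : UniformlyC2 a) (hs_meas : Measurable s)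
    (hs_bdd : ∃ B : ℝ, ∀ σ : ℝ, |s σ| ≤ B) (hs_per : Function.Periodic s 1)
    (hs_mean : ∫ σ in (0 : ℝ)..1, s σ = 0) (ρ ρy : ℝ) {N : ℝ} (hN : 0 ≤ N) :
    ∃ ε₁ > (0 : ℝ), ∃ C ≥ (0 : ℝ), ∀ ε, 0 < ε → ε < ε₁ → ∀ (T : ℝ) (z₀ : Vec n × Vec p)
      (x : ℝ → Vec n) (η : ℝ → Vec p) (y yv yr yvr : ℝ → ℝ),
      IsSolution (injectedField f g α a s ε y yv) (Icc 0 T) 0 z₀ (fun t => (x t, η t)) →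
      (∀ t ∈ Icc 0 T, ‖(x t, η t)‖ ≤ ρ) →
      ContinuousOn yr (Icc 0 T) → ContinuousOn yvr (Icc 0 T) →
      (∀ t ∈ Icc 0 T, |yr t| ≤ ρy ∧ |yvr t| ≤ ρy) →
      (∀ t ∈ Icc 0 T, |y t - yr t| ≤ N * ε ^ 2 ∧ |yv t - yvr t| ≤ N * ε ^ 2) →
      HasDefect (fun t z => loopField f g α a (yr t) (yvr t) 0 t z) 0 T (C * ε ^ 2)
        (fun t => (slowState g s ε t (x t), η t)) := by
  obtain ⟨W, hW⟩ := exists_bound_zeroMeanPrimitive hs_meas hs_bdd hs_per hs_mean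
  have hSc := continuous_zeroMeanPrimitive hs_meas hs_bdd
  have hSper := periodic_zeroMeanPrimitive hs_meas hs_bdd hs_per hs_mean
  have hSmean := integral_zeroMeanPrimitive hs_meas hs_bdd
  have hsSmean := integral_mul_zeroMeanPrimitive hs_meas hs_bdd hs_per hs_mean
  obtain ⟨Bs, hBs⟩ := hs_bdd
  have hW0 : 0 ≤ W := (abs_nonneg _).trans (hW 0)
  have hBs0 : 0 ≤ Bs := (abs_nonneg _).trans (hBs 0)
  obtain ⟨Lf, hLf, hfB, -, hflip⟩ := exists_lipschitz_fderiv_of_contDiff hf (ρ + 1)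
  obtain ⟨Lg, hLg, hgB, -, hglip⟩ := exists_lipschitz_fderiv_of_contDiff hg (ρ + 1)
  have hdf : ContDiff ℝ 1 (fderiv ℝ f) := hf.fderiv_right (by norm_num)
  have hdg : ContDiff ℝ 1 (fderiv ℝ g) := hg.fderiv_right (by norm_num)
  have hf1 : ContDiff ℝ 1 f := hf.of_le one_le_two
  have hg1 : ContDiff ℝ 1 g := hg.of_le one_le_two
  set c₁ : Vec n → Vec n := fun x => fderiv ℝ f x (g x) - fderiv ℝ g x (f x) with hc₁
  set c₂ : Vec n → Vec n := fun x => fderiv ℝ g x (g x) with hc₂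
  have hc₁C : ContDiff ℝ 1 c₁ := (hdf.clm_apply hg1).sub (hdg.clm_apply hf1)
  have hc₂C : ContDiff ℝ 1 c₂ := hdg.clm_apply hg1
  obtain ⟨L₁, hL₁, hc₁B, hc₁lip⟩ := exists_bound_lipschitz_of_contDiff hc₁C (ρ + 1)
  obtain ⟨L₂, hL₂, hc₂B, hc₂lip⟩ := exists_bound_lipschitz_of_contDiff hc₂C (ρ + 1)
  obtain ⟨Lα, hLα, hαt⟩ := hα.uniformlyC11 (max ρ (ρy + 1))
  obtain ⟨La, hLa, hat⟩ := ha.uniformlyC11 (max ρ (ρy + 1))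
  set Bx : ℝ := Lf + (Lα + Bs) * Lg with hBx
  set κ : ℝ := (Lf + Lα * Lg) * (W * Lg) ^ 2 + Lα * N * Lg with hκ
  have hBx0 : 0 ≤ Bx := by positivity
  have hκ0 : 0 ≤ κ := by positivity
  refine ⟨min 1 (min (1 / (W * Lg + 1)) (1 / (N + 1))),
    lt_min one_pos (lt_min (by positivity) (by positivity)),
    W * L₁ * (1 + Bx) + Bs * W * L₂ * (1 + Bx) + κ + La * N, by positivity, ?_⟩
  intro ε hε hε₁ T z₀ x η y yv yr yvr hsol hρ hyrc hyvrc hyrB hy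
  have hε1 : ε ≤ 1 := (hε₁.trans_le (min_le_left _ _)).le
  have hεW : ε * W * Lg ≤ 1 := by
    have h := (hε₁.trans_le ((min_le_right _ _).trans (min_le_left _ _))).le
    rw [le_div_iff₀ (by positivity)] at h
    linarith
  have hεN : N * ε ^ 2 ≤ 1 := by
    have h := (hε₁.trans_le ((min_le_right _ _).trans (min_le_right _ _))).le
    rw [le_div_iff₀ (by positivity)] at h
    nlinarith
  have hxρ : ∀ t ∈ Icc 0 T, ‖x t‖ ≤ ρ := fun t ht => (norm_fst_le (x t, η t)).trans (hρ t ht)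
  have hxρ1 : ∀ t ∈ Icc 0 T, ‖x t‖ ≤ ρ + 1 := fun t ht => by linarith [hxρ t ht]
  have hηρ : ∀ t ∈ Icc 0 T, ‖η t‖ ≤ ρ := fun t ht => (norm_snd_le (x t, η t)).trans (hρ t ht)
  have hdist : ∀ t ∈ Icc 0 T, ‖x t - slowState g s ε t (x t)‖ ≤ ε * W * Lg := fun t ht =>
    norm_slowState_sub_le hε.le hW (hgB _ (hxρ1 t ht))
  have hξρ : ∀ t ∈ Icc 0 T, ‖slowState g s ε t (x t)‖ ≤ ρ + 1 := fun t ht => by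
    have := norm_le_norm_add_norm_sub (x t) (slowState g s ε t (x t))
    linarith [hxρ t ht, hdist t ht]
  have hxc : ContinuousOn x (Icc 0 T) := hsol.continuousOn.fst
  have hηc : ContinuousOn η (Icc 0 T) := hsol.continuousOn.snd
  have hSεc : Continuous fun t => zeroMeanPrimitive s (t / ε) := hSc.comp (continuous_id.div_const ε)
  have hξc : ContinuousOn (fun t => slowState g s ε t (x t)) (Icc 0 T) :=
    hxc.sub (((continuous_const.mul hSεc).continuousOn).smul (hg.continuous.comp_continuousOn hxc))
  -- bounds on the controller along the actual and the reference signals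
  have hqr : ∀ t ∈ Icc 0 T, ‖(η t, yr t, yvr t)‖ ≤ max ρ (ρy + 1) := fun t ht =>
    max_le ((hηρ t ht).trans (le_max_left _ _)) (max_le
      ((hyrB t ht).1.trans (le_max_of_le_right (by linarith)))
      ((hyrB t ht).2.trans (le_max_of_le_right (by linarith))))
  have hq : ∀ t ∈ Icc 0 T, ‖(η t, y t, yv t)‖ ≤ max ρ (ρy + 1) := fun t ht => by
    obtain ⟨h1, h2⟩ := hy t ht
    obtain ⟨h3, h4⟩ := hyrB t ht
    refine max_le ((hηρ t ht).trans (le_max_left _ _)) (max_le ?_ ?_)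
    · have := abs_sub_abs_le_abs_sub (y t) (yr t)
      exact le_max_of_le_right (by rw [Real.norm_eq_abs]; linarith)
    · have := abs_sub_abs_le_abs_sub (yv t) (yvr t)
      exact le_max_of_le_right (by rw [Real.norm_eq_abs]; linarith)
  have hqq : ∀ t ∈ Icc 0 T, ‖(η t, y t, yv t) - (η t, yr t, yvr t)‖ ≤ N * ε ^ 2 := fun t ht => by
    simp only [Prod.mk_sub_mk, sub_self]
    exact max_le (by simpa using by positivity) (max_le (hy t ht).1 (hy t ht).2)
  have hαB : ∀ t ∈ Icc 0 T, |α (η t) (y t) (yv t) t| ≤ Lα := fun t ht =>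
    (hαt t ht.1).1 _ (hq t ht)
  have hαd : ∀ t ∈ Icc 0 T,
      |α (η t) (y t) (yv t) t - α (η t) (yr t) (yvr t) t| ≤ Lα * (N * ε ^ 2) := fun t ht =>
    ((hαt t ht.1).2.1 _ _ (hq t ht) (hqr t ht)).trans
      (mul_le_mul_of_nonneg_left (hqq t ht) hLα.le)
  have had : ∀ t ∈ Icc 0 T,
      ‖a (η t) (y t) (yv t) t - a (η t) (yr t) (yvr t) t‖ ≤ La * (N * ε ^ 2) := fun t ht =>
    ((hat t ht.1).2.1 _ _ (hq t ht) (hqr t ht)).trans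
      (mul_le_mul_of_nonneg_left (hqq t ht) hLa.le)
  -- the velocity of the plant state
  set U : ℝ → Vec n := fun τ => f (x τ) + (α (η τ) (y τ) (yv τ) τ + s (τ / ε)) • g (x τ) with hU
  have hUB : ∀ t ∈ Icc 0 T, ‖U t‖ ≤ Bx := fun t ht => by
    refine norm_add_le_of_le (hfB _ (hxρ1 t ht)) ?_
    rw [norm_smul]
    exact mul_le_mul ((norm_add_le _ _).trans (add_le_add (hαB t ht) (hBs _)))
      (hgB _ (hxρ1 t ht)) (norm_nonneg _) (by positivity)
  refine ⟨hξc.prodMk hηc, fun t₀ t h0 h1 h2 => ?_⟩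
  have hsub : Icc t₀ t ⊆ Icc 0 T := Icc_subset_Icc h0 h2
  have hres : IsSolution (injectedField f g α a s ε y yv) (Icc t₀ t) t₀ (x t₀, η t₀)
      (fun t => (x t, η t)) := hsol.restart (t₁ := t₀) ⟨h0, h1.trans h2⟩ hsub
  have hVi : ∀ τ ∈ Icc t₀ t, IntervalIntegrable U volume t₀ τ ∧
      IntervalIntegrable (fun τ => a (η τ) (y τ) (yv τ) τ) volume t₀ τ := fun τ hτ => by
    have h := hres.intervalIntegrable τ hτ
    exact ⟨⟨h.1.fst, h.2.fst⟩, ⟨h.1.snd, h.2.snd⟩⟩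
  have hxη : ∀ τ ∈ Icc t₀ t, x τ = x t₀ + ∫ r in t₀..τ, U r ∧
      η τ = η t₀ + ∫ r in t₀..τ, a (η r) (y r) (yv r) r := fun τ hτ => by
    have h := hres.eq_integral τ hτ
    simp only [injectedField, loopField] at h
    rw [intervalIntegral_prodMk (hVi τ hτ).1 (hVi τ hτ).2, Prod.mk_add_mk, Prod.mk.injEq] at h
    exact h
  have ht : t ∈ Icc t₀ t := right_mem_Icc.2 h1
  have hxlip : ∀ τ ∈ Icc t₀ t, ∀ τ' ∈ Icc t₀ t, ‖x τ - x τ'‖ ≤ Bx * |τ - τ'| := by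
    intro τ hτ τ' hτ'
    rw [(hxη τ hτ).1, (hxη τ' hτ').1, add_sub_add_left_eq_sub,
      intervalIntegral.integral_interval_sub_left (hVi τ hτ).1 (hVi τ' hτ').1]
    exact intervalIntegral.norm_integral_le_of_norm_le_const fun r hr =>
      hUB r (hsub (uIcc_subset_Icc hτ' hτ (uIoc_subset_uIcc hr)))
  obtain ⟨hvi, hve⟩ := slowState_sub_eq_integral hg1 hs_meas ⟨Bs, hBs⟩ hε h1 (hVi t ht).1
    (fun τ hτ => hUB τ (hsub hτ)) (fun τ hτ => (hxη τ hτ).1)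
  set v : ℝ → Vec n := fun τ => U τ - ((ε * zeroMeanPrimitive s (τ / ε)) •
    fderiv ℝ g (x τ) (U τ) + s (τ / ε) • g (x τ)) with hv
  set w : ℝ → Vec n := fun τ => f (slowState g s ε τ (x τ)) +
    α (η τ) (yr τ) (yvr τ) τ • g (slowState g s ε τ (x τ)) with hw
  have hqrc : ContinuousOn (fun τ => (η τ, yr τ, yvr τ, τ)) (Icc t₀ t) :=
    (hηc.prodMk (hyrc.prodMk (hyvrc.prodMk continuousOn_id))).mono hsub
  have hwi : IntervalIntegrable w volume t₀ t := by
    refine ContinuousOn.intervalIntegrable ?_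
    rw [uIcc_of_le h1]
    exact (hf.continuous.comp_continuousOn (hξc.mono hsub)).add
      ((hα.continuous.comp_continuousOn hqrc).smul
        (hg.continuous.comp_continuousOn (hξc.mono hsub)))
  have hari : IntervalIntegrable (fun τ => a (η τ) (yr τ) (yvr τ) τ) volume t₀ t := by
    refine ContinuousOn.intervalIntegrable ?_
    rw [uIcc_of_le h1]
    exact ha.continuous.comp_continuousOn hqrc
  -- the oscillating contributions of first order
  have hc₁x : ContinuousOn (fun τ => c₁ (x τ)) (Icc t₀ t) :=
    hc₁C.continuous.comp_continuousOn (hxc.mono hsub)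
  have hc₂x : ContinuousOn (fun τ => c₂ (x τ)) (Icc t₀ t) :=
    hc₂C.continuous.comp_continuousOn (hxc.mono hsub)
  have hi₁ : IntervalIntegrable (fun τ => zeroMeanPrimitive s (τ / ε) • c₁ (x τ)) volume t₀ t := by
    refine ContinuousOn.intervalIntegrable ?_
    rw [uIcc_of_le h1]
    exact hSεc.continuousOn.smul hc₁x
  have hsSmeas : Measurable fun σ => s σ * zeroMeanPrimitive s σ := hs_meas.mul hSc.measurable
  have hsSB : ∀ σ, |s σ * zeroMeanPrimitive s σ| ≤ Bs * W := fun σ => by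
    rw [abs_mul]
    exact mul_le_mul (hBs σ) (hW σ) (abs_nonneg _) hBs0
  have hi₂ : IntervalIntegrable
      (fun τ => (s (τ / ε) * zeroMeanPrimitive s (τ / ε)) • c₂ (x τ)) volume t₀ t := by
    refine intervalIntegrable_of_norm_le (B := Bs * W * L₂) h1 ?_ fun τ hτ => ?_
    · exact ((hsSmeas.comp (measurable_id.div_const ε)).aestronglyMeasurable).smul
        ((hc₂x.mono Ioc_subset_Icc_self).aestronglyMeasurable measurableSet_Ioc)
    · rw [norm_smul]
      exact mul_le_mul (hsSB _) (hc₂B _ (hxρ1 τ (hsub hτ))) (norm_nonneg _) (by positivity)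
  have hav₁ := norm_integral_periodic_smul_le hSc.measurable hW hSper hSmean hε
    (c := fun τ => c₁ (x τ)) (B := L₁) (Λ := L₁ * Bx) (by positivity) t₀ h1
    (fun τ hτ => hc₁B _ (hxρ1 τ (hsub hτ))) (fun τ hτ τ' hτ' => by
      rw [mul_assoc]
      exact (hc₁lip _ _ (hxρ1 τ (hsub hτ)) (hxρ1 τ' (hsub hτ'))).trans
        (mul_le_mul_of_nonneg_left (hxlip τ hτ τ' hτ') hL₁.le))
  have hav₂ := norm_integral_periodic_smul_le hsSmeas hsSB (hs_per.mul hSper) hsSmean hε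
    (c := fun τ => c₂ (x τ)) (B := L₂) (Λ := L₂ * Bx) (by positivity) t₀ h1
    (fun τ hτ => hc₂B _ (hxρ1 τ (hsub hτ))) (fun τ hτ τ' hτ' => by
      rw [mul_assoc]
      exact (hc₂lip _ _ (hxρ1 τ (hsub hτ)) (hxρ1 τ' (hsub hτ'))).trans
        (mul_le_mul_of_nonneg_left (hxlip τ hτ τ' hτ') hL₂.le))
  set I₁ : ℝ → Vec n := fun τ => zeroMeanPrimitive s (τ / ε) • c₁ (x τ) with hI₁
  set I₂ : ℝ → Vec n := fun τ => (s (τ / ε) * zeroMeanPrimitive s (τ / ε)) • c₂ (x τ) with hI₂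
  have hrem : ‖∫ τ in t₀..t, (v τ - w τ - (ε • I₁ τ - ε • I₂ τ))‖ ≤ κ * ε ^ 2 * |t - t₀| := by
    refine intervalIntegral.norm_integral_le_of_norm_le_const fun τ hτ => ?_
    rw [uIoc_of_le h1] at hτ
    have hτ' := hsub (Ioc_subset_Icc_self hτ)
    refine (norm_slow_velocity_sub_le (hf.differentiable two_ne_zero)
      (hg.differentiable two_ne_zero) hLf.le hLg.le hflip hglip hgB (ε := ε)
      (σ := zeroMeanPrimitive s (τ / ε)) rfl (hxρ1 τ hτ') (hξρ τ hτ') (hαB τ hτ') (hαd τ hτ')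
      (hdist τ hτ')).trans (le_of_eq ?_)
    rw [hκ]
    ring
  have htt : 0 ≤ t - t₀ := by linarith
  rw [abs_of_nonneg htt] at hrem
  have hD : (∫ τ in t₀..t, v τ) - ∫ τ in t₀..t, w τ
      = (∫ τ in t₀..t, (v τ - w τ - (ε • I₁ τ - ε • I₂ τ)))
        + (ε • ∫ τ in t₀..t, I₁ τ) - ε • ∫ τ in t₀..t, I₂ τ := by
    have hj₁ : IntervalIntegrable (fun τ => ε • I₁ τ) volume t₀ t := hi₁.smul ε
    have hj₂ : IntervalIntegrable (fun τ => ε • I₂ τ) volume t₀ t := hi₂.smul ε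
    rw [intervalIntegral.integral_sub (hvi.sub hwi) (hj₁.sub hj₂),
      intervalIntegral.integral_sub hvi hwi, intervalIntegral.integral_sub hj₁ hj₂,
      intervalIntegral.integral_smul, intervalIntegral.integral_smul]
    abel
  have hone : ∀ b c : ℝ, 0 ≤ b → 0 ≤ c → b * (1 + c * (t - t₀)) ≤ b * (1 + c) * (1 + (t - t₀)) :=
    fun b c hb hc => by
      have : 0 ≤ b * (t - t₀) + b * c := by positivity
      nlinarith
  have hfst : ‖(∫ τ in t₀..t, v τ) - ∫ τ in t₀..t, w τ‖
      ≤ (W * L₁ * (1 + Bx) + Bs * W * L₂ * (1 + Bx) + κ + La * N) * ε ^ 2 * (1 + (t - t₀)) := by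
    have h₁ : ‖ε • ∫ τ in t₀..t, I₁ τ‖ ≤ ε ^ 2 * (W * L₁ * (1 + Bx) * (1 + (t - t₀))) := by
      rw [norm_smul, Real.norm_of_nonneg hε.le]
      refine (mul_le_mul_of_nonneg_left hav₁ hε.le).trans ?_
      calc ε * (W * ε * (L₁ + L₁ * Bx * (t - t₀)))
          = ε ^ 2 * (W * L₁ * (1 + Bx * (t - t₀))) := by ring
        _ ≤ _ := mul_le_mul_of_nonneg_left (hone _ _ (by positivity) hBx0) (by positivity)
    have h₂ : ‖ε • ∫ τ in t₀..t, I₂ τ‖ ≤ ε ^ 2 * (Bs * W * L₂ * (1 + Bx) * (1 + (t - t₀))) := by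
      rw [norm_smul, Real.norm_of_nonneg hε.le]
      refine (mul_le_mul_of_nonneg_left hav₂ hε.le).trans ?_
      calc ε * (Bs * W * ε * (L₂ + L₂ * Bx * (t - t₀)))
          = ε ^ 2 * (Bs * W * L₂ * (1 + Bx * (t - t₀))) := by ring
        _ ≤ _ := mul_le_mul_of_nonneg_left (hone _ _ (by positivity) hBx0) (by positivity)
    rw [hD]
    have h₃ : κ * ε ^ 2 * (t - t₀) ≤ κ * ε ^ 2 * (1 + (t - t₀)) :=
      mul_le_mul_of_nonneg_left (by linarith) (by positivity)
    have h₄ : 0 ≤ La * N * ε ^ 2 * (1 + (t - t₀)) := by positivity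
    calc _ ≤ κ * ε ^ 2 * (1 + (t - t₀)) + ε ^ 2 * (W * L₁ * (1 + Bx) * (1 + (t - t₀)))
          + ε ^ 2 * (Bs * W * L₂ * (1 + Bx) * (1 + (t - t₀))) :=
          norm_sub_le_of_le (norm_add_le_of_le (hrem.trans h₃) h₁) h₂
      _ ≤ κ * ε ^ 2 * (1 + (t - t₀)) + ε ^ 2 * (W * L₁ * (1 + Bx) * (1 + (t - t₀)))
          + ε ^ 2 * (Bs * W * L₂ * (1 + Bx) * (1 + (t - t₀)))
          + La * N * ε ^ 2 * (1 + (t - t₀)) := le_add_of_nonneg_right h₄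
      _ = _ := by ring
  have hsnd : ‖∫ τ in t₀..t, (a (η τ) (y τ) (yv τ) τ - a (η τ) (yr τ) (yvr τ) τ)‖
      ≤ (W * L₁ * (1 + Bx) + Bs * W * L₂ * (1 + Bx) + κ + La * N) * ε ^ 2 * (1 + (t - t₀)) := by
    have h₁ : ‖∫ τ in t₀..t, (a (η τ) (y τ) (yv τ) τ - a (η τ) (yr τ) (yvr τ) τ)‖
        ≤ La * (N * ε ^ 2) * |t - t₀| :=
      intervalIntegral.norm_integral_le_of_norm_le_const fun τ hτ => by
        rw [uIoc_of_le h1] at hτ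
        exact had τ (hsub (Ioc_subset_Icc_self hτ))
    rw [abs_of_nonneg htt] at h₁
    have h₂ : La * (N * ε ^ 2) * (t - t₀) ≤ La * (N * ε ^ 2) * (1 + (t - t₀)) :=
      mul_le_mul_of_nonneg_left (by linarith) (by positivity)
    have h₃ : 0 ≤ (W * L₁ * (1 + Bx) + Bs * W * L₂ * (1 + Bx) + κ) * ε ^ 2 * (1 + (t - t₀)) := by
      positivity
    calc _ ≤ (W * L₁ * (1 + Bx) + Bs * W * L₂ * (1 + Bx) + κ) * ε ^ 2 * (1 + (t - t₀))
          + La * (N * ε ^ 2) * (1 + (t - t₀)) := le_add_of_nonneg_of_le h₃ (h₁.trans h₂)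
      _ = _ := by ring
  -- in the difference with the integral equation only the two estimated integrals are left
  have hfin : (slowState g s ε t (x t), η t) - (slowState g s ε t₀ (x t₀), η t₀)
      - ∫ τ in t₀..t, loopField f g α a (yr τ) (yvr τ) 0 τ (slowState g s ε τ (x τ), η τ)
      = ((∫ τ in t₀..t, v τ) - ∫ τ in t₀..t, w τ,
        ∫ τ in t₀..t, (a (η τ) (y τ) (yv τ) τ - a (η τ) (yr τ) (yvr τ) τ)) := by
    simp only [loopField, add_zero]
    rw [intervalIntegral_prodMk hwi hari, Prod.mk_sub_mk, Prod.mk_sub_mk, hve,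
      intervalIntegral.integral_sub (hVi t ht).2 hari, (hxη t ht).2, add_sub_cancel_left]
  rw [hfin]
  exact max_le hfst hsnd

end SlowDefect

/-! ### Existence of solutions of the injected system -/

section Existence

variable {n p : ℕ} {f g : Vec n → Vec n} {α : Vec p → ℝ → ℝ → ℝ → ℝ} {a : Vec p → ℝ → ℝ → ℝ → Vec p}
  {s : ℝ → ℝ}

/-- A time-dependent output map `Y t x` that is bounded and Lipschitz in the state on bounded sets,
uniformly in `t ≥ 0`, and measurable in time along continuous curves. -/
structure IsOutputMap (Y : ℝ → Vec n → ℝ) : Prop where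
  bound : ∀ ρ : ℝ, ∃ L : ℝ, 0 < L ∧ ∀ t, 0 ≤ t → (∀ x, ‖x‖ ≤ ρ → |Y t x| ≤ L) ∧
    ∀ x x', ‖x‖ ≤ ρ → ‖x'‖ ≤ ρ → |Y t x - Y t x'| ≤ L * ‖x - x'‖
  aestronglyMeasurable : ∀ x : ℝ → Vec n, Continuous x →
    AEStronglyMeasurable (fun t => Y t (x t)) (volume.restrict (Ici 0))

/-- If no solution of the loop in the ball of radius `ρ` can reach its boundary in finite time, the
loop has a solution. It is obtained from the system cut off outside of that ball. -/
lemma exists_isSolution_injectedField (hf : ContDiff ℝ 2 f) (hg : ContDiff ℝ 2 g)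
    (hα : UniformlyC2 α) (ha : UniformlyC2 a) (hs_meas : Measurable s)
    (hs_bdd : ∃ B : ℝ, ∀ σ : ℝ, |s σ| ≤ B) {ε ρ : ℝ} {Y Yv : ℝ → Vec n → ℝ} (hY : IsOutputMap Y)
    (hYv : IsOutputMap Yv) {J : Set ℝ} (hJ0 : J ⊆ Ici 0) (hJ : ∀ T ∈ J, Icc 0 T ⊆ J)
    {z₀ : Vec n × Vec p} (hz₀ : ‖z₀‖ < ρ)
    (hapriori : ∀ T ∈ J, ∀ (x : ℝ → Vec n) (η : ℝ → Vec p),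
      IsSolution (injectedField f g α a s ε (fun t => Y t (x t)) (fun t => Yv t (x t)))
        (Icc 0 T) 0 z₀ (fun t => (x t, η t)) →
      (∀ t ∈ Icc 0 T, ‖(x t, η t)‖ ≤ ρ) → ∀ t ∈ Icc 0 T, ‖(x t, η t)‖ < ρ) :
    ∃ (x : ℝ → Vec n) (η : ℝ → Vec p),
      IsSolution (injectedField f g α a s ε (fun t => Y t (x t)) (fun t => Yv t (x t)))
        J 0 z₀ (fun t => (x t, η t)) := by
  have hρ : 0 < ρ := (norm_nonneg _).trans_lt hz₀
  obtain ⟨Bs, hBs⟩ := hs_bdd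
  obtain ⟨L₁, hL₁, hYt⟩ := hY.bound ρ
  obtain ⟨L₂, hL₂, hYvt⟩ := hYv.bound ρ
  obtain ⟨L, hL, hLt⟩ := uniformlyC11_loopField hf hg hα ha (max (max L₁ L₂) (max Bs ρ))
  set q : ℝ → Vec n × Vec p → ℝ × ℝ × ℝ × Vec n × Vec p := fun t z =>
    (Y t (ballRetraction ρ z).1, Yv t (ballRetraction ρ z).1, s (t / ε), ballRetraction ρ z) with hq
  -- evaluating the loop at the retraction makes it bounded and globally Lipschitz
  set V : ℝ → Vec n × Vec p → Vec n × Vec p := fun t z =>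
    loopField f g α a (q t z).1 (q t z).2.1 (q t z).2.2.1 t (q t z).2.2.2 with hV
  have hfst : ∀ z : Vec n × Vec p, ‖(ballRetraction ρ z).1‖ ≤ ρ := fun z =>
    (norm_fst_le _).trans (norm_ballRetraction_le hρ z)
  have hqB : ∀ t, 0 ≤ t → ∀ z, ‖q t z‖ ≤ max (max L₁ L₂) (max Bs ρ) := fun t ht z => by
    refine max_le ?_ (max_le ?_ (max_le ?_ ?_))
    · exact ((hYt t ht).1 _ (hfst z)).trans (le_max_of_le_left (le_max_left _ _))
    · exact ((hYvt t ht).1 _ (hfst z)).trans (le_max_of_le_left (le_max_right _ _))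
    · exact (hBs _).trans (le_max_of_le_right (le_max_left _ _))
    · exact (norm_ballRetraction_le hρ z).trans (le_max_of_le_right (le_max_right _ _))
  have hqlip : ∀ t, 0 ≤ t → ∀ z z', ‖q t z - q t z'‖ ≤ (L₁ + L₂ + 1) * (2 * ‖z - z'‖) := by
    intro t ht z z'
    have hr := norm_ballRetraction_sub_le hρ z z'
    have hr1 : ‖(ballRetraction ρ z).1 - (ballRetraction ρ z').1‖ ≤ 2 * ‖z - z'‖ :=
      (norm_fst_le (ballRetraction ρ z - ballRetraction ρ z')).trans hr
    have hn : 0 ≤ 2 * ‖z - z'‖ := by positivity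
    refine max_le ?_ (max_le ?_ (max_le ?_ ?_))
    · refine ((hYt t ht).2 _ _ (hfst z) (hfst z')).trans ?_
      exact mul_le_mul (by linarith) hr1 (norm_nonneg _) (by positivity)
    · refine ((hYvt t ht).2 _ _ (hfst z) (hfst z')).trans ?_
      exact mul_le_mul (by linarith) hr1 (norm_nonneg _) (by positivity)
    · simp only [hq, Prod.snd_sub, Prod.fst_sub, sub_self, norm_zero]
      positivity
    · exact hr.trans (le_mul_of_one_le_left hn (by linarith))
  obtain ⟨z, hz⟩ := exists_isSolution_of_lipschitz (V := V) (t₀ := 0)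
    (L := L * ((L₁ + L₂ + 1) * 2)) (B := L) (by positivity)
    (fun t ht z z' => by
      refine ((hLt t ht).2.1 _ _ (hqB t ht z) (hqB t ht z')).trans ?_
      rw [mul_assoc, mul_assoc]
      exact mul_le_mul_of_nonneg_left (hqlip t ht z z') hL.le)
    (fun t ht z => (hLt t ht).1 _ (hqB t ht z))
    (fun z hz => by
      have hc : Continuous fun t => ballRetraction ρ (z t) :=
        (continuous_ballRetraction hρ).comp hz
      have hs : AEStronglyMeasurable (fun t => s (t / ε)) (volume.restrict (Ici 0)) :=
        (hs_meas.comp (measurable_id.div_const ε)).aestronglyMeasurable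
      have ht : AEStronglyMeasurable (fun t => (t, ballRetraction ρ (z t)))
          (volume.restrict (Ici 0)) := (continuous_id.prodMk hc).aestronglyMeasurable
      have hm := (hY.aestronglyMeasurable _ hc.fst).prodMk
        ((hYv.aestronglyMeasurable _ hc.fst).prodMk (hs.prodMk ht))
      have hV := (continuous_loopField hf.continuous hg.continuous hα ha).comp_aestronglyMeasurable hm
      exact hV) z₀
  have hinactive : ∀ J' ⊆ Ici (0 : ℝ), (∀ t ∈ J', ∀ τ ∈ Icc 0 t, ‖z τ‖ ≤ ρ) →
      IsSolution (injectedField f g α a s ε (fun t => Y t (z t).1) (fun t => Yv t (z t).1))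
        J' 0 z₀ z := by
    intro J' hJ' hle
    refine (hz.mono hJ').congr_field fun t ht τ hτ => ?_
    rw [uIcc_of_le (hJ' ht)] at hτ
    simp only [hV, hq, injectedField, ballRetraction_of_norm_le hρ (hle t ht τ hτ)]
  have hlt : ∀ T ∈ J, ∀ t ∈ Icc 0 T, ‖z t‖ < ρ := by
    intro T hT
    have hsub : Icc 0 T ⊆ Ici (0 : ℝ) := fun x hx => hx.1
    refine lt_of_bootstrap (hz.continuousOn.mono hsub).norm
      (by rwa [hz.apply_initial self_mem_Ici]) fun T' hT' hle => ?_
    exact hapriori T' (hJ T hT hT') (fun t => (z t).1) (fun t => (z t).2)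
      (hinactive (Icc 0 T') (fun x hx => hx.1) fun t ht τ hτ => hle τ ⟨hτ.1, hτ.2.trans ht.2⟩) hle
  exact ⟨fun t => (z t).1, fun t => (z t).2,
    hinactive J hJ0 fun t ht τ hτ => (hlt t ht τ hτ).le⟩

lemma IsOutputMap.of_signal {r : ℝ → ℝ} {B : ℝ} (hB : ∀ t, 0 ≤ t → |r t| ≤ B)
    (hm : AEStronglyMeasurable r (volume.restrict (Ici 0))) :
    IsOutputMap fun t (_ : Vec n) => r t :=
  ⟨fun _ => ⟨|B| + 1, by positivity, fun t ht =>
    ⟨fun _ _ => (hB t ht).trans (by linarith [le_abs_self B]), fun x x' _ _ => by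
      rw [sub_self, abs_zero]; positivity⟩⟩, fun _ _ => hm⟩

/-- The outputs prescribed by the modified control law, with measurable residual `r`. -/
lemma IsOutputMap.of_modified {φ ψ : Vec n → ℝ} (hφ : ContDiff ℝ 1 φ) (hψ : ContDiff ℝ 1 ψ)
    {S r : ℝ → ℝ} {W B : ℝ} (hS : Continuous S) (hW : ∀ σ, |S σ| ≤ W) (hr : Measurable r)
    (hB : ∀ t, 0 ≤ t → |r t| ≤ B) (ε : ℝ) :
    IsOutputMap fun t x => φ x + ε * (-ψ x * S (t / ε)) + r t := by
  have hW0 : 0 ≤ W := (abs_nonneg _).trans (hW 0)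
  constructor
  · intro ρ
    obtain ⟨L, hL, hφB, hφl⟩ := exists_bound_lipschitz_of_contDiff hφ ρ
    obtain ⟨L', hL', hψB, hψl⟩ := exists_bound_lipschitz_of_contDiff hψ ρ
    have hmul : ∀ (u : ℝ) (t b : ℝ), |u| ≤ b → |ε * (-u * S (t / ε))| ≤ |ε| * (b * W) :=
      fun u t b hu => by
        rw [abs_mul, abs_mul, abs_neg]
        have hb : 0 ≤ b := (abs_nonneg _).trans hu
        have := hW (t / ε)
        gcongr
    refine ⟨L + |ε| * (L' * W) + |B|, by positivity, fun t ht => ⟨fun x hx => ?_,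
      fun x x' hx hx' => ?_⟩⟩
    · have h1 : |φ x| ≤ L := hφB x hx
      have h2 := hmul (ψ x) t L' (hψB x hx)
      have h3 := (hB t ht).trans (le_abs_self B)
      exact (abs_add_three _ _ _).trans (by linarith)
    · have h1 : |φ x - φ x'| ≤ L * ‖x - x'‖ := hφl x x' hx hx'
      have h2 := hmul (ψ x - ψ x') t (L' * ‖x - x'‖) (hψl x x' hx hx')
      have e : φ x + ε * (-ψ x * S (t / ε)) + r t - (φ x' + ε * (-ψ x' * S (t / ε)) + r t)
          = (φ x - φ x') + ε * (-(ψ x - ψ x') * S (t / ε)) := by ring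
      rw [e]
      have h3 : 0 ≤ |B| * ‖x - x'‖ := by positivity
      calc _ ≤ _ := abs_add_le _ _
        _ ≤ L * ‖x - x'‖ + |ε| * (L' * ‖x - x'‖ * W) + |B| * ‖x - x'‖ := by linarith
        _ = _ := by ring
  · intro x hx
    have h1 : Continuous fun t => φ (x t) + ε * (-ψ (x t) * S (t / ε)) :=
      (hφ.continuous.comp hx).add (continuous_const.mul ((hψ.continuous.comp hx).neg.mul
        (hS.comp (continuous_id.div_const ε))))
    exact (h1.measurable.add hr).aestronglyMeasurable

end Existence

/-! ### A priori estimates for the injected systems -/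

section APriori

variable {n p : ℕ} {f g : Vec n → Vec n} {h : Vec n → ℝ} {α : Vec p → ℝ → ℝ → ℝ → ℝ}
  {a : Vec p → ℝ → ℝ → ℝ → Vec p} {s : ℝ → ℝ} {K : Set (Vec n × Vec p)}

lemma abs_sub_modified_output_le {φ : Vec n → ℝ} (hφ : Differentiable ℝ φ) {L ρ : ℝ} (hL : 0 ≤ L)
    (hlip : ∀ z z', ‖z‖ ≤ ρ → ‖z'‖ ≤ ρ → ‖φ z - φ z'‖ ≤ L * ‖z - z'‖)
    (hdlip : ∀ z z', ‖z‖ ≤ ρ → ‖z'‖ ≤ ρ → ‖fderiv ℝ φ z - fderiv ℝ φ z'‖ ≤ L * ‖z - z'‖)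
    {ε t d e : ℝ} {x xb : Vec n} (hx : ‖x‖ ≤ ρ) (hξ : ‖slowState g s ε t x‖ ≤ ρ) (hxb : ‖xb‖ ≤ ρ)
    (hd : ‖x - slowState g s ε t x‖ ≤ d) (he : ‖slowState g s ε t x - xb‖ ≤ e) :
    |φ xb - (φ x + ε * (-lieDeriv g φ x * zeroMeanPrimitive s (t / ε)))| ≤ L * (e + d ^ 2) := by
  have h1 := (abs_sub_comp_slowState_le hφ hL hdlip hx hξ).trans
    (mul_le_mul_of_nonneg_left (pow_le_pow_left₀ (norm_nonneg _) hd 2) hL)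
  have h2 := (hlip _ _ hξ hxb).trans (mul_le_mul_of_nonneg_left he hL)
  rw [Real.norm_eq_abs] at h2
  rw [abs_sub_comm] at h2 ⊢
  have h3 := abs_add_le (φ x + ε * (-lieDeriv g φ x * zeroMeanPrimitive s (t / ε))
    - φ (slowState g s ε t x)) (φ (slowState g s ε t x) - φ xb)
  rw [sub_add_sub_cancel] at h3
  rw [abs_sub_comm (φ xb)] at h2
  linarith

lemma slowState_zero (hS0 : zeroMeanPrimitive s 0 = 0) (ε : ℝ) (x : Vec n) :
    slowState g s ε 0 x = x := by
  rw [slowState, zero_div, hS0, mul_zero, zero_smul, sub_zero]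

/-- Under the modified control law, a trajectory stays in the ball of radius `ρ + 1`, and its
outputs are those of the nominal trajectory up to `O(ε²)`, uniformly in time. -/
lemma exists_modifiedLoop_estimate (hf : ContDiff ℝ 2 f) (hg : ContDiff ℝ 2 g)
    (hh : ContDiff ℝ 2 h) (hLh : ContDiff ℝ 2 (lieDeriv g h)) (hα : UniformlyC2 α)
    (ha : UniformlyC2 a) (hs_meas : Measurable s) (hs_bdd : ∃ B : ℝ, ∀ σ : ℝ, |s σ| ≤ B)
    (hs_per : Function.Periodic s 1) (hs_mean : ∫ σ in (0 : ℝ)..1, s σ = 0)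
    (hS0 : zeroMeanPrimitive s 0 = 0) (hK : IsCompact K)
    (hKattr : K ⊆ attractionRegion (nominalField f g h α a)) {ρ : ℝ}
    (hρ : ∀ z₀ ∈ K, ∀ z : ℝ → Vec n × Vec p, IsSolution (nominalField f g h α a) (Ici 0) 0 z₀ z →
      ∀ t, 0 ≤ t → ‖z t‖ ≤ ρ) (R : ℝ) :
    ∃ ε₀ > (0 : ℝ), ∃ C : ℝ, ∀ ε ∈ Ioo (0 : ℝ) ε₀, ∀ z₀ ∈ K, ∀ z : ℝ → Vec n × Vec p,
      IsSolution (nominalField f g h α a) (Ici 0) 0 z₀ z → ∀ T : ℝ,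
      ∀ (x : ℝ → Vec n) (η : ℝ → Vec p) (y yv : ℝ → ℝ),
        IsModifiedLoop f g h α a s (kappa g h s) (kappaV g h s) ε R (Icc 0 T) z₀ x η y yv →
        (∀ t ∈ Icc 0 T, ‖(x t, η t)‖ ≤ ρ + 1) → ∀ t ∈ Icc 0 T, ‖(x t, η t)‖ < ρ + 1 ∧
          |y t - h (z t).1| ≤ C * ε ^ 2 ∧ |yv t - lieDeriv g h (z t).1| ≤ C * ε ^ 2 ∧
          |h (z t).1 - (h (x t) + ε * kappa g h s (x t) (t / ε))| ≤ C * ε ^ 2 ∧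
          |lieDeriv g h (z t).1 - (lieDeriv g h (x t) + ε * kappaV g h s (x t) (t / ε))|
            ≤ C * ε ^ 2 := by
  obtain ⟨W, hW⟩ := exists_bound_zeroMeanPrimitive hs_meas hs_bdd hs_per hs_mean
  have hW0 : 0 ≤ W := (abs_nonneg _).trans (hW 0)
  obtain ⟨Lg, hLg, hgB, -, -⟩ := exists_lipschitz_fderiv_of_contDiff hg (ρ + 2)
  obtain ⟨L₁, hL₁, hhB, hhl, hhdl⟩ := exists_lipschitz_fderiv_of_contDiff hh (ρ + 2)
  obtain ⟨L₂, hL₂, hvB, hvl, hvdl⟩ := exists_lipschitz_fderiv_of_contDiff hLh (ρ + 2)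
  obtain ⟨_, C₀, hC₀, δ₀, hδ₀, hshadow⟩ := exists_shadowing
    (continuous_nominalField hf hg hh hLh hα ha) (uniformlyC11_nominalField hf hg hh hLh hα ha)
    hK hKattr (ρ + 2)
  set D : ℝ := W * Lg with hD
  have hD0 : 0 ≤ D := by positivity
  -- `N` bounds the residual together with the Taylor remainder of the outputs at the slow state
  set N : ℝ := |R| + (L₁ + L₂) * D ^ 2 with hN
  have hN0 : 0 ≤ N := by positivity
  obtain ⟨ε₁, hε₁, C₁, hC₁, hdef⟩ := exists_hasDefect_slowState hf hg hα ha hs_meas hs_bdd hs_per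
    hs_mean (ρ + 1) (max L₁ L₂) hN0
  have hA : 0 < D + C₀ * C₁ + C₁ / δ₀ + 1 := by positivity
  refine ⟨min ε₁ (1 / (D + C₀ * C₁ + C₁ / δ₀ + 1)), lt_min hε₁ (by positivity),
    |R| + (L₁ + L₂) * (C₀ * C₁ + D ^ 2), ?_⟩
  rintro ε ⟨hε, hεlt⟩ z₀ hz₀ z hz T x η y yv hloop hball t ht
  have hεA : ε * (D + C₀ * C₁ + C₁ / δ₀ + 1) < 1 := by
    have := hεlt.trans_le (min_le_right _ _)
    rwa [lt_div_iff₀ hA] at this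
  have p1 : 0 ≤ ε * D := by positivity
  have p2 : 0 ≤ ε * (C₀ * C₁) := by positivity
  have p3 : 0 ≤ ε * (C₁ / δ₀) := by positivity
  have hsum : ε * D + ε * (C₀ * C₁) + ε * (C₁ / δ₀) + ε < 1 := by linarith
  have hε1 : ε ≤ 1 := by linarith
  have hεsq : ε ^ 2 ≤ ε := by nlinarith
  have hδ : C₁ * ε ^ 2 ≤ δ₀ := by
    have h1 : ε * (C₁ / δ₀) ≤ 1 := by linarith
    rw [← mul_div_assoc, div_le_one hδ₀] at h1
    nlinarith
  have hT : 0 ≤ T := ht.1.trans ht.2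
  have hxB : ∀ t ∈ Icc 0 T, ‖x t‖ ≤ ρ + 2 := fun t ht => by
    linarith [(norm_fst_le (x t, η t)).trans (hball t ht)]
  have hdist : ∀ t ∈ Icc 0 T, ‖x t - slowState g s ε t (x t)‖ ≤ ε * D := fun t ht =>
    (norm_slowState_sub_le hε.le hW (hgB _ (hxB t ht))).trans_eq (mul_assoc _ _ _)
  have hξB : ∀ t ∈ Icc 0 T, ‖slowState g s ε t (x t)‖ ≤ ρ + 2 := fun t ht => by
    have h1 := norm_le_norm_add_norm_sub (x t) (slowState g s ε t (x t))
    linarith [hdist t ht, (norm_fst_le (x t, η t)).trans (hball t ht)]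
  have hxc : ContinuousOn x (Icc 0 T) := hloop.isSolution.continuousOn.fst
  have hξc : ContinuousOn (fun t => slowState g s ε t (x t)) (Icc 0 T) :=
    hxc.sub (((continuous_const.mul ((continuous_zeroMeanPrimitive hs_meas hs_bdd).comp
      (continuous_id.div_const ε))).continuousOn).smul (hg.continuous.comp_continuousOn hxc))
  have hd2 : ∀ L : ℝ, 0 ≤ L → ∀ t ∈ Icc 0 T,
      L * ‖x t - slowState g s ε t (x t)‖ ^ 2 ≤ L * D ^ 2 * ε ^ 2 := fun L hL t ht => by
    have := pow_le_pow_left₀ (norm_nonneg _) (hdist t ht) 2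
    calc _ ≤ L * (ε * D) ^ 2 := mul_le_mul_of_nonneg_left this hL
      _ = _ := by ring
  have hε2 : 0 ≤ ε ^ 2 := sq_nonneg ε
  have hRε : R * ε ^ 2 ≤ |R| * ε ^ 2 := mul_le_mul_of_nonneg_right (le_abs_self R) hε2
  have hx1 : 0 ≤ L₁ * D ^ 2 * ε ^ 2 := by positivity
  have hx2 : 0 ≤ L₂ * D ^ 2 * ε ^ 2 := by positivity
  have hd := hdef ε hε (hεlt.trans_le (min_le_left _ _)) T z₀ x η y yv
    (fun t => h (slowState g s ε t (x t))) (fun t => lieDeriv g h (slowState g s ε t (x t)))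
    hloop.isSolution hball (hh.continuous.comp_continuousOn hξc)
    (hLh.continuous.comp_continuousOn hξc)
    (fun t ht => ⟨(hhB _ (hξB t ht)).trans (le_max_left _ _),
      (hvB _ (hξB t ht)).trans (le_max_right _ _)⟩)
    (fun t ht => by
      constructor
      · have h1 := (abs_sub_comp_slowState_le (hh.differentiable two_ne_zero) hL₁.le hhdl
          (hxB t ht) (hξB t ht)).trans (hd2 L₁ hL₁.le t ht)
        have h2 := abs_sub_le (y t) _ (h (slowState g s ε t (x t))) |>.trans
          (add_le_add (hloop.output t ht) h1)
        rw [hN]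
        linarith
      · have h1 := (abs_sub_comp_slowState_le (hLh.differentiable two_ne_zero) hL₂.le hvdl
          (hxB t ht) (hξB t ht)).trans (hd2 L₂ hL₂.le t ht)
        have h2 := abs_sub_le (yv t) _ (lieDeriv g h (slowState g s ε t (x t))) |>.trans
          (add_le_add (hloop.virtualOutput t ht) h1)
        rw [hN]
        linarith)
  -- with the outputs at the slow state as references, the averaged system is the nominal loop
  have hd' : HasDefect (nominalField f g h α a) 0 T (C₁ * ε ^ 2)
      (fun t => (slowState g s ε t (x t), η t)) := ⟨hd.continuousOn, hd.defect⟩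
  have hclose := (hshadow z₀ hz₀ z hz).2 T (C₁ * ε ^ 2) hT (by positivity) hδ _ hd'
    (by
      simp only [slowState_zero hS0]
      exact hloop.isSolution.apply_initial (left_mem_Icc.2 hT))
    (fun t ht => max_le (hξB t ht) (by
      linarith [(norm_snd_le (x t, η t)).trans (hball t ht)])) t ht
  have hclose1 : ‖slowState g s ε t (x t) - (z t).1‖ ≤ C₀ * (C₁ * ε ^ 2) :=
    (norm_fst_le ((slowState g s ε t (x t), η t) - z t)).trans hclose
  have hzt : ‖z t‖ ≤ ρ := hρ z₀ hz₀ z hz t ht.1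
  have hz1 : ‖(z t).1‖ ≤ ρ + 2 := by linarith [norm_fst_le (z t)]
  have o1 := abs_sub_modified_output_le (hh.differentiable two_ne_zero) hL₁.le hhl hhdl
    (hxB t ht) (hξB t ht) hz1 (hdist t ht) hclose1
  have o2 := abs_sub_modified_output_le (hLh.differentiable two_ne_zero) hL₂.le hvl hvdl
    (hxB t ht) (hξB t ht) hz1 (hdist t ht) hclose1
  have e1 : ∀ L : ℝ, L * (C₀ * (C₁ * ε ^ 2) + (ε * D) ^ 2) = L * (C₀ * C₁ + D ^ 2) * ε ^ 2 :=
    fun L => by ring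
  rw [e1] at o1 o2
  have q1 : 0 ≤ L₁ * (C₀ * C₁ + D ^ 2) * ε ^ 2 := by positivity
  have q2 : 0 ≤ L₂ * (C₀ * C₁ + D ^ 2) * ε ^ 2 := by positivity
  have q3 : 0 ≤ |R| * ε ^ 2 := by positivity
  have e2 : (|R| + (L₁ + L₂) * (C₀ * C₁ + D ^ 2)) * ε ^ 2 = |R| * ε ^ 2
      + L₁ * (C₀ * C₁ + D ^ 2) * ε ^ 2 + L₂ * (C₀ * C₁ + D ^ 2) * ε ^ 2 := by ring
  rw [e2]
  refine ⟨?_, ?_, ?_, ?_, ?_⟩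
  · have h1 : ‖(x t, η t) - (slowState g s ε t (x t), η t)‖ ≤ ε * D := by
      rw [Prod.mk_sub_mk, sub_self]
      exact max_le (hdist t ht) (by simpa using p1)
    have h2 := norm_le_norm_add_norm_sub' (x t, η t) (slowState g s ε t (x t), η t)
    have h3 := norm_le_norm_add_norm_sub' (slowState g s ε t (x t), η t) (z t)
    have h4 : C₀ * (C₁ * ε ^ 2) ≤ ε * (C₀ * C₁) := by
      have : 0 ≤ C₀ * C₁ := by positivity
      nlinarith
    linarith
  · have h2 := (abs_sub_le (y t) _ (h (z t).1)).trans
      (add_le_add (hloop.output t ht) ((abs_sub_comm _ _).trans_le o1))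
    linarith
  · have h2 := (abs_sub_le (yv t) _ (lieDeriv g h (z t).1)).trans
      (add_le_add (hloop.virtualOutput t ht) ((abs_sub_comm _ _).trans_le o2))
    linarith
  · exact o1.trans (by linarith)
  · exact o2.trans (by linarith)

/-- When the controller is fed with the nominal outputs, the nominal outputs are on a bounded
horizon those which the modified control law prescribes, up to `O(ε²)`. -/
lemma exists_nominalSignal_estimate (hf : ContDiff ℝ 2 f) (hg : ContDiff ℝ 2 g)
    (hh : ContDiff ℝ 2 h) (hLh : ContDiff ℝ 2 (lieDeriv g h)) (hα : UniformlyC2 α)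
    (ha : UniformlyC2 a) (hs_meas : Measurable s) (hs_bdd : ∃ B : ℝ, ∀ σ : ℝ, |s σ| ≤ B)
    (hs_per : Function.Periodic s 1) (hs_mean : ∫ σ in (0 : ℝ)..1, s σ = 0)
    (hS0 : zeroMeanPrimitive s 0 = 0) {ρ : ℝ}
    (hρ : ∀ z₀ ∈ K, ∀ z : ℝ → Vec n × Vec p, IsSolution (nominalField f g h α a) (Ici 0) 0 z₀ z →
      ∀ t, 0 ≤ t → ‖z t‖ ≤ ρ) {T : ℝ} (hT : 0 < T) :
    ∃ ε₀ > (0 : ℝ), ∃ C : ℝ, ∀ ε ∈ Ioo (0 : ℝ) ε₀, ∀ z₀ ∈ K, ∀ z : ℝ → Vec n × Vec p,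
      IsSolution (nominalField f g h α a) (Ici 0) 0 z₀ z → ∀ T' ∈ Icc 0 T,
      ∀ (x : ℝ → Vec n) (η : ℝ → Vec p),
        IsSolution (injectedField f g α a s ε (fun t => h (z t).1)
          (fun t => lieDeriv g h (z t).1)) (Icc 0 T') 0 z₀ (fun t => (x t, η t)) →
        (∀ t ∈ Icc 0 T', ‖(x t, η t)‖ ≤ ρ + 1) → ∀ t ∈ Icc 0 T', ‖(x t, η t)‖ < ρ + 1 ∧
          |h (z t).1 - (h (x t) + ε * kappa g h s (x t) (t / ε))| ≤ C * ε ^ 2 ∧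
          |lieDeriv g h (z t).1 - (lieDeriv g h (x t) + ε * kappaV g h s (x t) (t / ε))|
            ≤ C * ε ^ 2 := by
  obtain ⟨W, hW⟩ := exists_bound_zeroMeanPrimitive hs_meas hs_bdd hs_per hs_mean
  have hW0 : 0 ≤ W := (abs_nonneg _).trans (hW 0)
  obtain ⟨Lg, hLg, hgB, -, -⟩ := exists_lipschitz_fderiv_of_contDiff hg (ρ + 2)
  obtain ⟨L₁, hL₁, hhB, hhl, hhdl⟩ := exists_lipschitz_fderiv_of_contDiff hh (ρ + 2)
  obtain ⟨L₂, hL₂, hvB, hvl, hvdl⟩ := exists_lipschitz_fderiv_of_contDiff hLh (ρ + 2)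
  obtain ⟨L, hL, hLt⟩ := uniformlyC11_loopField hf hg hα ha (max (max L₁ L₂) (ρ + 2))
  set D : ℝ := W * Lg with hD
  have hD0 : 0 ≤ D := by positivity
  obtain ⟨ε₁, hε₁, C₁, hC₁, hdef⟩ := exists_hasDefect_slowState hf hg hα ha hs_meas hs_bdd hs_per
    hs_mean (ρ + 1) (max L₁ L₂) le_rfl
  set C₀ : ℝ := (1 + T) * Real.exp (L * T) with hC₀def
  have hC₀ : 0 ≤ C₀ := by positivity
  have hA : 0 < D + C₀ * C₁ + 1 := by positivity
  refine ⟨min ε₁ (1 / (D + C₀ * C₁ + 1)), lt_min hε₁ (by positivity),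
    (L₁ + L₂) * (C₀ * C₁ + D ^ 2), ?_⟩
  rintro ε ⟨hε, hεlt⟩ z₀ hz₀ z hz T' hT' x η hsol hball t ht
  have hεA : ε * (D + C₀ * C₁ + 1) < 1 := by
    have := hεlt.trans_le (min_le_right _ _)
    rwa [lt_div_iff₀ hA] at this
  have p1 : 0 ≤ ε * D := by positivity
  have p2 : 0 ≤ ε * (C₀ * C₁) := by positivity
  have hsum : ε * D + ε * (C₀ * C₁) + ε < 1 := by linarith
  have hεsq : ε ^ 2 ≤ ε := by nlinarith
  have hε2 : 0 ≤ ε ^ 2 := sq_nonneg ε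
  have hsub : Icc 0 T' ⊆ Ici (0 : ℝ) := fun x hx => hx.1
  have hxB : ∀ t ∈ Icc 0 T', ‖x t‖ ≤ ρ + 2 := fun t ht => by
    linarith [(norm_fst_le (x t, η t)).trans (hball t ht)]
  have hdist : ∀ t ∈ Icc 0 T', ‖x t - slowState g s ε t (x t)‖ ≤ ε * D := fun t ht =>
    (norm_slowState_sub_le hε.le hW (hgB _ (hxB t ht))).trans_eq (mul_assoc _ _ _)
  have hξB : ∀ t ∈ Icc 0 T', ‖slowState g s ε t (x t)‖ ≤ ρ + 2 := fun t ht => by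
    have h1 := norm_le_norm_add_norm_sub (x t) (slowState g s ε t (x t))
    linarith [hdist t ht, (norm_fst_le (x t, η t)).trans (hball t ht)]
  have hzρ : ∀ t ∈ Icc 0 T', ‖z t‖ ≤ ρ := fun t ht => hρ z₀ hz₀ z hz t ht.1
  have hz1 : ∀ t ∈ Icc 0 T', ‖(z t).1‖ ≤ ρ + 2 := fun t ht => by
    linarith [hzρ t ht, norm_fst_le (z t)]
  have hzc : ContinuousOn (fun t => (z t).1) (Icc 0 T') := (hz.continuousOn.mono hsub).fst
  have hyc : ContinuousOn (fun t => h (z t).1) (Icc 0 T') := hh.continuous.comp_continuousOn hzc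
  have hyvc : ContinuousOn (fun t => lieDeriv g h (z t).1) (Icc 0 T') :=
    hLh.continuous.comp_continuousOn hzc
  have hyB : ∀ t ∈ Icc 0 T', |h (z t).1| ≤ max L₁ L₂ ∧ |lieDeriv g h (z t).1| ≤ max L₁ L₂ :=
    fun t ht => ⟨(hhB _ (hz1 t ht)).trans (le_max_left _ _),
      (hvB _ (hz1 t ht)).trans (le_max_right _ _)⟩
  have hd := hdef ε hε (hεlt.trans_le (min_le_left _ _)) T' z₀ x η _ _
    (fun t => h (z t).1) (fun t => lieDeriv g h (z t).1) hsol hball hyc hyvc hyB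
    (fun t _ => by simp)
  -- the nominal trajectory solves the system fed with its own outputs
  have hnom : HasDefect (fun t w => loopField f g α a (h (z t).1) (lieDeriv g h (z t).1) 0 t w)
      0 T' 0 z := ⟨(hz.mono hsub).hasDefect.continuousOn, (hz.mono hsub).hasDefect.defect⟩
  have hcont : ContinuousOn (fun q : ℝ × Vec n × Vec p =>
      loopField f g α a (h (z q.1).1) (lieDeriv g h (z q.1).1) 0 q.1 q.2) (Icc 0 T' ×ˢ univ) := by
    have hm : MapsTo (Prod.fst : ℝ × Vec n × Vec p → ℝ) (Icc 0 T' ×ˢ univ) (Icc 0 T') :=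
      fun q hq => hq.1
    have h1 := (hyc.comp continuousOn_fst hm).prodMk ((hyvc.comp continuousOn_fst hm).prodMk
      ((continuousOn_const (c := (0 : ℝ))).prodMk
        (continuousOn_id (s := Icc (0 : ℝ) T' ×ˢ (univ : Set (Vec n × Vec p))))))
    have h2 := (continuous_loopField hf.continuous hg.continuous hα ha).comp_continuousOn h1
    exact h2
  have hlip : ∀ t ∈ Icc 0 T', ∀ w w' : Vec n × Vec p, ‖w‖ ≤ ρ + 2 → ‖w'‖ ≤ ρ + 2 →
      ‖loopField f g α a (h (z t).1) (lieDeriv g h (z t).1) 0 t w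
        - loopField f g α a (h (z t).1) (lieDeriv g h (z t).1) 0 t w'‖ ≤ L * ‖w - w'‖ := by
    intro t ht w w' hw hw'
    have hB : ∀ w : Vec n × Vec p, ‖w‖ ≤ ρ + 2 →
        ‖(h (z t).1, lieDeriv g h (z t).1, (0 : ℝ), w)‖ ≤ max (max L₁ L₂) (ρ + 2) := fun w hw =>
      max_le ((hyB t ht).1.trans (le_max_left _ _)) (max_le ((hyB t ht).2.trans (le_max_left _ _))
        (max_le (by rw [norm_zero]; positivity) (hw.trans (le_max_right _ _))))
    refine ((hLt t ht.1).2.1 _ _ (hB w hw) (hB w' hw')).trans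
      (mul_le_mul_of_nonneg_left ?_ hL.le)
    simp only [Prod.mk_sub_mk, sub_self]
    exact max_le (by simp) (max_le (by simp) (max_le (by simp) le_rfl))
  have hclose : ∀ t ∈ Icc 0 T', ‖(slowState g s ε t (x t), η t) - z t‖ ≤ C₀ * (C₁ * ε ^ 2) := by
    intro t ht
    have h1 := norm_sub_le_of_hasDefect hcont hL.le hlip hd hnom
      (fun t ht => max_le (hξB t ht) (by
        linarith [(norm_snd_le (x t, η t)).trans (hball t ht)]))
      (fun t ht => by linarith [hzρ t ht]) (by positivity) t ht
    have h0 : (slowState g s ε 0 (x 0), η 0) = z 0 := by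
      rw [slowState_zero hS0, hz.apply_initial self_mem_Ici]
      exact hsol.apply_initial (left_mem_Icc.2 hT'.1)
    rw [h0, sub_self, norm_zero, zero_add, add_zero, sub_zero, sub_zero] at h1
    have h2 : Real.exp (L * t) ≤ Real.exp (L * T) :=
      Real.exp_le_exp.2 (mul_le_mul_of_nonneg_left (ht.2.trans hT'.2) hL.le)
    have h3 := hT'.1
    calc _ ≤ C₁ * ε ^ 2 * (1 + T') * Real.exp (L * t) := h1
      _ ≤ C₁ * ε ^ 2 * (1 + T) * Real.exp (L * T) := by
          gcongr
          exact hT'.2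
      _ = _ := by rw [hC₀def]; ring
  have hclose1 : ‖slowState g s ε t (x t) - (z t).1‖ ≤ C₀ * (C₁ * ε ^ 2) :=
    (norm_fst_le ((slowState g s ε t (x t), η t) - z t)).trans (hclose t ht)
  have o1 := abs_sub_modified_output_le (hh.differentiable two_ne_zero) hL₁.le hhl hhdl
    (hxB t ht) (hξB t ht) (hz1 t ht) (hdist t ht) hclose1
  have o2 := abs_sub_modified_output_le (hLh.differentiable two_ne_zero) hL₂.le hvl hvdl
    (hxB t ht) (hξB t ht) (hz1 t ht) (hdist t ht) hclose1
  have e1 : ∀ L : ℝ, L * (C₀ * (C₁ * ε ^ 2) + (ε * D) ^ 2) = L * (C₀ * C₁ + D ^ 2) * ε ^ 2 :=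
    fun L => by ring
  rw [e1] at o1 o2
  have q1 : 0 ≤ L₁ * (C₀ * C₁ + D ^ 2) * ε ^ 2 := by positivity
  have q2 : 0 ≤ L₂ * (C₀ * C₁ + D ^ 2) * ε ^ 2 := by positivity
  have e2 : (L₁ + L₂) * (C₀ * C₁ + D ^ 2) * ε ^ 2 = L₁ * (C₀ * C₁ + D ^ 2) * ε ^ 2
      + L₂ * (C₀ * C₁ + D ^ 2) * ε ^ 2 := by ring
  rw [e2]
  refine ⟨?_, o1.trans (by linarith), o2.trans (by linarith)⟩
  have h1 : ‖(x t, η t) - (slowState g s ε t (x t), η t)‖ ≤ ε * D := by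
    rw [Prod.mk_sub_mk, sub_self]
    exact max_le (hdist t ht) (by simpa using p1)
  have h2 := norm_le_norm_add_norm_sub' (x t, η t) (slowState g s ε t (x t), η t)
  have h3 := norm_le_norm_add_norm_sub' (slowState g s ε t (x t), η t) (z t)
  have h4 : C₀ * (C₁ * ε ^ 2) ≤ ε * (C₀ * C₁) := by
    have : 0 ≤ C₀ * C₁ := by positivity
    nlinarith
  linarith [hclose t ht, hzρ t ht]

end APriori

end SignalInjection

open SignalInjection

/-! ### The controller fed with shifted outputs -/

theorem corollary1 {n p : ℕ} (f g : Vec n → Vec n) (h : Vec n → ℝ)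
    (α : Vec p → ℝ → ℝ → ℝ → ℝ) (a : Vec p → ℝ → ℝ → ℝ → Vec p) (s : ℝ → ℝ)
    (hf : ContDiff ℝ 2 f) (hg : ContDiff ℝ 2 g) (hh : ContDiff ℝ 2 h)
    (hLh : ContDiff ℝ 2 (lieDeriv g h))
    (hα : UniformlyC2 α) (ha : UniformlyC2 a)
    (hs_meas : Measurable s) (hs_bdd : ∃ B : ℝ, ∀ σ : ℝ, |s σ| ≤ B)
    (hs_per : Function.Periodic s 1) (hs_mean : ∫ σ in (0 : ℝ)..1, s σ = 0)
    (hS0 : zeroMeanPrimitive s 0 = 0)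
    (K : Set (Vec n × Vec p)) (hK : IsCompact K)
    (hKattr : K ⊆ attractionRegion (nominalField f g h α a)) :
    -- the chosen `κ` and `κ_v` are admissible in the modified control law
    (∀ x : Vec n, Function.Periodic (kappa g h s x) 1 ∧
      ∫ σ in (0 : ℝ)..1, kappa g h s x σ = 0) ∧
    (∀ x : Vec n, Function.Periodic (kappaV g h s x) 1 ∧
      ∫ σ in (0 : ℝ)..1, kappaV g h s x σ = 0) ∧
    -- under the modified control law with this choice, for all times, the signals fed to the
    -- controller are `h(x̄)` and `L_g h(x̄)` up to `O(ε²)`, and `h(x̄)`, `L_g h(x̄)` satisfy the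
    -- equations by which the law prescribes these signals
    (∀ R : ℝ, ∃ ε₀ > (0 : ℝ), ∃ C : ℝ, ∀ ε ∈ Ioo (0 : ℝ) ε₀, ∀ z₀ ∈ K,
      ∀ (xbar : ℝ → Vec n) (ηbar : ℝ → Vec p),
        IsSolution (nominalField f g h α a) (Ici 0) 0 z₀ (fun t => (xbar t, ηbar t)) →
        (∀ r rv : ℝ → ℝ, Measurable r → Measurable rv →
          (∀ t : ℝ, 0 ≤ t → |r t| ≤ R * ε ^ 2) → (∀ t : ℝ, 0 ≤ t → |rv t| ≤ R * ε ^ 2) →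
          ∃ (x : ℝ → Vec n) (η : ℝ → Vec p) (y yv : ℝ → ℝ),
            IsModifiedLoop f g h α a s (kappa g h s) (kappaV g h s) ε R (Ici 0) z₀ x η y yv ∧
            ∀ t : ℝ, 0 ≤ t →
              y t = h (x t) + ε * kappa g h s (x t) (t / ε) + r t ∧
              yv t = lieDeriv g h (x t) + ε * kappaV g h s (x t) (t / ε) + rv t) ∧
        (∀ (x : ℝ → Vec n) (η : ℝ → Vec p) (y yv : ℝ → ℝ),
          IsModifiedLoop f g h α a s (kappa g h s) (kappaV g h s) ε R (Ici 0) z₀ x η y yv →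
          ∀ t : ℝ, 0 ≤ t →
            |y t - h (xbar t)| ≤ C * ε ^ 2 ∧
            |yv t - lieDeriv g h (xbar t)| ≤ C * ε ^ 2 ∧
            |h (xbar t) - (h (x t) + ε * kappa g h s (x t) (t / ε))| ≤ C * ε ^ 2 ∧
            |lieDeriv g h (xbar t)
              - (lieDeriv g h (x t) + ε * kappaV g h s (x t) (t / ε))| ≤ C * ε ^ 2)) ∧
    -- on every bounded horizon, the controller that is fed with the available signals `h(x̄(t))`
    -- and `L_g h(x̄(t))` themselves implements the modified control law with this choice
    (∀ T > (0 : ℝ), ∃ ε₀ > (0 : ℝ), ∃ C : ℝ, ∀ ε ∈ Ioo (0 : ℝ) ε₀, ∀ z₀ ∈ K,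
      ∀ (xbar : ℝ → Vec n) (ηbar : ℝ → Vec p),
        IsSolution (nominalField f g h α a) (Ici 0) 0 z₀ (fun t => (xbar t, ηbar t)) →
        (∃ (x : ℝ → Vec n) (η : ℝ → Vec p),
          IsSolution (injectedField f g α a s ε
            (fun t => h (xbar t)) (fun t => lieDeriv g h (xbar t)))
            (Icc 0 T) 0 z₀ (fun t => (x t, η t))) ∧
        (∀ (x : ℝ → Vec n) (η : ℝ → Vec p),
          IsSolution (injectedField f g α a s ε
            (fun t => h (xbar t)) (fun t => lieDeriv g h (xbar t)))
            (Icc 0 T) 0 z₀ (fun t => (x t, η t)) →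
          IsModifiedLoop f g h α a s (kappa g h s) (kappaV g h s) ε C (Icc 0 T) z₀ x η
            (fun t => h (xbar t)) (fun t => lieDeriv g h (xbar t)))) := by
  obtain ⟨W, hW⟩ := exists_bound_zeroMeanPrimitive hs_meas hs_bdd hs_per hs_mean
  have hSc := continuous_zeroMeanPrimitive hs_meas hs_bdd
  have hSper := periodic_zeroMeanPrimitive hs_meas hs_bdd hs_per hs_mean
  have hSmean := integral_zeroMeanPrimitive hs_meas hs_bdd
  have hLLh : ContDiff ℝ 1 (lieDeriv g (lieDeriv g h)) :=
    (hLh.fderiv_right (m := 1) (by norm_num)).clm_apply (hg.of_le one_le_two)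
  obtain ⟨ρ, _, _, _, _, hshadow⟩ := exists_shadowing
    (continuous_nominalField hf hg hh hLh hα ha) (uniformlyC11_nominalField hf hg hh hLh hα ha)
    hK hKattr 0
  have hρ : ∀ z₀ ∈ K, ∀ z : ℝ → Vec n × Vec p,
      IsSolution (nominalField f g h α a) (Ici 0) 0 z₀ z → ∀ t, 0 ≤ t → ‖z t‖ ≤ ρ :=
    fun z₀ hz₀ z hz => (hshadow z₀ hz₀ z hz).1
  have hz₀ρ : ∀ z₀ ∈ K, ∀ z : ℝ → Vec n × Vec p,
      IsSolution (nominalField f g h α a) (Ici 0) 0 z₀ z → ‖z₀‖ < ρ + 1 := fun z₀ hz₀ z hz => by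
    have := hρ z₀ hz₀ z hz 0 le_rfl
    rw [hz.apply_initial self_mem_Ici] at this
    linarith
  have hIcc : ∀ T : ℝ, Icc 0 T ⊆ Ici (0 : ℝ) := fun T t ht => ht.1
  refine ⟨fun x => ⟨fun σ => ?_, ?_⟩, fun x => ⟨fun σ => ?_, ?_⟩, fun R => ?_, fun T hT => ?_⟩
  · rw [kappa, kappa, hSper σ]
  · simp only [kappa, intervalIntegral.integral_const_mul, hSmean, mul_zero]
  · rw [kappaV, kappaV, hSper σ]
  · simp only [kappaV, intervalIntegral.integral_const_mul, hSmean, mul_zero]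
  · obtain ⟨ε₀, hε₀, C, hC⟩ := exists_modifiedLoop_estimate hf hg hh hLh hα ha hs_meas hs_bdd
      hs_per hs_mean hS0 hK hKattr hρ R
    refine ⟨ε₀, hε₀, C, fun ε hε z₀ hz₀ xbar ηbar hz => ⟨fun r rv hr hrv hrB hrvB => ?_,
      fun x η y yv hloop t ht => ?_⟩⟩
    · obtain ⟨x, η, hsol⟩ := exists_isSolution_injectedField hf hg hα ha hs_meas hs_bdd (ε := ε)
        (IsOutputMap.of_modified (hh.of_le one_le_two) (hLh.of_le one_le_two) hSc hW hr hrB ε)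
        (IsOutputMap.of_modified (hLh.of_le one_le_two) hLLh hSc hW hrv hrvB ε)
        (J := Ici 0) subset_rfl (fun T _ => hIcc T) (hz₀ρ z₀ hz₀ _ hz)
        (fun T _ x η hsol hball t ht => (hC ε hε z₀ hz₀ _ hz T x η _ _
          ⟨hsol, fun t ht => by simpa [kappa] using hrB t ht.1,
            fun t ht => by simpa [kappaV] using hrvB t ht.1⟩ hball t ht).1)
      exact ⟨x, η, _, _, ⟨hsol, fun t ht => by simpa [kappa] using hrB t ht,
        fun t ht => by simpa [kappaV] using hrvB t ht⟩, fun t _ => ⟨rfl, rfl⟩⟩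
    · have hloopT : ∀ T : ℝ, IsModifiedLoop f g h α a s (kappa g h s) (kappaV g h s) ε R (Icc 0 T)
          z₀ x η y yv := fun T => ⟨hloop.isSolution.mono (hIcc T),
        fun t ht => hloop.output t ht.1, fun t ht => hloop.virtualOutput t ht.1⟩
      have hball : ∀ τ ∈ Icc 0 t, ‖(x τ, η τ)‖ < ρ + 1 := by
        refine lt_of_bootstrap (hloopT t).isSolution.continuousOn.norm ?_
          fun T' _ hle τ hτ => (hC ε hε z₀ hz₀ _ hz T' x η y yv (hloopT T') hle τ hτ).1
        rw [hloop.isSolution.apply_initial self_mem_Ici]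
        exact hz₀ρ z₀ hz₀ _ hz
      exact (hC ε hε z₀ hz₀ _ hz t x η y yv (hloopT t) (fun τ hτ => (hball τ hτ).le) t
        (right_mem_Icc.2 ht)).2
  · obtain ⟨ε₀, hε₀, C, hC⟩ := exists_nominalSignal_estimate hf hg hh hLh hα ha hs_meas hs_bdd
      hs_per hs_mean hS0 hρ hT
    refine ⟨ε₀, hε₀, C, fun ε hε z₀ hz₀ xbar ηbar hz => ⟨?_, fun x η hsol => ?_⟩⟩
    · have hxρ : ∀ t, 0 ≤ t → ‖xbar t‖ ≤ ρ := fun t ht =>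
        (norm_fst_le (xbar t, ηbar t)).trans (hρ z₀ hz₀ _ hz t ht)
      have hxc : ContinuousOn xbar (Ici 0) := hz.continuousOn.fst
      obtain ⟨L₁, _, hhB, _⟩ := exists_bound_lipschitz_of_contDiff (hh.of_le one_le_two) ρ
      obtain ⟨L₂, _, hvB, _⟩ := exists_bound_lipschitz_of_contDiff (hLh.of_le one_le_two) ρ
      exact exists_isSolution_injectedField hf hg hα ha hs_meas hs_bdd
        (IsOutputMap.of_signal (r := fun t => h (xbar t)) (fun t ht => hhB _ (hxρ t ht))
          ((hh.continuous.comp_continuousOn hxc).aestronglyMeasurable measurableSet_Ici))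
        (IsOutputMap.of_signal (r := fun t => lieDeriv g h (xbar t))
          (fun t ht => hvB _ (hxρ t ht))
          ((hLh.continuous.comp_continuousOn hxc).aestronglyMeasurable measurableSet_Ici))
        (hIcc T) (fun T' hT' => Icc_subset_Icc_right hT'.2) (hz₀ρ z₀ hz₀ _ hz)
        (fun T' hT' x η hsol hball t ht => (hC ε hε z₀ hz₀ _ hz T' hT' x η hsol hball t ht).1)
    · have hball : ∀ τ ∈ Icc 0 T, ‖(x τ, η τ)‖ < ρ + 1 := by
        refine lt_of_bootstrap hsol.continuousOn.norm ?_ fun T' hT' hle τ hτ =>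
          (hC ε hε z₀ hz₀ _ hz T' hT' x η (hsol.mono (Icc_subset_Icc_right hT'.2)) hle τ hτ).1
        rw [hsol.apply_initial (left_mem_Icc.2 hT.le)]
        exact hz₀ρ z₀ hz₀ _ hz
      have hest := hC ε hε z₀ hz₀ _ hz T (right_mem_Icc.2 hT.le) x η hsol
        fun τ hτ => (hball τ hτ).le
      exact ⟨hsol, fun t ht => (hest t ht).2.1, fun t ht => (hest t ht).2.2⟩
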